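/- **Setting.** Let $L>0$ and $1<p<\infty$. For every $s\in[0,L]$ let the material cross-section $\mathcal A(s)\subset\mathbb R^2$ be compact and simply connected with $0\in\operatorname{int}\mathcal A(s)$. Assume that $$\Omega:=\{(s,\zeta_1,\zeta_2): s\in[0,L],\ (\zeta_1,\zeta_2)\in\mathcal A(s)\}$$ is compact and that $(s,0,0)\in\operatorname{int}\Omega$ for $0<s<L$. Let $V:=L^p([0,L];\mathbb R^3)\times\mathbb R^3\times\mathbb R^3\times\mathbb R^3$. For $w=((\kappa_1,\kappa_2,\omega),x_0,t_0,d_0)\in V$, let $x[w],t[w],d[w]:[0,L]\to\mathbb R^3$ be the unique (Carathéodory) solution of $$x'=t,\qquad t'=\kappa_2\,d-\kappa_1\,t\times d,\qquad d'=\omega\,t\times d-\kappa_2\,t,\qquad (x,t,d)(0)=(x_0,t_0,d_0),$$ and let $p[w](s,\zeta_1,\zeta_2):=x(s)+\zeta_1d(s)+\zeta_2\,t(s)\times d(s)$ on $\Omega$; if $t_0,d_0$ are orthonormal, its Jacobian determinant is $1-\zeta_1\kappa_2+\zeta_2\kappa_1$. **Energy.** Let $f:\mathbb R^3\times[0,L]\to\mathbb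 R\cup\{+\infty\}$ be such that $f(\cdot,s)$ is continuous and convex for each $s$, $f(a,\cdot)$ is measurable for each $a$, and $f(a,s)\ge C_1|a|^p+C_2$ for all $a,s$, with constants $C_1>0$, $C_2\in\mathbb R$. Let $\rho>0$ be integrable on $\Omega$ and $g\in\mathbb R^3$. Put $E_{\rm loop}:=E_{\rm sh}+E_{\rm ni}+E_{\rm g}$, where $$E_{\rm sh}(w)=\int_0^L f\big((\kappa_1,\kappa_2,\omega)(s),s\big)\,ds,\qquad E_{\rm g}(w)=-\int_\Omega\rho\;g\cdot p[w]\,d(s,\zeta_1,\zeta_2),$$ and $E_{\rm ni}(w)=0$ if $\max_{(\zeta_1,\zeta_2)\in\mathcal A(s)}(\zeta_1\kappa_2(s)-\zeta_2\kappa_1(s))\le1$ for a.e. $s\in[0,L]$, $E_{\rm ni}(w)=+\infty$ otherwise. **Constraints.** Let vectors $x_0,t_0,d_0\in\mathbb R^3$ with $|t_0|=|d_0|=1$ and $t_0\cdot d_0=0$ (clamping parameters), $\theta\in\mathbb R$ and $n\in\mathbb Z$ (global gluing conditions), and a continuous $\ell:[0,L]\to\mathbb R^3$ with $\ell(L)=\ell(0)$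 be given. Let $\mathcal U$ be the set of all $w=(w_1,x_0,t_0,d_0)\in V$, with these $x_0,t_0,d_0$, such that $x=x[w]$, $t=t[w]$, $d=d[w]$ satisfy 1. (closure) $x(L)=x(0)=x_0$; 2. (clamping) $t(L)=t(0)=t_0$ and $d(0)=d_0$; 3. (gluing) $d(L)=\cos\theta\,d_0+\sin\theta\,t_0\times d_0$, and the link type is $n$: for all sufficiently small $\varepsilon>0$ the closed midline $x$ is disjoint from, and has linking number $n$ with, the curve $x+\varepsilon d$ closed up by the circular arc $\tau\mapsto x_0+\varepsilon\big(\cos((1-\tau)\theta)\,d_0+\sin((1-\tau)\theta)\,t_0\times d_0\big)$, $\tau\in[0,1]$; the linking number of disjoint closed curves $a,b$ is the Gauss integral $\frac1{4\pi}\iint\frac{(a(s)-b(u))\cdot(a'(s)\times b'(u))}{|a(s)-b(u)|^3}\,du\,ds$; 4. (global injectivity) $\displaystyle\int_\Omega(1-\zeta_1\kappa_2(s)+\zeta_2\kappa_1(s))\,d(s,\zeta_1,\zeta_2)\le\mathcal H^3(p[w](\Omega))$; 5. (knot type) $x\simeq\ell$, i.e. there are open neighbourhoods $N_1$ of $x([0,L])$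 and $N_2$ of $\ell([0,L])$ and a continuous $\Phi:N_1\times[0,1]\to\mathbb R^3$ such that $\Phi(\cdot,\tau)$ is a homeomorphism of $N_1$ onto its image for every $\tau\in[0,1]$, $\Phi(\cdot,0)=\mathrm{id}$, $\Phi(N_1,1)=N_2$, and $\Phi(x([0,L]),1)=\ell([0,L])$. **Theorem (Minimization of the loop energy).** If there is $\tilde w\in\mathcal U$ with $E_{\rm loop}(\tilde w)<+\infty$, then there is $w\in\mathcal U$ with $E_{\rm loop}(w)\le E_{\rm loop}(v)$ for all $v\in\mathcal U$. -/

import Mathlib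

open MeasureTheory Set Filter Topology
open scoped ENNReal

namespace KirchhoffRod

noncomputable section

/-- Three-dimensional Euclidean space. -/
abbrev E3 : Type := EuclideanSpace ℝ (Fin 3)

/-- The vector product of two vectors of Euclidean space. -/
def cross (u v : E3) : E3 := WithLp.toLp 2 (crossProduct (WithLp.ofLp u) (WithLp.ofLp v))

/-- The Lebesgue integral of an extended-real-valued function, `∫ h⁺ - ∫ h⁻`. It is used below only
for functions that are bounded below on a set of finite measure, so that `∫ h⁻` is finite. -/
def extIntegral {α : Type*} [MeasurableSpace α] (μ : Measure α) (h : α → EReal) : EReal :=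
  ((∫⁻ a, (h a).toENNReal ∂μ : ℝ≥0∞) : EReal) - ((∫⁻ a, (-(h a)).toENNReal ∂μ : ℝ≥0∞) : EReal)

/-- The set `{(s, ζ₁, ζ₂) : s ∈ [0, L], (ζ₁, ζ₂) ∈ A(s)}`. -/
def materialDomain (L : ℝ) (A : ℝ → Set (ℝ × ℝ)) : Set (ℝ × ℝ × ℝ) :=
  {q | q.1 ∈ Icc 0 L ∧ q.2 ∈ A q.1}

/-- The data of a Kirchhoff rod: length, exponent, material cross-sections, stored energy density,
mass density and gravitational acceleration, with the standing assumptions on them. Only the values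
at arc-length parameters in `[0, L]`, respectively at points of the material domain, matter. -/
structure Rod where
  /-- length of the midline -/
  L : ℝ
  L_pos : 0 < L
  /-- integrability exponent of the flexural and twist densities -/
  p : ℝ≥0∞
  one_lt_p : 1 < p
  p_lt_top : p < ⊤
  /-- material cross-sections -/
  A : ℝ → Set (ℝ × ℝ)
  isCompact_A : ∀ s ∈ Icc 0 L, IsCompact (A s)
  isSimplyConnected_A : ∀ s ∈ Icc 0 L, IsSimplyConnected (A s)
  zero_mem_interior_A : ∀ s ∈ Icc 0 L, (0, 0) ∈ interior (A s)
  isCompact_domain : IsCompact (materialDomain L A)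
  midline_mem_interior : ∀ s ∈ Ioo 0 L, (s, 0, 0) ∈ interior (materialDomain L A)
  /-- stored energy density; the growth condition below excludes the value `-∞` -/
  f : E3 → ℝ → EReal
  continuous_f : ∀ s ∈ Icc 0 L, Continuous fun a => f a s
  convex_f : ∀ s ∈ Icc 0 L, ∀ (a b : E3) (α β : ℝ), 0 < α → 0 < β → α + β = 1 →
    f (α • a + β • b) s ≤ (α : EReal) * f a s + (β : EReal) * f b s
  measurable_f : ∀ a : E3, AEMeasurable (f a) (volume.restrict (Icc 0 L))
  growth_f : ∃ C₁ C₂ : ℝ, 0 < C₁ ∧ ∀ s ∈ Icc 0 L, ∀ a : E3,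
    ((C₁ * ‖a‖ ^ p.toReal + C₂ : ℝ) : EReal) ≤ f a s
  /-- mass density -/
  ρ : ℝ × ℝ × ℝ → ℝ
  ρ_pos : ∀ q ∈ materialDomain L A, 0 < ρ q
  integrable_ρ : IntegrableOn ρ (materialDomain L A)
  /-- gravitational acceleration -/
  g : E3

namespace Rod

variable (B : Rod)

/-- The set of material points of the rod. -/
abbrev Ω : Set (ℝ × ℝ × ℝ) := materialDomain B.L B.A

/-- The space `V = L^p([0, L]; ℝ³) × ℝ³ × ℝ³ × ℝ³` of the `w = ((κ₁, κ₂, ω), x₀, t₀, d₀)`. -/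
abbrev V : Type := Lp E3 B.p (volume.restrict (Icc 0 B.L)) × E3 × E3 × E3

variable {B}

/-- The first flexural density. -/
def κ₁ (w : B.V) (s : ℝ) : ℝ := w.1 s 0

/-- The second flexural density. -/
def κ₂ (w : B.V) (s : ℝ) : ℝ := w.1 s 1

/-- The twist density. -/
def ω (w : B.V) (s : ℝ) : ℝ := w.1 s 2

/-- `(x, t, d)` is the (Carathéodory) solution on `[0, L]` of
`x' = t`, `t' = κ₂ d - κ₁ t × d`, `d' = ω t × d - κ₂ t`, `(x, t, d)(0) = (x₀, t₀, d₀)`.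
Here `κ₁ d + κ₂ t × d + ω t` is the Darboux vector of the frame, so that
`(t × d)' = κ₁ t - ω d` and the configuration map below has Jacobian determinant
`1 - ζ₁ κ₂ + ζ₂ κ₁`. -/
structure IsFrame (w : B.V) (x t d : ℝ → E3) : Prop where
  continuousOn_t : ContinuousOn t (Icc 0 B.L)
  continuousOn_d : ContinuousOn d (Icc 0 B.L)
  eq_x : ∀ s ∈ Icc 0 B.L, x s = w.2.1 + ∫ r in (0 : ℝ)..s, t r
  eq_t : ∀ s ∈ Icc 0 B.L,
    t s = w.2.2.1 + ∫ r in (0 : ℝ)..s, (κ₂ w r • d r - κ₁ w r • cross (t r) (d r))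
  eq_d : ∀ s ∈ Icc 0 B.L,
    d s = w.2.2.2 + ∫ r in (0 : ℝ)..s, (ω w r • cross (t r) (d r) - κ₂ w r • t r)

/-- The solution `(x, t, d)` of the initial value problem. For every `w` in `V` it exists and is
unique on `[0, L]`: the right-hand side is locally Lipschitz in `(x, t, d)` with an integrable
constant, and `|t|² + |d|²` is conserved. -/
def frame (w : B.V) : (ℝ → E3) × (ℝ → E3) × (ℝ → E3) :=
  Classical.epsilon fun F => IsFrame w F.1 F.2.1 F.2.2

/-- The midline `x[w]`. -/
def x (w : B.V) : ℝ → E3 := (frame w).1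

/-- The tangent field `t[w]`. -/
def t (w : B.V) : ℝ → E3 := (frame w).2.1

/-- The director field `d[w]`. -/
def d (w : B.V) : ℝ → E3 := (frame w).2.2

/-- The configuration map `p[w](s, ζ₁, ζ₂) = x(s) + ζ₁ d(s) + ζ₂ t(s) × d(s)`. -/
def config (w : B.V) (q : ℝ × ℝ × ℝ) : E3 :=
  x w q.1 + q.2.1 • d w q.1 + q.2.2 • cross (t w q.1) (d w q.1)

/-- The shape energy. -/
def Esh (w : B.V) : EReal := extIntegral (volume.restrict (Icc 0 B.L)) fun s => B.f (w.1 s) s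

/-- The set `N` of local non-interpenetration: `max_{A(s)} (ζ₁ κ₂(s) - ζ₂ κ₁(s)) ≤ 1` for almost
every `s`. -/
def localNI (B : Rod) : Set B.V :=
  {w | ∀ᵐ s ∂(volume.restrict (Icc 0 B.L)), ∀ ζ ∈ B.A s, ζ.1 * κ₂ w s - ζ.2 * κ₁ w s ≤ 1}

open Classical in
/-- The energy `0` on `N` and `+∞` off `N`. -/
def Eni (w : B.V) : EReal := if w ∈ localNI B then 0 else ⊤

/-- The potential energy of the weight. -/
def Eg (w : B.V) : ℝ := -∫ q in B.Ω, B.ρ q * inner ℝ B.g (config w q)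

/-- The loop energy. -/
def Eloop (w : B.V) : EReal := Esh w + Eni w + (Eg w : EReal)

/-- Closure of the midline, `x(L) = x(0) = x₀`. -/
def Closure (w : B.V) : Prop := x w B.L = x w 0 ∧ x w 0 = w.2.1

/-- Clamping, `t(L) = t(0) = t₀` and `d(0) = d₀`. -/
def Clamping (w : B.V) : Prop := t w B.L = t w 0 ∧ t w 0 = w.2.2.1 ∧ d w 0 = w.2.2.2

/-- The unit normal at angle `φ` from `d₀` in the plane orthogonal to `t₀`. -/
def normalAt (w : B.V) (φ : ℝ) : E3 :=
  Real.cos φ • w.2.2.2 + Real.sin φ • cross w.2.2.1 w.2.2.2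

/-- The curve `x + ε d`, closed up (when the angle from `d(0)` to `d(L)` is `θ`) by the circular arc
on `[L, L + 1]` that turns back from `x₀ + ε d(L)` to `x₀ + ε d(0)` through the angle `θ`. -/
def shifted (w : B.V) (θ ε : ℝ) (u : ℝ) : E3 :=
  if u ≤ B.L then x w u + ε • d w u else w.2.1 + ε • normalAt w ((1 - (u - B.L)) * θ)

end Rod

/-- The linking number of two disjoint closed curves `a` on `[0, ℓa]` and `b` on `[0, ℓb]`, as the
Gauss integral `(1 / 4π) ∬ (a - b) · (a' × b') / |a - b|³`. -/
def linkingNumber (a b : ℝ → E3) (ℓa ℓb : ℝ) : ℝ :=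
  (1 / (4 * Real.pi)) * ∫ s in (0 : ℝ)..ℓa, ∫ u in (0 : ℝ)..ℓb,
    inner ℝ (a s - b u) (cross (deriv a s) (deriv b u)) / ‖a s - b u‖ ^ 3

/-- Isotopy of two closed curves `x₁, x₂` on `[0, L]`: there are open neighbourhoods `N₁`, `N₂` of
their images and a continuous `Φ : N₁ × [0, 1] → ℝ³` such that each `Φ(·, τ)` is a homeomorphism of
`N₁` onto its image, `Φ(·, 0) = id`, `Φ(N₁, 1) = N₂` and `Φ(·, 1)` maps the first image onto the
second. -/
def Isotopic (L : ℝ) (x₁ x₂ : ℝ → E3) : Prop :=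
  ∃ (N₁ N₂ : Set E3) (Φ : E3 × ℝ → E3),
    IsOpen N₁ ∧ IsOpen N₂ ∧ x₁ '' Icc 0 L ⊆ N₁ ∧ x₂ '' Icc 0 L ⊆ N₂ ∧
    ContinuousOn Φ (N₁ ×ˢ Icc 0 1) ∧
    (∀ τ ∈ Icc (0 : ℝ) 1, IsEmbedding fun y : N₁ => Φ (y, τ)) ∧
    (∀ y ∈ N₁, Φ (y, 0) = y) ∧
    (fun y => Φ (y, 1)) '' N₁ = N₂ ∧
    (fun y => Φ (y, 1)) '' (x₁ '' Icc 0 L) = x₂ '' Icc 0 L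

namespace Rod

variable {B : Rod}

/-- The global gluing conditions: the angle from `d(0)` to `d(L)`, measured in the plane orthogonal
to `t₀`, is `θ`, and the link type is `n`: for all small `ε > 0` the midline and the closed-up curve
`x + ε d` are disjoint and have linking number `n`. -/
def Gluing (θ : ℝ) (n : ℤ) (w : B.V) : Prop :=
  d w B.L = normalAt w θ ∧
  ∀ᶠ ε in 𝓝[>] (0 : ℝ),
    Disjoint (x w '' Icc 0 B.L) (shifted w θ ε '' Icc 0 (B.L + 1)) ∧
    linkingNumber (x w) (shifted w θ ε) B.L (B.L + 1) = n

/-- Global injectivity, `∫_Ω (1 - ζ₁ κ₂ + ζ₂ κ₁) ≤ H³(p[w](Ω))`, where `μHE[3]` is the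
three-dimensional Hausdorff measure normalised to agree with Lebesgue measure. -/
def GlobalInj (w : B.V) : Prop :=
  ENNReal.ofReal (∫ q in B.Ω, (1 - q.2.1 * κ₂ w q.1 + q.2.2 * κ₁ w q.1)) ≤
    μHE[3] (config w '' B.Ω)

/-- The elements of `V` with given clamping parameters that satisfy the closure, clamping, gluing,
global injectivity and knot-type constraints. -/
def admissible (B : Rod) (x₀ t₀ d₀ : E3) (θ : ℝ) (n : ℤ) (ℓ : ℝ → E3) : Set B.V :=
  {w | w.2 = (x₀, t₀, d₀) ∧ Closure w ∧ Clamping w ∧ Gluing θ n w ∧ GlobalInj w ∧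
    Isotopic B.L (x w) ℓ}

end Rod

end

end KirchhoffRod

/-! The proof is the direct method. With fixed clamping parameters the energy of the weight is
bounded, so the growth of `f` bounds the strains of a minimizing sequence in `L^p`. A subsequence of
the strains converges weakly, and the associated orthonormal frames converge uniformly
(`exists_converges`). The shape energy is weakly lower semicontinuous by convexity and Fatou's lemma
(`shiftEnergy_le_of_weakTendsto`), the energy of the weight is continuous, and local
non-interpenetration is a closed convex condition. Weak compactness and Mazur's lemma are replaced
by one construction: near-minimizers of a strictly convex functional over the convex hulls of the
tails converge in `L¹` (`exists_tendsto_of_convex`). Weak convergence itself is expressed by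
convergence of primitives.

The main point is that the constraints survive the limit (`Converges.mem_admissible`). Closure,
clamping and the gluing angle pass to the limit pointwise. In the global injectivity condition the
Jacobian integral is affine in the strains and converges, while the volume of the image is upper
semicontinuous under uniform convergence.

Link and knot type are more delicate, because the curves might touch in the limit. This is excluded
as follows. With a nonnegative Jacobian, global injectivity and the area inequality
(`Framing.volume_tube_image_le`) forbid two disjoint parts of the rod to overlap in an open set.
Interior midline points are interior to the material, so a self-contact of the midline would produce
such an overlap (`midline_ne`). The limit midline is therefore an embedded closed `C¹` curve and
satisfies a chord-arc estimate (`exists_chordArc`), which is stable under uniform convergence of the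
tangents.

The chord-arc estimate gives the knot type: the displacement between nearby midlines extends to a
1/2-Lipschitz map `F`, and the identity plus `F` is reached by a straight-line isotopy
(`exists_isotopic_of_close`). It also gives the link type: for one `ε₀` common to the limit and the
tail of the sequence, the curves at distance `ε < ε₀` avoid the midline. There the Gauss integral
does not depend on `ε` (`gaussIntegral_const`), and for fixed `ε` it passes to the limit
(`tendsto_gaussIntegral`). -/

namespace KirchhoffRod

noncomputable section

/-! ### The vector product of Euclidean space. -/

section Algebra

@[simp] lemma cross_apply_zero (u v : E3) : cross u v 0 = u 1 * v 2 - u 2 * v 1 := by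
  simp [cross, crossProduct]

@[simp] lemma cross_apply_one (u v : E3) : cross u v 1 = u 2 * v 0 - u 0 * v 2 := by
  simp [cross, crossProduct]

@[simp] lemma cross_apply_two (u v : E3) : cross u v 2 = u 0 * v 1 - u 1 * v 0 := by
  simp [cross, crossProduct]

lemma inner_eq_sum (u v : E3) : inner ℝ u v = u 0 * v 0 + u 1 * v 1 + u 2 * v 2 := by
  simp [PiLp.inner_apply, Fin.sum_univ_three, mul_comm]

lemma norm_sq_eq_sum (u : E3) : ‖u‖ ^ 2 = u 0 ^ 2 + u 1 ^ 2 + u 2 ^ 2 := by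
  rw [← real_inner_self_eq_norm_sq, inner_eq_sum]; ring

lemma E3.ext {u v : E3} (h0 : u 0 = v 0) (h1 : u 1 = v 1) (h2 : u 2 = v 2) : u = v := by
  ext i; fin_cases i <;> assumption

lemma abs_apply_le_norm (u : E3) (i : Fin 3) : |u i| ≤ ‖u‖ := by
  simpa using PiLp.norm_apply_le u i

lemma norm_cross_sq (u v : E3) :
    ‖cross u v‖ ^ 2 = ‖u‖ ^ 2 * ‖v‖ ^ 2 - inner ℝ u v ^ 2 := by
  simp only [norm_sq_eq_sum, inner_eq_sum, cross_apply_zero, cross_apply_one, cross_apply_two]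
  ring

lemma norm_cross_le (u v : E3) : ‖cross u v‖ ≤ ‖u‖ * ‖v‖ := by
  apply le_of_sq_le_sq _ (by positivity)
  rw [norm_cross_sq, mul_pow]
  nlinarith [sq_nonneg (inner ℝ u v)]

/-- The vector product as a bilinear map. -/
def crossL : E3 →L[ℝ] E3 →L[ℝ] E3 :=
  LinearMap.mkContinuous₂ (LinearMap.mk₂ ℝ cross
    (fun a b c => by apply E3.ext <;> simp <;> ring) (fun a b c => by apply E3.ext <;> simp <;> ring)
    (fun a b c => by apply E3.ext <;> simp <;> ring) (fun a b c => by apply E3.ext <;> simp <;> ring))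
    1 (fun a b => by simpa using norm_cross_le a b)

@[simp] lemma crossL_apply (u v : E3) : crossL u v = cross u v := rfl

lemma continuous_cross : Continuous fun q : E3 × E3 => cross q.1 q.2 :=
  crossL.continuous₂

lemma _root_.ContinuousOn.cross {α : Type*} [TopologicalSpace α] {f g : α → E3} {s : Set α}
    (hf : ContinuousOn f s) (hg : ContinuousOn g s) :
    ContinuousOn (fun a => cross (f a) (g a)) s :=
  continuous_cross.comp_continuousOn (hf.prodMk hg)

lemma _root_.Continuous.cross {α : Type*} [TopologicalSpace α] {f g : α → E3}
    (hf : Continuous f) (hg : Continuous g) : Continuous (fun a => cross (f a) (g a)) :=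
  continuous_cross.comp (hf.prodMk hg)

lemma _root_.HasDerivAt.cross {f g : ℝ → E3} {f' g' : E3} {s : ℝ}
    (hf : HasDerivAt f f' s) (hg : HasDerivAt g g' s) :
    HasDerivAt (fun r => cross (f r) (g r)) (cross (f s) g' + cross f' (g s)) s := by
  have h := (crossL.hasFDerivAt_of_bilinear hf.hasFDerivAt hg.hasFDerivAt).hasDerivAt
  simpa using h

end Algebra

/-! ### Absolutely continuous functions with values in normed spaces. -/

section AbsolutelyContinuous

variable {E F : Type*} [NormedAddCommGroup E] [NormedSpace ℝ E] [NormedAddCommGroup F]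
  [NormedSpace ℝ F]

/-- Sums of increments of `g` are squeezed by those of `f`. The closure properties below reduce to
this comparison. -/
lemma _root_.AbsolutelyContinuousOnInterval.of_dist_le {X Y : Type*} [PseudoMetricSpace X]
    [PseudoMetricSpace Y] {f : ℝ → X} {g : ℝ → Y} {a b K : ℝ}
    (hf : AbsolutelyContinuousOnInterval f a b)
    (h : ∀ r ∈ uIcc a b, ∀ s ∈ uIcc a b, dist (g r) (g s) ≤ K * dist (f r) (f s)) :
    AbsolutelyContinuousOnInterval g a b := by
  unfold AbsolutelyContinuousOnInterval at hf ⊢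
  have h0 : Tendsto (fun E : ℕ × (ℕ → ℝ × ℝ) =>
      K * ∑ i ∈ Finset.range E.1, dist (f (E.2 i).1) (f (E.2 i).2))
      (AbsolutelyContinuousOnInterval.totalLengthFilter ⊓
        𝓟 (AbsolutelyContinuousOnInterval.disjWithin a b)) (𝓝 0) := by
    simpa using hf.const_mul K
  refine squeeze_zero' (Eventually.of_forall fun E => Finset.sum_nonneg fun i _ => dist_nonneg) ?_ h0
  rw [eventually_inf_principal]
  refine Eventually.of_forall fun E hE => ?_
  rw [Finset.mul_sum]
  exact Finset.sum_le_sum fun i hi => h _ (hE.1 i hi).1 _ (hE.1 i hi).2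

lemma _root_.AbsolutelyContinuousOnInterval.lipschitz_comp {X Y : Type*} [PseudoMetricSpace X]
    [PseudoMetricSpace Y] {f : ℝ → X} {φ : X → Y} {a b : ℝ} {K : NNReal} {s : Set X}
    (hf : AbsolutelyContinuousOnInterval f a b) (hs : MapsTo f (uIcc a b) s)
    (hφ : LipschitzOnWith K φ s) : AbsolutelyContinuousOnInterval (φ ∘ f) a b :=
  hf.of_dist_le fun _ hr _ ht => hφ.dist_le_mul _ (hs hr) _ (hs ht)

/-- The integral of an integrable function is absolutely continuous. -/
lemma _root_.IntervalIntegrable.absolutelyContinuous_integral {f : ℝ → F} {a b : ℝ}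
    (h : IntervalIntegrable f volume a b) :
    AbsolutelyContinuousOnInterval (fun s => ∫ r in a..s, f r) a b := by
  refine (h.norm.absolutelyContinuousOnInterval_intervalIntegral (c := a) (by simp)).of_dist_le
    (K := 1) fun r hr s hs => ?_
  have hi : ∀ {r s : ℝ}, r ∈ uIcc a b → s ∈ uIcc a b → IntervalIntegrable f volume r s :=
    fun hr hs => h.mono_set (uIcc_subset_uIcc hr hs)
  have ha : a ∈ uIcc a b := by simp
  rw [dist_comm, dist_comm (∫ v in a..r, ‖f v‖), dist_eq_norm, Real.dist_eq,
    intervalIntegral.integral_interval_sub_left (hi ha hs) (hi ha hr),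
    intervalIntegral.integral_interval_sub_left (hi ha hs).norm (hi ha hr).norm, one_mul]
  exact intervalIntegral.norm_integral_le_abs_integral_norm

lemma _root_.AbsolutelyContinuousOnInterval.prodMk {f : ℝ → E} {g : ℝ → F} {a b : ℝ}
    (hf : AbsolutelyContinuousOnInterval f a b) (hg : AbsolutelyContinuousOnInterval g a b) :
    AbsolutelyContinuousOnInterval (fun s => (f s, g s)) a b := by
  have h1 : AbsolutelyContinuousOnInterval ((ContinuousLinearMap.inl ℝ E F) ∘ f) a b :=
    hf.lipschitz_comp (mapsTo_univ _ _) ((ContinuousLinearMap.inl ℝ E F).lipschitz.lipschitzOnWith)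
  have h2 : AbsolutelyContinuousOnInterval ((ContinuousLinearMap.inr ℝ E F) ∘ g) a b :=
    hg.lipschitz_comp (mapsTo_univ _ _) ((ContinuousLinearMap.inr ℝ E F).lipschitz.lipschitzOnWith)
  exact (h1.add h2).of_dist_le (K := 1) fun r _ s _ => by simp [dist_eq_norm]

/-- The values of `f` lie in a closed ball, and a `C¹` map is Lipschitz on that compact convex set.
-/
lemma _root_.AbsolutelyContinuousOnInterval.contDiff_comp [FiniteDimensional ℝ E] {f : ℝ → E}
    {φ : E → F} {a b : ℝ} (hf : AbsolutelyContinuousOnInterval f a b) (hφ : ContDiff ℝ 1 φ) :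
    AbsolutelyContinuousOnInterval (φ ∘ f) a b := by
  obtain ⟨C, hC⟩ := hf.exists_bound
  obtain ⟨K, hK⟩ := (hφ.contDiffOn (s := Metric.closedBall (0 : E) C)).exists_lipschitzOnWith
    (by decide) (convex_closedBall _ _) (isCompact_closedBall _ _)
  exact hf.lipschitz_comp (fun s hs => by simpa using hC s hs) hK

/-- The fundamental theorem of calculus for absolutely continuous functions. -/
lemma _root_.AbsolutelyContinuousOnInterval.integral_eq_sub [CompleteSpace F] {f f' : ℝ → F}
    {a b : ℝ} (hf : AbsolutelyContinuousOnInterval f a b)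
    (hd : ∀ᵐ s, s ∈ uIcc a b → HasDerivAt f (f' s) s) (hi : IntervalIntegrable f' volume a b) :
    ∫ s in a..b, f' s = f b - f a := by
  -- `f` minus the primitive of `f'` is absolutely continuous with derivative zero almost
  -- everywhere, hence constant.
  have hg := hf.sub hi.absolutelyContinuous_integral
  obtain ⟨C, hC⟩ := hg.const_of_ae_hasDerivAt_zero (by
    filter_upwards [hd, hi.ae_hasDerivAt_integral] with s h1 h2 hs
    simpa using (h1 hs).sub (h2 hs a (by simp)))
  have h1 := hC a (by simp)
  have h2 := hC b (by simp)
  simp only [Pi.sub_apply, intervalIntegral.integral_same, sub_zero] at h1 h2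
  rw [← h1] at h2
  rw [← h2]; abel

lemma _root_.AbsolutelyContinuousOnInterval.eq_of_hasDerivAt_zero {f : ℝ → F}
    {a b : ℝ} (hf : AbsolutelyContinuousOnInterval f a b)
    (hd : ∀ᵐ s, s ∈ uIcc a b → HasDerivAt f 0 s) {s : ℝ} (hs : s ∈ uIcc a b) : f s = f a := by
  obtain ⟨C, hC⟩ := hf.const_of_ae_hasDerivAt_zero hd
  rw [hC s hs, hC a (by simp)]

end AbsolutelyContinuous

/-! ### Primitives of integrable functions on `[0, L]`. -/

section Primitive

variable {F : Type*} [NormedAddCommGroup F] [NormedSpace ℝ F]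

/-- A function that is a primitive on `[0, L]` of an integrable function. -/
structure IsPrimitive (L : ℝ) (f f' : ℝ → F) : Prop where
  integrableOn : IntegrableOn f' (Icc 0 L)
  eq_add : ∀ s ∈ Icc 0 L, f s = f 0 + ∫ r in (0 : ℝ)..s, f' r

namespace IsPrimitive

variable {L : ℝ} {f f' : ℝ → F}

lemma intervalIntegrable_of {G : Type*} [NormedAddCommGroup G] {g : ℝ → G} (hg : IntegrableOn g (Icc 0 L)) {a b : ℝ}
    (ha : a ∈ Icc 0 L) (hb : b ∈ Icc 0 L) : IntervalIntegrable g volume a b := by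
  rw [intervalIntegrable_iff]
  exact hg.mono_set ((uIoc_subset_uIcc).trans (uIcc_subset_Icc ha hb))

lemma intervalIntegrable (h : IsPrimitive L f f') {a b : ℝ}
    (ha : a ∈ Icc 0 L) (hb : b ∈ Icc 0 L) : IntervalIntegrable f' volume a b :=
  intervalIntegrable_of h.integrableOn ha hb

lemma sub_eq (h : IsPrimitive L f f') {a b : ℝ} (ha : a ∈ Icc 0 L) (hb : b ∈ Icc 0 L) :
    f b - f a = ∫ r in a..b, f' r := by
  have h0 : (0 : ℝ) ∈ Icc 0 L := ⟨le_rfl, ha.1.trans ha.2⟩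
  rw [h.eq_add a ha, h.eq_add b hb, ← intervalIntegral.integral_interval_sub_left
    (h.intervalIntegrable h0 hb) (h.intervalIntegrable h0 ha)]
  abel

lemma absolutelyContinuous (h : IsPrimitive L f f') (hL : 0 ≤ L) :
    AbsolutelyContinuousOnInterval f 0 L := by
  have h0 : (0 : ℝ) ∈ Icc 0 L := ⟨le_rfl, hL⟩
  have h1 : L ∈ Icc 0 L := ⟨hL, le_rfl⟩
  refine (h.intervalIntegrable h0 h1).absolutelyContinuous_integral.of_dist_le (K := 1)
    fun r hr s hs => ?_
  rw [uIcc_of_le hL] at hr hs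
  rw [h.eq_add r hr, h.eq_add s hs, dist_add_left, one_mul]

lemma continuousOn (h : IsPrimitive L f f') (hL : 0 ≤ L) : ContinuousOn f (Icc 0 L) := by
  simpa [uIcc_of_le hL] using (h.absolutelyContinuous hL).continuousOn

lemma ae_hasDerivAt [CompleteSpace F] (h : IsPrimitive L f f') (hL : 0 ≤ L) :
    ∀ᵐ s, s ∈ Icc 0 L → HasDerivAt f (f' s) s := by
  have h0 : (0 : ℝ) ∈ Icc 0 L := ⟨le_rfl, hL⟩
  have h1 : L ∈ Icc 0 L := ⟨hL, le_rfl⟩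
  -- At the two endpoints the identity with the primitive holds on one side only, so they are
  -- discarded as null sets.
  have e0 : ∀ᵐ s : ℝ, s ≠ 0 := by simp [ae_iff, measure_singleton]
  have e1 : ∀ᵐ s : ℝ, s ≠ L := by simp [ae_iff, measure_singleton]
  filter_upwards [(h.intervalIntegrable h0 h1).ae_hasDerivAt_integral, e0, e1] with s hs s0 s1 hsL
  have h2 := (hs (by rwa [uIcc_of_le hL]) 0 (by simp)).const_add (f 0)
  refine h2.congr_of_eventuallyEq ?_
  filter_upwards [Icc_mem_nhds (lt_of_le_of_ne hsL.1 (Ne.symm s0)) (lt_of_le_of_ne hsL.2 s1)]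
    with r hr using h.eq_add r hr

lemma hasDerivAt [CompleteSpace F] (h : IsPrimitive L f f') (hc : ContinuousOn f' (Icc 0 L))
    {s : ℝ} (hs : s ∈ Ioo 0 L) : HasDerivAt f (f' s) s := by
  have h0 : (0 : ℝ) ∈ Icc 0 L := ⟨le_rfl, hs.1.le.trans hs.2.le⟩
  have hn : Icc 0 L ∈ 𝓝 s := Icc_mem_nhds hs.1 hs.2
  have h2 := (intervalIntegral.integral_hasDerivAt_right
    (h.intervalIntegrable h0 (Ioo_subset_Icc_self hs))
    (hc.stronglyMeasurableAtFilter_nhdsWithin measurableSet_Icc s |>.filter_mono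
      (by rw [nhdsWithin_eq_nhds.2 hn])) (hc.continuousAt hn)).const_add (f 0)
  refine h2.congr_of_eventuallyEq ?_
  filter_upwards [hn] with r hr using h.eq_add r hr

end IsPrimitive

end Primitive

/-! ### Linear Carathéodory equations by exponentially weighted norms. -/

section LinearODE

variable {L : ℝ}

lemma isPrimitive_integral {F : Type*} [NormedAddCommGroup F] [NormedSpace ℝ F] {f : ℝ → F}
    (hf : IntegrableOn f (Icc 0 L)) : IsPrimitive L (fun s => ∫ r in (0 : ℝ)..s, f r) f :=
  ⟨hf, fun s _ => by simp⟩

/-- The antiderivative is half of the exponential. The factor 2 in the exponent produces the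
constant 1/2 in the two weighted-norm arguments below. -/
lemma integral_mul_exp_two_mul {h : ℝ → ℝ} (hL : 0 ≤ L) (hh : IntegrableOn h (Icc 0 L)) {s : ℝ}
    (hs : s ∈ Icc 0 L) :
    ∫ r in (0 : ℝ)..s, Real.exp (2 * ∫ u in (0 : ℝ)..r, h u) * h r =
      (Real.exp (2 * ∫ u in (0 : ℝ)..s, h u) - 1) / 2 := by
  have hm := isPrimitive_integral hh
  set m : ℝ → ℝ := fun s => ∫ r in (0 : ℝ)..s, h r
  have h0 : (0 : ℝ) ∈ Icc 0 L := ⟨le_rfl, hL⟩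
  have hac : AbsolutelyContinuousOnInterval (fun r => Real.exp (2 * m r) / 2) 0 L :=
    (hm.absolutelyContinuous hL).contDiff_comp (φ := fun z : ℝ => Real.exp (2 * z) / 2)
      (by fun_prop)
  have hsub : uIcc 0 s ⊆ Icc 0 L := uIcc_subset_Icc h0 hs
  have key := AbsolutelyContinuousOnInterval.integral_eq_sub
    (f' := fun r => Real.exp (2 * m r) * h r)
    (hac.mono (c := 0) (d := s) (by rwa [uIcc_of_le hL])) (by
      filter_upwards [hm.ae_hasDerivAt hL] with r hr hrs
      have := (((hr (hsub hrs)).const_mul 2).exp).div_const 2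
      exact this.congr_deriv (by ring)) (IsPrimitive.intervalIntegrable_of (hh.continuousOn_mul
        (Real.continuous_exp.comp_continuousOn ((hm.continuousOn hL).const_smul (2 : ℝ)))
        isCompact_Icc) h0 hs)
  change ∫ r in (0 : ℝ)..s, Real.exp (2 * m r) * h r = (Real.exp (2 * m s) - 1) / 2
  rw [key]
  simp [m]
  ring

/-- Uniqueness in Gronwall's lemma with an integrable kernel. -/
lemma eq_zero_of_norm_le_integral {Y : Type*} [NormedAddCommGroup Y] {h : ℝ → ℝ} (hL : 0 ≤ L) (hh : IntegrableOn h (Icc 0 L))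
    (hpos : ∀ s, 0 ≤ h s) {δ : ℝ → Y} (hδ : ContinuousOn δ (Icc 0 L))
    (hle : ∀ s ∈ Icc 0 L, ‖δ s‖ ≤ ∫ r in (0 : ℝ)..s, h r * ‖δ r‖) {s : ℝ} (hs : s ∈ Icc 0 L) :
    δ s = 0 := by
  set m : ℝ → ℝ := fun s => ∫ r in (0 : ℝ)..s, h r with hmdef
  have hmc : ContinuousOn m (Icc 0 L) := (isPrimitive_integral hh).continuousOn hL
  have h0 : (0 : ℝ) ∈ Icc 0 L := ⟨le_rfl, hL⟩
  have hgc : ContinuousOn (fun s => Real.exp (-(2 * m s)) * ‖δ s‖) (Icc 0 L) :=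
    (Real.continuous_exp.comp_continuousOn (hmc.const_smul (2 : ℝ)).neg).mul hδ.norm
  obtain ⟨u, hu, hmax⟩ := isCompact_Icc.exists_isMaxOn ⟨0, h0⟩ hgc
  -- `G` is the maximum of `‖δ‖` weighted by `exp (-2 m)`. Inserting `‖δ r‖ ≤ G exp (2 m r)` into
  -- the integral inequality at the maximum point gives `G ≤ G / 2`.
  set G := Real.exp (-(2 * m u)) * ‖δ u‖ with hG
  have hb : ∀ r ∈ Icc 0 L, ‖δ r‖ ≤ G * Real.exp (2 * m r) := by
    intro r hr
    have := hmax hr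
    simp only [mem_ofPred_eq] at this
    calc ‖δ r‖ = (Real.exp (-(2 * m r)) * ‖δ r‖) * Real.exp (2 * m r) := by
          rw [mul_right_comm, ← Real.exp_add]; simp
      _ ≤ _ := by gcongr
  have hEc : ContinuousOn (fun r => Real.exp (2 * m r)) (Icc 0 L) :=
    Real.continuous_exp.comp_continuousOn (hmc.const_smul (2 : ℝ))
  have h1 : ‖δ u‖ ≤ ∫ r in (0 : ℝ)..u, G * (Real.exp (2 * m r) * h r) := by
    refine (hle u hu).trans (intervalIntegral.integral_mono_on hu.1 ?_ ?_ ?_)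
    · exact IsPrimitive.intervalIntegrable_of (hh.mul_continuousOn hδ.norm isCompact_Icc) h0 hu
    · exact IsPrimitive.intervalIntegrable_of
        ((hh.continuousOn_mul hEc isCompact_Icc).const_mul G) h0 hu
    · intro r hr
      have := mul_le_mul_of_nonneg_left (hb r ⟨hr.1, hr.2.trans hu.2⟩) (hpos r)
      linarith
  rw [intervalIntegral.integral_const_mul, integral_mul_exp_two_mul hL hh hu] at h1
  have hGn : 0 ≤ G := by positivity
  have h2 : G ≤ G / 2 := by
    calc G ≤ Real.exp (-(2 * m u)) * (G * ((Real.exp (2 * m u) - 1) / 2)) := by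
            rw [hG]; gcongr
      _ = G / 2 * (Real.exp (-(2 * m u)) * Real.exp (2 * m u) - Real.exp (-(2 * m u))) := by ring
      _ ≤ G / 2 * 1 := by
        rw [← Real.exp_add]
        gcongr
        simp [Real.exp_nonneg]
      _ = G / 2 := by ring
  have hG0 : G = 0 := by linarith
  have := hb s hs
  rw [hG0, zero_mul] at this
  exact norm_le_zero_iff.1 this

variable {Y : Type*} [NormedAddCommGroup Y] [NormedSpace ℝ Y]

lemma integrableOn_clm_apply {A : ℝ → Y →L[ℝ] Y} (hA : IntegrableOn A (Icc 0 L)) {u : ℝ → Y}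
    (hu : ContinuousOn u (Icc 0 L)) : IntegrableOn (fun r => A r (u r)) (Icc 0 L) := by
  obtain ⟨C, hC⟩ := isCompact_Icc.exists_bound_of_continuousOn hu
  refine (hA.norm.mul_const C).mono' ?_ ?_
  · exact (ContinuousLinearMap.apply ℝ Y).flip.aestronglyMeasurable_comp₂ hA.aestronglyMeasurable
      (hu.aestronglyMeasurable_of_isCompact isCompact_Icc measurableSet_Icc)
  · filter_upwards [ae_restrict_mem measurableSet_Icc] with r hr
    exact (ContinuousLinearMap.le_opNorm _ _).trans (by gcongr; exact hC r hr)

/-- Existence of Carathéodory solutions of linear differential equations. -/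
theorem exists_isPrimitive_linear [CompleteSpace Y] (hL : 0 ≤ L) {A : ℝ → Y →L[ℝ] Y}
    (hA : IntegrableOn A (Icc 0 L)) (y₀ : Y) :
    ∃ y : ℝ → Y, y 0 = y₀ ∧ IsPrimitive L y fun s => A s (y s) := by
  have hh : IntegrableOn (fun r => ‖A r‖) (Icc 0 L) := hA.norm
  set m : ℝ → ℝ := fun s => ∫ r in (0 : ℝ)..s, ‖A r‖ with hmdef
  have hmc : ContinuousOn m (Icc 0 L) := (isPrimitive_integral hh).continuousOn hL
  have h0 : (0 : ℝ) ∈ Icc 0 L := ⟨le_rfl, hL⟩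
  have hEc : ContinuousOn (fun r => Real.exp (2 * m r)) (Icc 0 L) :=
    Real.continuous_exp.comp_continuousOn (hmc.const_smul (2 : ℝ))
  have hEc' : ContinuousOn (fun r => Real.exp (-(2 * m r))) (Icc 0 L) :=
    Real.continuous_exp.comp_continuousOn (hmc.const_smul (2 : ℝ)).neg
  let ext : C(Icc (0 : ℝ) L, Y) → ℝ → Y := fun v => IccExtend hL v
  have hext : ∀ v, Continuous (ext v) := fun v => v.continuous.Icc_extend'
  have hI : ∀ v, IntegrableOn (fun r => Real.exp (2 * m r) • A r (ext v r)) (Icc 0 L) := fun v =>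
    (integrableOn_clm_apply hA (hext v).continuousOn).continuousOn_smul hEc isCompact_Icc
  -- Picard's operator conjugated by `exp (2 m)`: the unknown is `v = exp (-2 m) y`, and in the
  -- plain supremum norm this operator contracts by 1/2, without any restriction on `L`.
  let Tf : C(Icc (0 : ℝ) L, Y) → ℝ → Y := fun v s =>
    Real.exp (-(2 * m s)) • (y₀ + ∫ r in (0 : ℝ)..s, Real.exp (2 * m r) • A r (ext v r))
  have hTc : ∀ v, ContinuousOn (Tf v) (Icc 0 L) := fun v =>
    hEc'.smul (continuousOn_const.add ((isPrimitive_integral (hI v)).continuousOn hL))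
  let T : C(Icc (0 : ℝ) L, Y) → C(Icc (0 : ℝ) L, Y) := fun v =>
    ⟨fun s => Tf v s, continuousOn_iff_continuous_domRestrict.1 (hTc v)⟩
  have hcon : ContractingWith (1 / 2) T := by
    refine ⟨by rw [← NNReal.coe_lt_coe]; norm_num, LipschitzWith.of_dist_le_mul fun v w => ?_⟩
    rw [ContinuousMap.dist_le (by positivity)]
    rintro ⟨s, hs⟩
    change dist (Tf v s) (Tf w s) ≤ _
    have hi := fun v => IsPrimitive.intervalIntegrable_of (hI v) h0 hs
    simp only [Tf]
    rw [dist_smul₀, dist_add_left, dist_eq_norm, ← intervalIntegral.integral_sub (hi v) (hi w)]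
    have hle : ‖∫ r in (0 : ℝ)..s, (Real.exp (2 * m r) • A r (ext v r) -
        Real.exp (2 * m r) • A r (ext w r))‖ ≤
        ∫ r in (0 : ℝ)..s, dist v w * (Real.exp (2 * m r) * ‖A r‖) := by
      refine intervalIntegral.norm_integral_le_of_norm_le hs.1 (Eventually.of_forall fun r hr => ?_)
        (IsPrimitive.intervalIntegrable_of
          ((hh.continuousOn_mul hEc isCompact_Icc).const_mul (dist v w)) h0 hs)
      rw [← smul_sub, ← map_sub, norm_smul, Real.norm_of_nonneg (Real.exp_nonneg _)]
      have h1 : ‖ext v r - ext w r‖ ≤ dist v w := by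
        rw [← dist_eq_norm]; exact ContinuousMap.dist_apply_le_dist _
      have h2 := (A r).le_opNorm (ext v r - ext w r)
      have h3 := mul_le_mul_of_nonneg_left h1 (norm_nonneg (A r))
      have h4 := mul_le_mul_of_nonneg_left (h2.trans h3) (Real.exp_nonneg (2 * m r))
      linarith
    rw [intervalIntegral.integral_const_mul, integral_mul_exp_two_mul hL hh hs] at hle
    rw [Real.norm_of_nonneg (Real.exp_nonneg _)]
    calc _ ≤ Real.exp (-(2 * m s)) * (dist v w * ((Real.exp (2 * m s) - 1) / 2)) := by gcongr
      _ = dist v w / 2 * (Real.exp (-(2 * m s)) * Real.exp (2 * m s) - Real.exp (-(2 * m s))) := by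
        ring
      _ ≤ dist v w / 2 * 1 := by
        rw [← Real.exp_add]
        gcongr
        simp [Real.exp_nonneg]
      _ = _ := by norm_num; ring
  have hne : Nonempty C(Icc (0 : ℝ) L, Y) := ⟨0⟩
  set v := hcon.fixedPoint T
  have hv : T v = v := hcon.fixedPoint_isFixedPt
  have hv' : ∀ s ∈ Icc 0 L, ext v s = Tf v s := by
    intro s hs
    have h1 : T v ⟨s, hs⟩ = v ⟨s, hs⟩ := by rw [hv]
    simp only [ext, IccExtend_of_mem hL _ hs]
    exact h1.symm
  have hy : ∀ s ∈ Icc 0 L, Real.exp (2 * m s) • ext v s =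
      y₀ + ∫ r in (0 : ℝ)..s, Real.exp (2 * m r) • A r (ext v r) := by
    intro s hs
    rw [hv' s hs]
    simp only [Tf]
    rw [smul_smul, ← Real.exp_add]
    simp
  refine ⟨fun s => Real.exp (2 * m s) • ext v s, ?_, ?_, ?_⟩
  · exact (hy 0 h0).trans (by simp)
  · simpa using hI v
  · intro s hs
    exact (hy s hs).trans (by rw [hy 0 h0]; simp)

end LinearODE

/-! ### Orthonormal frames driven by integrable strains. -/

section Framing

/-- Orthonormal frames along a curve on `[0, L]` driven by the strains `W = (κ₁, κ₂, ω)`. -/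
structure Framing (L : ℝ) (W x t d : ℝ → E3) : Prop where
  L_pos : 0 < L
  integrableOn : IntegrableOn W (Icc 0 L)
  primitive_x : IsPrimitive L x t
  primitive_t : IsPrimitive L t fun s => W s 1 • d s - W s 0 • cross (t s) (d s)
  primitive_d : IsPrimitive L d fun s => W s 2 • cross (t s) (d s) - W s 1 • t s
  norm_t : ∀ s ∈ Icc 0 L, ‖t s‖ = 1
  norm_d : ∀ s ∈ Icc 0 L, ‖d s‖ = 1
  inner_td : ∀ s ∈ Icc 0 L, inner ℝ (t s) (d s) = 0

lemma integrableOn_apply {L : ℝ} {W : ℝ → E3} (hW : IntegrableOn W (Icc 0 L)) (i : Fin 3) :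
    IntegrableOn (fun s => W s i) (Icc 0 L) :=
  (EuclideanSpace.proj (𝕜 := ℝ) i : E3 →L[ℝ] ℝ).integrable_comp hW

lemma _root_.AbsolutelyContinuousOnInterval.realInner {f g : ℝ → E3} {a b : ℝ}
    (hf : AbsolutelyContinuousOnInterval f a b) (hg : AbsolutelyContinuousOnInterval g a b) :
    AbsolutelyContinuousOnInterval (fun s => inner ℝ (f s) (g s)) a b :=
  (hf.prodMk hg).contDiff_comp (φ := fun q : E3 × E3 => inner ℝ q.1 q.2) contDiff_inner

lemma _root_.AbsolutelyContinuousOnInterval.cross {f g : ℝ → E3} {a b : ℝ}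
    (hf : AbsolutelyContinuousOnInterval f a b) (hg : AbsolutelyContinuousOnInterval g a b) :
    AbsolutelyContinuousOnInterval (fun s => KirchhoffRod.cross (f s) (g s)) a b :=
  (hf.prodMk hg).contDiff_comp (φ := fun q : E3 × E3 => KirchhoffRod.cross q.1 q.2)
    crossL.isBoundedBilinearMap.contDiff

lemma absolutelyContinuous_const {X : Type*} [PseudoMetricSpace X] (c : X) (a b : ℝ) :
    AbsolutelyContinuousOnInterval (fun _ : ℝ => c) a b :=
  ((LipschitzWith.const c).lipschitzOnWith (s := uIcc a b)).absolutelyContinuousOnInterval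

lemma _root_.AbsolutelyContinuousOnInterval.sub_const_sq {f : ℝ → ℝ} {a b : ℝ}
    (hf : AbsolutelyContinuousOnInterval f a b) (c : ℝ) :
    AbsolutelyContinuousOnInterval (fun s => (f s - c) ^ 2) a b :=
  hf.contDiff_comp (φ := fun z : ℝ => (z - c) ^ 2) (by fun_prop)

section

variable {L : ℝ} {W t d n : ℝ → E3}

/-- The coefficient matrix `A` of the system is skew-symmetric, so the Gram matrix `Q` of `(t, d,
n)` satisfies `Q' = A Q - Q A` and the squared Frobenius distance of `Q` from the identity is
constant. It starts at 0. Off-diagonal entries occur twice, hence the factors 2. -/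
lemma gram_conserved (hL : 0 ≤ L)
    (ht : IsPrimitive L t fun s => W s 1 • d s - W s 0 • n s)
    (hd : IsPrimitive L d fun s => W s 2 • n s - W s 1 • t s)
    (hn : IsPrimitive L n fun s => W s 0 • t s - W s 2 • d s)
    (ht0 : ‖t 0‖ = 1) (hd0 : ‖d 0‖ = 1) (hn0 : ‖n 0‖ = 1) (htd : inner ℝ (t 0) (d 0) = 0)
    (htn : inner ℝ (t 0) (n 0) = 0) (hdn : inner ℝ (d 0) (n 0) = 0) {s : ℝ} (hs : s ∈ Icc 0 L) :
    ‖t s‖ = 1 ∧ ‖d s‖ = 1 ∧ ‖n s‖ = 1 ∧ inner ℝ (t s) (d s) = 0 := by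
  have at' := ht.absolutelyContinuous hL
  have ad := hd.absolutelyContinuous hL
  have an := hn.absolutelyContinuous hL
  have hac := ((((((at'.realInner at').sub_const_sq 1).fun_add ((ad.realInner ad).sub_const_sq 1)).fun_add
    ((an.realInner an).sub_const_sq 1)).fun_add (((at'.realInner ad).sub_const_sq 0).const_mul 2)).fun_add
    (((at'.realInner an).sub_const_sq 0).const_mul 2)).fun_add (((ad.realInner an).sub_const_sq 0).const_mul 2)
  have hE := hac.eq_of_hasDerivAt_zero (s := s) (by
    filter_upwards [ht.ae_hasDerivAt hL, hd.ae_hasDerivAt hL, hn.ae_hasDerivAt hL] with r h1 h2 h3 hr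
    rw [uIcc_of_le hL] at hr
    replace h1 := h1 hr
    replace h2 := h2 hr
    replace h3 := h3 hr
    have e1 := ((h1.inner ℝ h1).sub_const 1).pow 2
    have e2 := ((h2.inner ℝ h2).sub_const 1).pow 2
    have e3 := ((h3.inner ℝ h3).sub_const 1).pow 2
    have e4 := (((h1.inner ℝ h2).sub_const 0).pow 2).const_mul 2
    have e5 := (((h1.inner ℝ h3).sub_const 0).pow 2).const_mul 2
    have e6 := (((h2.inner ℝ h3).sub_const 0).pow 2).const_mul 2
    refine (((((e1.add e2).add e3).add e4).add e5).add e6).congr_deriv ?_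
    simp only [inner_sub_left, inner_sub_right, inner_smul_left, inner_smul_right,
      real_inner_comm (t r) (d r), real_inner_comm (t r) (n r), real_inner_comm (d r) (n r)]
    simp
    ring) (by rwa [uIcc_of_le hL])
  simp only [real_inner_self_eq_norm_sq, ht0, hd0, hn0, htd, htn, hdn, sub_zero] at hE
  norm_num at hE
  have p1 := sq_nonneg (‖t s‖ ^ 2 - 1)
  have p2 := sq_nonneg (‖d s‖ ^ 2 - 1)
  have p3 := sq_nonneg (‖n s‖ ^ 2 - 1)
  have p4 := sq_nonneg (inner ℝ (t s) (d s))
  have p5 := sq_nonneg (inner ℝ (t s) (n s))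
  have p6 := sq_nonneg (inner ℝ (d s) (n s))
  have hone : ∀ z : E3, (‖z‖ ^ 2 - 1) ^ 2 = 0 → ‖z‖ = 1 := fun z hz => by
    have := pow_eq_zero_iff (two_ne_zero) |>.1 hz
    exact (pow_eq_one_iff_of_nonneg (norm_nonneg z) two_ne_zero).1 (by linarith)
  exact ⟨hone _ (by linarith), hone _ (by linarith), hone _ (by linarith),
    pow_eq_zero_iff two_ne_zero |>.1 (by linarith)⟩

/-- The coefficient matrix has trace zero. This fixes the orientation, which the Gram matrix does
not see. -/
lemma det_conserved (hL : 0 ≤ L)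
    (ht : IsPrimitive L t fun s => W s 1 • d s - W s 0 • n s)
    (hd : IsPrimitive L d fun s => W s 2 • n s - W s 1 • t s)
    (hn : IsPrimitive L n fun s => W s 0 • t s - W s 2 • d s) {s : ℝ} (hs : s ∈ Icc 0 L) :
    inner ℝ (cross (t s) (d s)) (n s) = inner ℝ (cross (t 0) (d 0)) (n 0) := by
  have at' := ht.absolutelyContinuous hL
  have ad := hd.absolutelyContinuous hL
  have an := hn.absolutelyContinuous hL
  refine ((at'.cross ad).realInner an).eq_of_hasDerivAt_zero (s := s) ?_ (by rwa [uIcc_of_le hL])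
  filter_upwards [ht.ae_hasDerivAt hL, hd.ae_hasDerivAt hL, hn.ae_hasDerivAt hL] with r h1 h2 h3 hr
  rw [uIcc_of_le hL] at hr
  refine (((h1 hr).cross (h2 hr)).inner ℝ (h3 hr)).congr_deriv ?_
  simp only [inner_eq_sum, cross_apply_zero, cross_apply_one, cross_apply_two, PiLp.add_apply,
    PiLp.sub_apply, PiLp.smul_apply, smul_eq_mul]
  ring

/-- A solution of the linear system of a moving frame that starts at an orthonormal frame stays
orthonormal. -/
lemma orthonormal_of_linear (hL : 0 ≤ L)
    (ht : IsPrimitive L t fun s => W s 1 • d s - W s 0 • n s)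
    (hd : IsPrimitive L d fun s => W s 2 • n s - W s 1 • t s)
    (hn : IsPrimitive L n fun s => W s 0 • t s - W s 2 • d s)
    (ht0 : ‖t 0‖ = 1) (hd0 : ‖d 0‖ = 1) (htd : inner ℝ (t 0) (d 0) = 0)
    (hn0 : n 0 = cross (t 0) (d 0)) {s : ℝ} (hs : s ∈ Icc 0 L) :
    ‖t s‖ = 1 ∧ ‖d s‖ = 1 ∧ inner ℝ (t s) (d s) = 0 ∧ n s = cross (t s) (d s) := by
  have n0 : ‖n 0‖ = 1 := by
    rw [← pow_eq_one_iff_of_nonneg (norm_nonneg _) two_ne_zero, hn0, norm_cross_sq, ht0, hd0, htd]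
    norm_num
  obtain ⟨c1, c2, c3, c4⟩ := gram_conserved hL ht hd hn ht0 hd0 n0 htd
    (by rw [hn0]; simp [inner_eq_sum]; ring) (by rw [hn0]; simp [inner_eq_sum]; ring) hs
  have c5 := det_conserved hL ht hd hn hs
  rw [← hn0, real_inner_self_eq_norm_sq, n0] at c5
  refine ⟨c1, c2, c4, ?_⟩
  -- Both `n` and `t × d` are unit vectors with inner product 1, so their difference vanishes.
  rw [← sub_eq_zero, ← norm_eq_zero, ← sq_eq_zero_iff, norm_sub_sq_real, norm_cross_sq, c4, c1, c2,
    c3, real_inner_comm, c5]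
  norm_num

end

/-- Every integrable strain field drives an orthonormal frame. -/
theorem exists_framing {L : ℝ} (hL : 0 < L) {W : ℝ → E3} (hW : IntegrableOn W (Icc 0 L))
    (x₀ t₀ d₀ : E3) (ht : ‖t₀‖ = 1) (hd : ‖d₀‖ = 1) (htd : inner ℝ t₀ d₀ = 0) :
    ∃ x t d : ℝ → E3, Framing L W x t d ∧ x 0 = x₀ ∧ t 0 = t₀ ∧ d 0 = d₀ := by
  let pt : E3 × E3 × E3 →L[ℝ] E3 := ContinuousLinearMap.fst ℝ _ _
  let pd : E3 × E3 × E3 →L[ℝ] E3 :=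
    ContinuousLinearMap.fst ℝ _ _ ∘L ContinuousLinearMap.snd ℝ E3 (E3 × E3)
  let pn : E3 × E3 × E3 →L[ℝ] E3 :=
    ContinuousLinearMap.snd ℝ _ _ ∘L ContinuousLinearMap.snd ℝ E3 (E3 × E3)
  -- The normal `n` is an independent third unknown, which makes the frame equations linear in `(t,
  -- d, n)`; `M₀`, `M₁`, `M₂` are the coefficients of `κ₁`, `κ₂`, `ω`. That `n = t × d` is recovered
  -- afterwards.
  let M₀ : E3 × E3 × E3 →L[ℝ] E3 × E3 × E3 := (-pn).prod ((0 : E3 × E3 × E3 →L[ℝ] E3).prod pt)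
  let M₁ : E3 × E3 × E3 →L[ℝ] E3 × E3 × E3 := pd.prod ((-pt).prod 0)
  let M₂ : E3 × E3 × E3 →L[ℝ] E3 × E3 × E3 := (0 : E3 × E3 × E3 →L[ℝ] E3).prod (pn.prod (-pd))
  have hA : IntegrableOn (fun s => W s 0 • M₀ + W s 1 • M₁ + W s 2 • M₂) (Icc 0 L) :=
    (((integrableOn_apply hW 0).smul_const M₀).add ((integrableOn_apply hW 1).smul_const M₁)).add
      ((integrableOn_apply hW 2).smul_const M₂)
  obtain ⟨y, hy0, hy⟩ := exists_isPrimitive_linear hL.le hA (t₀, d₀, cross t₀ d₀)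
  have hcomp : ∀ P : E3 × E3 × E3 →L[ℝ] E3, IsPrimitive L (fun s => P (y s)) (fun s =>
      P ((W s 0 • M₀ + W s 1 • M₁ + W s 2 • M₂) (y s))) := fun P =>
    ⟨P.integrable_comp hy.integrableOn, fun s hs => by
      rw [P.intervalIntegral_comp_comm (hy.intervalIntegrable ⟨le_rfl, hL.le⟩ hs), ← map_add,
        ← hy.eq_add s hs]⟩
  have hcongr : ∀ {f g g' : ℝ → E3}, (∀ s ∈ Icc 0 L, g s = g' s) → IsPrimitive L f g →
      IsPrimitive L f g' := fun {f g g'} h hp =>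
    ⟨hp.integrableOn.congr_fun h measurableSet_Icc, fun s hs => by
      rw [hp.eq_add s hs]
      congr 1
      refine intervalIntegral.integral_congr fun r hr => h r ?_
      exact uIcc_subset_Icc ⟨le_rfl, hL.le⟩ hs hr⟩
  have h1 : IsPrimitive L (fun s => (y s).1) fun s => W s 1 • (y s).2.1 - W s 0 • (y s).2.2 := by
    refine hcongr (fun s _ => ?_) (hcomp pt)
    change W s 0 • (-(y s).2.2) + W s 1 • (y s).2.1 + W s 2 • (0 : E3) = _
    module
  have h2 : IsPrimitive L (fun s => (y s).2.1) fun s => W s 2 • (y s).2.2 - W s 1 • (y s).1 := by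
    refine hcongr (fun s _ => ?_) (hcomp pd)
    change W s 0 • (0 : E3) + W s 1 • (-(y s).1) + W s 2 • (y s).2.2 = _
    module
  have h3 : IsPrimitive L (fun s => (y s).2.2) fun s => W s 0 • (y s).1 - W s 2 • (y s).2.1 := by
    refine hcongr (fun s _ => ?_) (hcomp pn)
    change W s 0 • (y s).1 + W s 1 • (0 : E3) + W s 2 • (-(y s).2.1) = _
    module
  have hg := fun s hs => orthonormal_of_linear hL.le h1 h2 h3 (by rwa [hy0]) (by rwa [hy0])
    (by rwa [hy0]) (by rw [hy0]) (s := s) hs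
  have hx : IsPrimitive L (fun s => x₀ + ∫ r in (0 : ℝ)..s, (y r).1) fun s => (y s).1 :=
    ⟨(h1.continuousOn hL.le).integrableOn_Icc, fun s _ => by simp⟩
  refine ⟨_, _, _, ⟨hL, hW, hx, hcongr ?_ h1, hcongr ?_ h2, fun s hs => (hg s hs).1,
    fun s hs => (hg s hs).2.1, fun s hs => (hg s hs).2.2.1⟩, by simp, by simp [hy0], by simp [hy0]⟩
  · intro s hs; simp only [(hg s hs).2.2.2]
  · intro s hs; simp only [(hg s hs).2.2.2]

end Framing

/-! ### Uniqueness of frames. -/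

section Uniqueness

variable {L : ℝ} {W x t d x' t' d' : ℝ → E3}

/-- In the nonlinear system `t × d` is orthogonal to `t` and `d`, so the Gram matrix of this pair
obeys a closed system, and its squared distance from the identity is again conserved. -/
lemma Framing.of_isPrimitive (hL : 0 < L) (hW : IntegrableOn W (Icc 0 L))
    (hx : IsPrimitive L x t)
    (ht : IsPrimitive L t fun s => W s 1 • d s - W s 0 • cross (t s) (d s))
    (hd : IsPrimitive L d fun s => W s 2 • cross (t s) (d s) - W s 1 • t s)
    (ht0 : ‖t 0‖ = 1) (hd0 : ‖d 0‖ = 1) (htd : inner ℝ (t 0) (d 0) = 0) : Framing L W x t d := by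
  have at' := ht.absolutelyContinuous hL.le
  have ad := hd.absolutelyContinuous hL.le
  have hac := (((at'.realInner at').sub_const_sq 1).fun_add ((ad.realInner ad).sub_const_sq 1)).fun_add
    (((at'.realInner ad).sub_const_sq 0).const_mul 2)
  have key : ∀ s ∈ Icc 0 L, ‖t s‖ = 1 ∧ ‖d s‖ = 1 ∧ inner ℝ (t s) (d s) = 0 := by
    intro s hs
    have hE := hac.eq_of_hasDerivAt_zero (s := s) (by
      filter_upwards [ht.ae_hasDerivAt hL.le, hd.ae_hasDerivAt hL.le] with r h1 h2 hr
      rw [uIcc_of_le hL.le] at hr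
      replace h1 := h1 hr
      replace h2 := h2 hr
      have e1 := ((h1.inner ℝ h1).sub_const 1).pow 2
      have e2 := ((h2.inner ℝ h2).sub_const 1).pow 2
      have e4 := (((h1.inner ℝ h2).sub_const 0).pow 2).const_mul 2
      refine ((e1.add e2).add e4).congr_deriv ?_
      have f1 : inner ℝ (t r) (cross (t r) (d r)) = 0 := by simp [inner_eq_sum]; ring
      have f2 : inner ℝ (d r) (cross (t r) (d r)) = 0 := by simp [inner_eq_sum]; ring
      have f3 : inner ℝ (cross (t r) (d r)) (t r) = 0 := by rw [real_inner_comm, f1]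
      have f4 : inner ℝ (cross (t r) (d r)) (d r) = 0 := by rw [real_inner_comm, f2]
      simp only [inner_sub_left, inner_sub_right, inner_smul_left, inner_smul_right,
        real_inner_comm (t r) (d r), f1, f2, f3, f4]
      simp
      ring) (by rwa [uIcc_of_le hL.le])
    simp only [real_inner_self_eq_norm_sq, ht0, hd0, htd, sub_zero] at hE
    norm_num at hE
    have p1 := sq_nonneg (‖t s‖ ^ 2 - 1)
    have p2 := sq_nonneg (‖d s‖ ^ 2 - 1)
    have p4 := sq_nonneg (inner ℝ (t s) (d s))
    have hone : ∀ z : E3, (‖z‖ ^ 2 - 1) ^ 2 = 0 → ‖z‖ = 1 := fun z hz => by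
      have := pow_eq_zero_iff (two_ne_zero) |>.1 hz
      exact (pow_eq_one_iff_of_nonneg (norm_nonneg z) two_ne_zero).1 (by linarith)
    exact ⟨hone _ (by linarith), hone _ (by linarith), pow_eq_zero_iff two_ne_zero |>.1 (by linarith)⟩
  exact ⟨hL, hW, hx, ht, hd, fun s hs => (key s hs).1, fun s hs => (key s hs).2.1,
    fun s hs => (key s hs).2.2⟩

lemma cross_sub_cross (a b a' b' : E3) :
    cross a b - cross a' b' = cross (a - a') b + cross a' (b - b') := by
  simp only [← crossL_apply, map_sub, sub_apply]; abel

/-- Orthonormal frames are determined by their strains and their initial values. -/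
lemma Framing.unique (h : Framing L W x t d) (h' : Framing L W x' t' d') (hx0 : x 0 = x' 0)
    (ht0 : t 0 = t' 0) (hd0 : d 0 = d' 0) {s : ℝ} (hs : s ∈ Icc 0 L) :
    x s = x' s ∧ t s = t' s ∧ d s = d' s := by
  have hL := h.L_pos.le
  have h0 : (0 : ℝ) ∈ Icc 0 L := ⟨le_rfl, hL⟩
  have hc : ContinuousOn (fun s => (t s - t' s, d s - d' s)) (Icc 0 L) :=
    ((h.primitive_t.continuousOn hL).sub (h'.primitive_t.continuousOn hL)).prodMk
      ((h.primitive_d.continuousOn hL).sub (h'.primitive_d.continuousOn hL))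
  -- The right-hand sides are Lipschitz in `(t, d)` with constant `3‖W‖`: 1 from the term with `t`
  -- or `d`, and 2 from the vector product of unit vectors.
  have hk : IntegrableOn (fun s => 3 * ‖W s‖) (Icc 0 L) := h.integrableOn.norm.const_mul 3
  have hki : ∀ s ∈ Icc 0 L, IntervalIntegrable
      (fun r => 3 * ‖W r‖ * ‖(t r - t' r, d r - d' r)‖) volume 0 s := fun s hs =>
    IsPrimitive.intervalIntegrable_of (hk.mul_continuousOn hc.norm isCompact_Icc) h0 hs
  have hcr : ∀ r ∈ Icc 0 L, ‖cross (t r) (d r) - cross (t' r) (d' r)‖ ≤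
      2 * ‖(t r - t' r, d r - d' r)‖ := fun r hr => by
    rw [cross_sub_cross]
    refine (norm_add_le _ _).trans ?_
    have e1 := norm_cross_le (t r - t' r) (d r)
    have e2 := norm_cross_le (t' r) (d r - d' r)
    rw [h.norm_d r hr] at e1
    rw [h'.norm_t r hr] at e2
    have e3 := norm_fst_le (t r - t' r, d r - d' r)
    have e4 := norm_snd_le (t r - t' r, d r - d' r)
    simp only at e3 e4
    linarith
  have main : ∀ (f f' g g' : ℝ → E3), IsPrimitive L f g → IsPrimitive L f' g' → f 0 = f' 0 →
      (∀ r ∈ Icc 0 L, ‖g r - g' r‖ ≤ 3 * ‖W r‖ * ‖(t r - t' r, d r - d' r)‖) →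
      ∀ s ∈ Icc 0 L, ‖f s - f' s‖ ≤ ∫ r in (0 : ℝ)..s, 3 * ‖W r‖ * ‖(t r - t' r, d r - d' r)‖ := by
    intro f f' g g' hf hf' h00 hle s hs
    rw [hf.eq_add s hs, hf'.eq_add s hs, h00, add_sub_add_left_eq_sub,
      ← intervalIntegral.integral_sub (hf.intervalIntegrable h0 hs) (hf'.intervalIntegrable h0 hs)]
    exact intervalIntegral.norm_integral_le_of_norm_le hs.1
      (Eventually.of_forall fun r hr => hle r ⟨hr.1.le, hr.2.trans hs.2⟩) (hki s hs)
  have hz : ∀ s ∈ Icc 0 L, (t s - t' s, d s - d' s) = 0 := fun s hs => by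
    refine eq_zero_of_norm_le_integral (δ := fun s => (t s - t' s, d s - d' s)) hL hk
      (fun s => by positivity) hc (fun s hs => ?_) hs
    rw [Prod.norm_def]
    refine max_le (main _ _ _ _ h.primitive_t h'.primitive_t ht0 (fun r hr => ?_) s hs)
      (main _ _ _ _ h.primitive_d h'.primitive_d hd0 (fun r hr => ?_) s hs)
    · have e : W r 1 • d r - W r 0 • cross (t r) (d r) - (W r 1 • d' r - W r 0 • cross (t' r) (d' r))
          = W r 1 • (d r - d' r) - W r 0 • (cross (t r) (d r) - cross (t' r) (d' r)) := by module
      rw [e]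
      refine (norm_sub_le _ _).trans ?_
      rw [norm_smul, norm_smul, Real.norm_eq_abs, Real.norm_eq_abs]
      have e4 := norm_snd_le (t r - t' r, d r - d' r)
      have e5 := mul_le_mul (abs_apply_le_norm (W r) 1) e4 (norm_nonneg _) (norm_nonneg _)
      have e6 := mul_le_mul (abs_apply_le_norm (W r) 0) (hcr r hr) (norm_nonneg _) (norm_nonneg _)
      simp only at e5
      linarith
    · have e : W r 2 • cross (t r) (d r) - W r 1 • t r - (W r 2 • cross (t' r) (d' r) - W r 1 • t' r)
          = W r 2 • (cross (t r) (d r) - cross (t' r) (d' r)) - W r 1 • (t r - t' r) := by module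
      rw [e]
      refine (norm_sub_le _ _).trans ?_
      rw [norm_smul, norm_smul, Real.norm_eq_abs, Real.norm_eq_abs]
      have e4 := norm_fst_le (t r - t' r, d r - d' r)
      have e5 := mul_le_mul (abs_apply_le_norm (W r) 1) e4 (norm_nonneg _) (norm_nonneg _)
      have e6 := mul_le_mul (abs_apply_le_norm (W r) 2) (hcr r hr) (norm_nonneg _) (norm_nonneg _)
      simp only at e5
      linarith
  have hz1 : ∀ s ∈ Icc 0 L, t s = t' s := fun s hs => sub_eq_zero.1 (congrArg Prod.fst (hz s hs))
  have hz2 : ∀ s ∈ Icc 0 L, d s = d' s := fun s hs => sub_eq_zero.1 (congrArg Prod.snd (hz s hs))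
  refine ⟨?_, hz1 s hs, hz2 s hs⟩
  rw [h.primitive_x.eq_add s hs, h'.primitive_x.eq_add s hs, hx0]
  congr 1
  exact intervalIntegral.integral_congr fun r hr => hz1 r (uIcc_subset_Icc h0 hs hr)

end Uniqueness

/-! ### The frame of a configuration. -/

namespace Rod

variable {B : Rod}

lemma integrableOn_strain (w : B.V) : IntegrableOn (w.1 : ℝ → E3) (Icc 0 B.L) :=
  (Lp.memLp w.1).integrable B.one_lt_p.le

/-- The frame `(x, t, d)[w]` is an orthonormal frame along the midline. -/
theorem framing (w : B.V) (ht : ‖w.2.2.1‖ = 1) (hd : ‖w.2.2.2‖ = 1)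
    (htd : inner ℝ w.2.2.1 w.2.2.2 = 0) :
    Framing B.L w.1 (x w) (t w) (d w) ∧ x w 0 = w.2.1 ∧ t w 0 = w.2.2.1 ∧ d w 0 = w.2.2.2 := by
  have h0 : (0 : ℝ) ∈ Icc 0 B.L := ⟨le_rfl, B.L_pos.le⟩
  have hW := integrableOn_strain w
  obtain ⟨x', t', d', hf, hx', ht', hd'⟩ := exists_framing B.L_pos hW w.2.1 w.2.2.1 w.2.2.2 ht hd htd
  -- `frame` is selected by `Classical.epsilon`, so it solves the equations only once existence is
  -- known.
  have hex : ∃ F : (ℝ → E3) × (ℝ → E3) × (ℝ → E3), IsFrame w F.1 F.2.1 F.2.2 :=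
    ⟨(x', t', d'), hf.primitive_t.continuousOn B.L_pos.le, hf.primitive_d.continuousOn B.L_pos.le,
      fun s hs => by rw [← hx']; exact hf.primitive_x.eq_add s hs,
      fun s hs => by rw [← ht']; exact hf.primitive_t.eq_add s hs,
      fun s hs => by rw [← hd']; exact hf.primitive_d.eq_add s hs⟩
  have hF : IsFrame w (x w) (t w) (d w) := Classical.epsilon_spec hex
  have ex : x w 0 = w.2.1 := by simpa using hF.eq_x 0 h0
  have et : t w 0 = w.2.2.1 := by simpa using hF.eq_t 0 h0
  have ed : d w 0 = w.2.2.2 := by simpa using hF.eq_d 0 h0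
  have hcr := hF.continuousOn_t.cross hF.continuousOn_d
  have hi : ∀ (i : Fin 3) (g : ℝ → E3), ContinuousOn g (Icc 0 B.L) →
      IntegrableOn (fun s => w.1 s i • g s) (Icc 0 B.L) := fun i g hg =>
    (integrableOn_apply hW i).smul_continuousOn hg isCompact_Icc
  refine ⟨Framing.of_isPrimitive B.L_pos hW ⟨hF.continuousOn_t.integrableOn_Icc, ?_⟩
    ⟨(hi 1 _ hF.continuousOn_d).sub (hi 0 _ hcr), ?_⟩
    ⟨(hi 2 _ hcr).sub (hi 1 _ hF.continuousOn_t), ?_⟩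
    (by rwa [et]) (by rwa [ed]) (by rwa [et, ed]), ex, et, ed⟩
  · intro s hs; rw [ex]; exact hF.eq_x s hs
  · intro s hs; rw [et]; exact hF.eq_t s hs
  · intro s hs; rw [ed]; exact hF.eq_d s hs

end Rod

/-! ### Strongly convergent selections from bounded convex sets. -/

section ConvexLimit

variable {α E : Type*} [MeasurableSpace α] {μ : Measure α} [NormedAddCommGroup E]

/-- A strictly convex function of linear growth. -/
def bracket (a : E) : ℝ := Real.sqrt (1 + ‖a‖ ^ 2)

lemma bracket_sq (a : E) : bracket a ^ 2 = 1 + ‖a‖ ^ 2 := Real.sq_sqrt (by positivity)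

lemma one_le_bracket (a : E) : 1 ≤ bracket a := Real.one_le_sqrt.2 (by nlinarith [sq_nonneg ‖a‖])

lemma norm_le_bracket (a : E) : ‖a‖ ≤ bracket a := Real.le_sqrt_of_sq_le (by linarith)

lemma bracket_le (a : E) : bracket a ≤ 1 + ‖a‖ :=
  Real.sqrt_le_iff.2 ⟨by positivity, by nlinarith [norm_nonneg a]⟩

lemma continuous_bracket : Continuous (bracket : E → ℝ) := by
  unfold bracket; fun_prop

lemma integrable_bracket [IsFiniteMeasure μ] {v : α → E} (hv : Integrable v μ) :
    Integrable (fun s => bracket (v s)) μ := by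
  refine ((integrable_const (1 : ℝ)).add hv.norm).mono'
    (continuous_bracket.comp_aestronglyMeasurable hv.aestronglyMeasurable) ?_
  filter_upwards with s
  rw [Real.norm_of_nonneg (zero_le_one.trans (one_le_bracket _))]
  exact bracket_le _

lemma integrable_bracket_add_rpow [IsFiniteMeasure μ] {p : ℝ≥0∞} (hp : 1 < p) (hp' : p < ⊤)
    {v w : α → E} (hv : MemLp v p μ) (hw : MemLp w p μ) :
    Integrable (fun s => (bracket (v s) + bracket (w s)) ^ p.toReal) μ := by
  have hb : ∀ {u : α → E}, MemLp u p μ → MemLp (fun s => bracket (u s)) p μ := fun {u} hu =>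
    ((memLp_const (1 : ℝ)).add hu.norm).of_le
      (continuous_bracket.comp_aestronglyMeasurable hu.aestronglyMeasurable)
      (by
        filter_upwards with s
        rw [Real.norm_of_nonneg (zero_le_one.trans (one_le_bracket _))]
        exact (bracket_le _).trans (le_abs_self _))
  have := ((hb hv).add (hb hw)).integrable_norm_rpow (zero_lt_one.trans hp).ne' hp'.ne
  refine this.congr (Eventually.of_forall fun s => ?_)
  simp only [Pi.add_apply]
  rw [Real.norm_of_nonneg]
  have := one_le_bracket (v s); have := one_le_bracket (w s); positivity

/-- By Minkowski's inequality for `2 + ‖v‖ + ‖w‖`. The uniform bound will control the region where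
the functions take large values. -/
lemma integral_bracket_add_rpow_le [IsFiniteMeasure μ] {p : ℝ≥0∞} (hp : 1 < p) (hp' : p < ⊤)
    (M : NNReal) : ∃ K : ℝ, 0 ≤ K ∧ ∀ v w : α → E, AEStronglyMeasurable v μ → AEStronglyMeasurable w μ →
      eLpNorm v p μ ≤ M → eLpNorm w p μ ≤ M →
      ∫ s, (bracket (v s) + bracket (w s)) ^ p.toReal ∂μ ≤ K := by
  have hp0 : p ≠ 0 := (zero_lt_one.trans hp).ne'
  set c := eLpNorm (fun _ : α => (2 : ℝ)) p μ
  have hc : c ≠ ⊤ := (memLp_const (2 : ℝ)).eLpNorm_ne_top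
  refine ⟨((c + (M + M)) ^ p.toReal).toReal, ENNReal.toReal_nonneg, fun v w hv hw hvM hwM => ?_⟩
  have hvL : MemLp v p μ := ⟨hv, hvM.trans_lt ENNReal.coe_lt_top⟩
  have hwL : MemLp w p μ := ⟨hw, hwM.trans_lt ENNReal.coe_lt_top⟩
  have hle : eLpNorm (fun s => bracket (v s) + bracket (w s)) p μ ≤ c + (M + M) := by
    calc eLpNorm (fun s => bracket (v s) + bracket (w s)) p μ
        ≤ eLpNorm ((fun _ : α => (2 : ℝ)) + ((fun s => ‖v s‖) + fun s => ‖w s‖)) p μ := by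
          refine eLpNorm_mono fun s => ?_
          have h1 := bracket_le (v s); have h2 := bracket_le (w s)
          have h3 := one_le_bracket (v s); have h4 := one_le_bracket (w s)
          rw [Real.norm_of_nonneg (by positivity)]
          refine le_trans ?_ (le_abs_self _)
          simp only [Pi.add_apply]
          linarith
      _ ≤ c + (eLpNorm (fun s => ‖v s‖) p μ + eLpNorm (fun s => ‖w s‖) p μ) :=
          (eLpNorm_add_le aestronglyMeasurable_const (hv.norm.add hw.norm) hp.le).trans
            (by gcongr; exact eLpNorm_add_le hv.norm hw.norm hp.le)
      _ ≤ c + (M + M) := by rw [eLpNorm_norm, eLpNorm_norm]; gcongr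
  have hnn : ∀ s, 0 ≤ bracket (v s) + bracket (w s) := fun s => by
    have h3 := one_le_bracket (v s); have h4 := one_le_bracket (w s); positivity
  rw [integral_eq_lintegral_of_nonneg_ae (Eventually.of_forall fun s => Real.rpow_nonneg (hnn s) _)
    (integrable_bracket_add_rpow hp hp' hvL hwL).aestronglyMeasurable]
  refine ENNReal.toReal_mono (ENNReal.rpow_ne_top_of_nonneg ENNReal.toReal_nonneg (by simp [hc])) ?_
  have := ENNReal.rpow_le_rpow hle (ENNReal.toReal_nonneg (a := p))
  refine le_trans (le_of_eq ?_) this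
  rw [eLpNorm_eq_lintegral_rpow_enorm_toReal hp0 hp'.ne, ← ENNReal.rpow_mul, one_div,
    inv_mul_cancel₀ (ENNReal.toReal_pos hp0 hp'.ne).ne', ENNReal.rpow_one]
  refine lintegral_congr fun s => ?_
  rw [← ENNReal.ofReal_rpow_of_nonneg (hnn s) ENNReal.toReal_nonneg, Real.enorm_eq_ofReal (hnn s)]

variable [InnerProductSpace ℝ E]

/-- Quantitative strict convexity of `bracket`. -/
lemma norm_sub_sq_le_bracket_gap (a b : E) :
    ‖a - b‖ ^ 2 ≤ (bracket a + bracket b) ^ 3 *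
      ((bracket a + bracket b) / 2 - bracket ((1 / 2 : ℝ) • a + (1 / 2 : ℝ) • b)) := by
  set X := bracket a
  set Y := bracket b
  set Z := bracket ((1 / 2 : ℝ) • a + (1 / 2 : ℝ) • b)
  have hX : 1 ≤ X := one_le_bracket a
  have hY : 1 ≤ Y := one_le_bracket b
  have hZ : 1 ≤ Z := one_le_bracket _
  have hX2 : X ^ 2 = 1 + ‖a‖ ^ 2 := bracket_sq a
  have hY2 : Y ^ 2 = 1 + ‖b‖ ^ 2 := bracket_sq b
  set c := inner ℝ a b
  have hZ2 : 4 * Z ^ 2 = 4 + ‖a‖ ^ 2 + ‖b‖ ^ 2 + 2 * c := by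
    have h1 : Z ^ 2 = 1 + ‖(1 / 2 : ℝ) • a + (1 / 2 : ℝ) • b‖ ^ 2 := bracket_sq _
    rw [h1, ← smul_add, norm_smul, mul_pow, norm_add_sq_real]
    norm_num; ring
  have hc : |c| ≤ ‖a‖ * ‖b‖ := abs_real_inner_le_norm a b
  have hc2 : c ^ 2 ≤ ‖a‖ ^ 2 * ‖b‖ ^ 2 := by
    rw [← mul_pow, ← sq_abs c]; gcongr
  have hab : ‖a - b‖ ^ 2 = ‖a‖ ^ 2 + ‖b‖ ^ 2 - 2 * c := by rw [norm_sub_sq_real]; ring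
  -- The right side exceeds the left by `‖a‖² ‖b‖² - c²`, which is nonnegative by Cauchy–Schwarz.
  have h1 : ‖a - b‖ ^ 2 ≤ (X * Y) ^ 2 - (1 + c) ^ 2 := by
    rw [mul_pow, hX2, hY2, hab]; linarith
  have hXY : 1 + c ≤ X * Y := by
    apply le_of_sq_le_sq _ (by positivity)
    linarith [sq_nonneg ‖a - b‖]
  have hXY1 : 1 ≤ X * Y := one_le_mul_of_one_le_of_one_le hX hY
  have hd0 : 0 ≤ X * Y - (1 + c) := by linarith
  have h2 : ‖a - b‖ ^ 2 ≤ (X * Y - (1 + c)) * ((X + Y) ^ 2 / 2) := by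
    have : (X * Y) ^ 2 - (1 + c) ^ 2 = (X * Y - (1 + c)) * (X * Y + (1 + c)) := by ring
    refine h1.trans (this.trans_le (mul_le_mul_of_nonneg_left ?_ hd0))
    linarith [sq_nonneg (X - Y)]
  -- This is `(X + Y)² - 4 Z² = 2 (X Y - (1 + c))`; it relates the defect `X Y - (1 + c)` to the
  -- convexity gap.
  have h3 : (X + Y - 2 * Z) * (X + Y) + (X + Y - 2 * Z) * (2 * Z) = 2 * (X * Y - (1 + c)) := by
    linarith
  have hZle : 2 * Z ≤ X + Y := by
    by_contra hcon
    push Not at hcon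
    have : (X + Y - 2 * Z) * (X + Y + 2 * Z) < 0 :=
      mul_neg_of_neg_of_pos (by linarith) (by linarith)
    linarith
  have h4 : X * Y - (1 + c) ≤ (X + Y - 2 * Z) * (X + Y) := by
    have := mul_le_mul_of_nonneg_left hZle (by linarith : 0 ≤ X + Y - 2 * Z)
    linarith
  calc ‖a - b‖ ^ 2 ≤ (X * Y - (1 + c)) * ((X + Y) ^ 2 / 2) := h2
    _ ≤ ((X + Y - 2 * Z) * (X + Y)) * ((X + Y) ^ 2 / 2) := by gcongr
    _ = _ := by ring

/-- Where `bracket a + bracket b ≤ R`, the quadratic gap estimate and `r ≤ δ + r² / δ` apply.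
Elsewhere `‖a - b‖` is at most the sum of the brackets, which is at most `R ^ (1 - q)` times its
`q`-th power. Integrated, this turns small convexity gaps into `L¹`-closeness of `L^q`-bounded
functions. -/
lemma norm_sub_le_bracket_gap (a b : E) {q R δ : ℝ} (hq : 1 < q) (hR : 0 < R) (hδ : 0 < δ) :
    ‖a - b‖ ≤ δ + R ^ 3 / δ *
        ((bracket a + bracket b) / 2 - bracket ((1 / 2 : ℝ) • a + (1 / 2 : ℝ) • b)) +
      R ^ (1 - q) * (bracket a + bracket b) ^ q := by
  set S := bracket a + bracket b
  set G := S / 2 - bracket ((1 / 2 : ℝ) • a + (1 / 2 : ℝ) • b)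
  have hS : 0 < S := by have := one_le_bracket a; have := one_le_bracket b; positivity
  have hgap := norm_sub_sq_le_bracket_gap a b
  change ‖a - b‖ ^ 2 ≤ S ^ 3 * G at hgap
  have hG : 0 ≤ G := by
    by_contra hcon
    push Not at hcon
    have : S ^ 3 * G < 0 := mul_neg_of_pos_of_neg (by positivity) hcon
    linarith [sq_nonneg ‖a - b‖]
  by_cases hSR : S ≤ R
  · have h1 : ‖a - b‖ ^ 2 ≤ R ^ 3 * G := hgap.trans (by gcongr)
    have h2 : ‖a - b‖ ≤ δ + R ^ 3 / δ * G := by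
      have e : R ^ 3 / δ * G = (R ^ 3 * G) / δ := by ring
      rw [e]
      have h3 : ‖a - b‖ ^ 2 / δ ≤ R ^ 3 * G / δ := by gcongr
      have h4 : ‖a - b‖ ≤ δ + ‖a - b‖ ^ 2 / δ := by
        rw [← sub_nonneg]
        have : δ + ‖a - b‖ ^ 2 / δ - ‖a - b‖ = (δ ^ 2 + ‖a - b‖ ^ 2 - ‖a - b‖ * δ) / δ := by
          field_simp
        rw [this]
        apply div_nonneg _ hδ.le
        nlinarith [sq_nonneg (δ - ‖a - b‖), mul_nonneg hδ.le (norm_nonneg (a - b))]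
      linarith
    have : 0 ≤ R ^ (1 - q) * S ^ q := by positivity
    linarith
  · push Not at hSR
    have h1 : ‖a - b‖ ≤ S := (norm_sub_le a b).trans (add_le_add (norm_le_bracket a) (norm_le_bracket b))
    have h2 : S ≤ R ^ (1 - q) * S ^ q := by
      have e : S = S ^ (1 - q) * S ^ q := by rw [← Real.rpow_add hS]; simp
      calc S = S ^ (1 - q) * S ^ q := e
        _ ≤ R ^ (1 - q) * S ^ q := by
          gcongr ?_ * _
          exact Real.rpow_le_rpow_of_nonpos hR hSR.le (by linarith)
    have : 0 ≤ R ^ 3 / δ * G := by positivity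
    linarith

/-- From a decreasing sequence of nonempty convex sets that are bounded in `L^p`, `1 < p < ∞`, one
can choose a sequence that converges almost everywhere and in `L¹`. -/
theorem exists_tendsto_of_convex [CompleteSpace E] [IsFiniteMeasure μ] {p : ℝ≥0∞} (hp : 1 < p) (hp' : p < ⊤)
    {C : ℕ → Set (α → E)} (hanti : Antitone C) (hconv : ∀ k, Convex ℝ (C k))
    (hne : ∀ k, (C k).Nonempty) {M : NNReal}
    (hC : ∀ k, ∀ v ∈ C k, AEStronglyMeasurable v μ ∧ eLpNorm v p μ ≤ M) :
    ∃ (v : ℕ → α → E) (u : α → E), (∀ k, v k ∈ C k) ∧ AEStronglyMeasurable u μ ∧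
      eLpNorm u p μ ≤ M ∧ (∀ᵐ s ∂μ, Tendsto (fun k => v k s) atTop (𝓝 (u s))) ∧
      Tendsto (fun k => ∫ s, ‖v k s - u s‖ ∂μ) atTop (𝓝 0) := by
  have hLp : ∀ k, ∀ v ∈ C k, MemLp v p μ := fun k v hv =>
    ⟨(hC k v hv).1, (hC k v hv).2.trans_lt ENNReal.coe_lt_top⟩
  have hint : ∀ k, ∀ v ∈ C k, Integrable v μ := fun k v hv => (hLp k v hv).integrable hp.le
  let Φ : (α → E) → ℝ := fun v => ∫ s, bracket (v s) ∂μ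
  have hΦ0 : ∀ v, 0 ≤ Φ v := fun v =>
    integral_nonneg fun s => zero_le_one.trans (one_le_bracket _)
  -- The infima of the strictly convex functional `Φ` over the sets `C k` increase and stay bounded;
  -- near-minimizers `v k ∈ C k` will be a Cauchy sequence in `L¹`.
  let a : ℕ → ℝ := fun k => sInf (Φ '' C k)
  have hbdd : ∀ k, BddBelow (Φ '' C k) := fun k => ⟨0, by rintro _ ⟨v, _, rfl⟩; exact hΦ0 v⟩
  have hamono : Monotone a := fun k l hkl =>
    csInf_le_csInf (hbdd k) ((hne l).image _) (image_mono (hanti hkl))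
  obtain ⟨K, hK0, hK⟩ := integral_bracket_add_rpow_le (E := E) (μ := μ) hp hp' M
  have hq : 1 < p.toReal := by
    rw [← ENNReal.toReal_one]; exact (ENNReal.toReal_lt_toReal ENNReal.one_ne_top hp'.ne).2 hp
  have haK : ∀ k, a k ≤ K := fun k => by
    obtain ⟨v, hv⟩ := hne k
    refine (csInf_le (hbdd k) ⟨v, hv, rfl⟩).trans (le_trans ?_ (hK v v (hC k v hv).1 (hC k v hv).1
      (hC k v hv).2 (hC k v hv).2))
    refine integral_mono (integrable_bracket (hint k v hv))
      (integrable_bracket_add_rpow hp hp' (hLp k v hv) (hLp k v hv)) fun s => ?_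
    have h1 := one_le_bracket (v s)
    calc bracket (v s) ≤ (bracket (v s) + bracket (v s)) ^ (1 : ℝ) := by rw [Real.rpow_one]; linarith
      _ ≤ _ := Real.rpow_le_rpow_of_exponent_le (by linarith) hq.le
  have hatend : ∃ A, Tendsto a atTop (𝓝 A) :=
    ⟨_, tendsto_atTop_ciSup hamono ⟨K, by rintro _ ⟨k, rfl⟩; exact haK k⟩⟩
  obtain ⟨A, hA⟩ := hatend
  have hale : ∀ k, a k ≤ A := fun k => hamono.ge_of_tendsto hA k
  have hchoose : ∀ k : ℕ, ∃ v ∈ C k, Φ v < a k + 1 / (k + 1) := fun k => by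
    obtain ⟨_, ⟨v, hv, rfl⟩, hlt⟩ := exists_lt_of_csInf_lt ((hne k).image Φ)
      (lt_add_of_pos_right (a k) (by positivity : (0 : ℝ) < 1 / (k + 1)))
    exact ⟨v, hv, hlt⟩
  choose v hvC hvΦ using hchoose
  have hgap : ∀ k l : ℕ, k ≤ l →
      ∫ s, ((bracket (v k s) + bracket (v l s)) / 2 -
        bracket ((1 / 2 : ℝ) • v k s + (1 / 2 : ℝ) • v l s)) ∂μ ≤ (A - a k) + 1 / (k + 1) := by
    intro k l hkl
    -- For `k ≤ l` the midpoint of `v k` and `v l` stays in `C k`, so its value is at least `a k`,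
    -- while both end values are at most `A + 1 / (k + 1)`.
    have hmid : (1 / 2 : ℝ) • v k + (1 / 2 : ℝ) • v l ∈ C k :=
      hconv k (hvC k) (hanti hkl (hvC l)) (by norm_num) (by norm_num) (by norm_num)
    have h1 : a k ≤ Φ ((1 / 2 : ℝ) • v k + (1 / 2 : ℝ) • v l) := csInf_le (hbdd k) ⟨_, hmid, rfl⟩
    have i1 := integrable_bracket (hint k _ (hvC k))
    have i2 := integrable_bracket (hint l _ (hvC l))
    have i3 := integrable_bracket (hint k _ hmid)
    have e : ∫ s, ((bracket (v k s) + bracket (v l s)) / 2 -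
        bracket ((1 / 2 : ℝ) • v k s + (1 / 2 : ℝ) • v l s)) ∂μ =
        (Φ (v k) + Φ (v l)) / 2 - Φ ((1 / 2 : ℝ) • v k + (1 / 2 : ℝ) • v l) := by
      rw [← integral_add i1 i2, ← integral_div]
      exact integral_sub ((i1.add i2).div_const 2) i3
    rw [e]
    have h2 := (hvΦ k).le
    have h3 := (hvΦ l).le
    have h4 : (1 : ℝ) / (l + 1) ≤ 1 / (k + 1) := by gcongr
    linarith [hale l, hale k]
  have hdist : ∀ ε > 0, ∃ N, ∀ k l, N ≤ k → k ≤ l → ∫ s, ‖v k s - v l s‖ ∂μ < ε := by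
    intro ε hε
    have hRlim : Tendsto (fun R : ℝ => R ^ (1 - p.toReal) * K) atTop (𝓝 0) := by
      have := (tendsto_rpow_neg_atTop (by linarith : 0 < p.toReal - 1)).mul_const K
      simpa using this
    -- `R`, then `δ`, then `N` are chosen so that each of the three terms of the pointwise estimate
    -- contributes at most `ε / 4`.
    obtain ⟨R, hR, hR0⟩ := ((hRlim.eventually (gt_mem_nhds (by positivity : 0 < ε / 4))).and
      (eventually_gt_atTop 0)).exists
    set m := μ.real univ
    have hm : 0 ≤ m := measureReal_nonneg
    set δ := ε / (4 * (m + 1))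
    have hδ : 0 < δ := by positivity
    have hδm : δ * m ≤ ε / 4 := by
      have : δ * (m + 1) = ε / 4 := by simp only [δ]; field_simp
      nlinarith
    have hgl : Tendsto (fun k : ℕ => R ^ 3 / δ * ((A - a k) + 1 / (k + 1))) atTop (𝓝 0) := by
      have h := ((hA.const_sub A).add tendsto_one_div_add_atTop_nhds_zero_nat).const_mul (R ^ 3 / δ)
      simpa using h
    obtain ⟨N, hN⟩ := eventually_atTop.1 (hgl.eventually (gt_mem_nhds (by positivity : 0 < ε / 4)))
    refine ⟨N, fun k l hk hkl => ?_⟩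
    have i1 := integrable_bracket (hint k _ (hvC k))
    have i2 := integrable_bracket (hint l _ (hvC l))
    have i3 := integrable_bracket ((((hint k _ (hvC k)).smul (1 / 2 : ℝ))).add
      ((hint l _ (hvC l)).smul (1 / 2 : ℝ)))
    have i4 := integrable_bracket_add_rpow hp hp' (hLp k _ (hvC k)) (hLp l _ (hvC l))
    have ig : Integrable (fun s => (bracket (v k s) + bracket (v l s)) / 2 -
        bracket ((1 / 2 : ℝ) • v k s + (1 / 2 : ℝ) • v l s)) μ := ((i1.add i2).div_const 2).sub i3
    have hle := integral_mono ((hint k _ (hvC k)).sub (hint l _ (hvC l))).norm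
      (((integrable_const δ).add (ig.const_mul (R ^ 3 / δ))).add (i4.const_mul (R ^ (1 - p.toReal))))
      (fun s => norm_sub_le_bracket_gap (v k s) (v l s) hq hR0 hδ)
    have ic : Integrable (fun s => δ + R ^ 3 / δ * ((bracket (v k s) + bracket (v l s)) / 2 -
        bracket ((1 / 2 : ℝ) • v k s + (1 / 2 : ℝ) • v l s))) μ :=
      (integrable_const δ).add (ig.const_mul (R ^ 3 / δ))
    have e : ∫ s, (δ + R ^ 3 / δ * ((bracket (v k s) + bracket (v l s)) / 2 -
        bracket ((1 / 2 : ℝ) • v k s + (1 / 2 : ℝ) • v l s)) + R ^ (1 - p.toReal) *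
        (bracket (v k s) + bracket (v l s)) ^ p.toReal) ∂μ = m * δ + R ^ 3 / δ *
        (∫ s, ((bracket (v k s) + bracket (v l s)) / 2 -
        bracket ((1 / 2 : ℝ) • v k s + (1 / 2 : ℝ) • v l s)) ∂μ) + R ^ (1 - p.toReal) *
        ∫ s, (bracket (v k s) + bracket (v l s)) ^ p.toReal ∂μ := by
      rw [integral_add ic (i4.const_mul (R ^ (1 - p.toReal))), integral_add (integrable_const δ)
        (ig.const_mul (R ^ 3 / δ)), integral_const_mul, integral_const_mul, integral_const]
      rfl
    replace hle := hle.trans_eq e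
    have h1 := hK (v k) (v l) (hC k _ (hvC k)).1 (hC l _ (hvC l)).1 (hC k _ (hvC k)).2
      (hC l _ (hvC l)).2
    have h2 : R ^ (1 - p.toReal) * ∫ s, (bracket (v k s) + bracket (v l s)) ^ p.toReal ∂μ ≤
      R ^ (1 - p.toReal) * K := by gcongr
    have h3 := mul_le_mul_of_nonneg_left (hgap k l hkl) (by positivity : 0 ≤ R ^ 3 / δ)
    have h4 := hN k hk
    have h5 : ∫ s, ‖v k s - v l s‖ ∂μ ≤ _ := hle
    linarith
  let f : ℕ → (α →₁[μ] E) := fun k => (hint k _ (hvC k)).toL1 (v k)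
  have hfd : ∀ k l, dist (f k) (f l) = ∫ s, ‖v k s - v l s‖ ∂μ := fun k l => by
    rw [dist_eq_norm, ← Integrable.toL1_sub, L1.norm_of_fun_eq_integral_norm]; rfl
  have hcau : CauchySeq f := by
    rw [Metric.cauchySeq_iff']
    intro ε hε
    obtain ⟨N, hN⟩ := hdist ε hε
    refine ⟨N, fun n hn => ?_⟩
    rw [dist_comm, hfd]
    exact hN N n le_rfl hn
  obtain ⟨F, hF⟩ := cauchySeq_tendsto_of_complete hcau
  have hFint : Integrable F μ := L1.integrable_coeFn F
  have hFd : ∀ k, dist (f k) F = ∫ s, ‖v k s - F s‖ ∂μ := fun k => by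
    have : F = hFint.toL1 F := (Integrable.toL1_coeFn F hFint).symm
    rw [this, dist_eq_norm, ← Integrable.toL1_sub, L1.norm_of_fun_eq_integral_norm]
    refine integral_congr_ae ?_
    filter_upwards [hFint.coeFn_toL1] with s hs
    simp
  have htd : Tendsto (fun k => ∫ s, ‖v k s - F s‖ ∂μ) atTop (𝓝 0) := by
    simp_rw [← hFd]; exact tendsto_iff_dist_tendsto_zero.1 hF
  have hmeas : TendstoInMeasure μ (fun k => v k) atTop F := by
    refine tendstoInMeasure_of_tendsto_eLpNorm one_ne_zero (fun k => (hC k _ (hvC k)).1)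
      hFint.aestronglyMeasurable ?_
    have h := ENNReal.tendsto_ofReal htd
    rw [ENNReal.ofReal_zero] at h
    refine h.congr fun k => ?_
    rw [eLpNorm_one_eq_lintegral_enorm]
    exact ofReal_integral_norm_eq_lintegral_enorm ((hint k _ (hvC k)).sub hFint)
  obtain ⟨ns, hns, hae⟩ := hmeas.exists_seq_tendsto_ae
  -- Almost everywhere convergence costs a subsequence; `v (ns k)` still lies in `C k` because `k ≤
  -- ns k` and `C` is decreasing.
  refine ⟨fun k => v (ns k), F, fun k => hanti (hns.id_le k) (hvC (ns k)),
    hFint.aestronglyMeasurable, ?_, hae, htd.comp hns.tendsto_atTop⟩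
  refine (Lp.eLpNorm_lim_le_liminf_eLpNorm (fun k => (hC _ _ (hvC (ns k))).1) F hae).trans ?_
  exact liminf_le_of_le (by isBoundedDefault) fun b hb => by
    obtain ⟨k, hk⟩ := hb.exists
    exact hk.trans (hC _ _ (hvC (ns k))).2

end ConvexLimit

/-! ### Weak convergence in `L^p`, without duality. -/

section WeakConvergence

variable {F : Type*} [NormedAddCommGroup F] [NormedSpace ℝ F]

/-- The measure of the parameter interval. -/
abbrev arcMeasure (L : ℝ) : Measure ℝ := volume.restrict (Icc 0 L)

/-- Weak convergence in `L^p`, expressed by boundedness and convergence of the primitives. -/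
structure WeakTendsto (L : ℝ) (p : ℝ≥0∞) (w : ℕ → ℝ → E3) (u : ℝ → E3) : Prop where
  bounded : ∃ M : NNReal, ∀ k, AEStronglyMeasurable (w k) (arcMeasure L) ∧
    eLpNorm (w k) p (arcMeasure L) ≤ M
  integrable : Integrable u (arcMeasure L)
  tendsto : ∀ s ∈ Icc 0 L, Tendsto (fun k => ∫ r in (0 : ℝ)..s, w k r) atTop
    (𝓝 (∫ r in (0 : ℝ)..s, u r))

/-- Hölder's inequality against the constant 1; `K` depends only on `L`, `p` and `M`. -/
lemma integral_norm_le_of_eLpNorm_le {L : ℝ} {p : ℝ≥0∞} (hp : 1 ≤ p) (M : NNReal) :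
    ∃ K : ℝ, 0 ≤ K ∧ ∀ w : ℝ → E3, AEStronglyMeasurable w (arcMeasure L) →
      eLpNorm w p (arcMeasure L) ≤ M → ∫ s, ‖w s‖ ∂(arcMeasure L) ≤ K := by
  set c : ℝ≥0∞ := M * (arcMeasure L univ) ^ (1 / (1 : ℝ≥0∞).toReal - 1 / p.toReal)
  have hc : c ≠ ⊤ := by
    refine ENNReal.mul_ne_top ENNReal.coe_ne_top (ENNReal.rpow_ne_top_of_nonneg ?_ (by simp))
    rw [ENNReal.toReal_one, div_one, sub_nonneg]
    by_cases hpt : p = ⊤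
    · simp [hpt]
    · have : 1 ≤ p.toReal := by
        rw [← ENNReal.toReal_one]; exact (ENNReal.toReal_le_toReal ENNReal.one_ne_top hpt).2 hp
      exact (div_le_one (by linarith)).2 this
  refine ⟨c.toReal, ENNReal.toReal_nonneg, fun w hw hM => ?_⟩
  rw [integral_norm_eq_lintegral_enorm hw]
  refine ENNReal.toReal_mono hc ?_
  rw [← eLpNorm_one_eq_lintegral_enorm]
  exact (eLpNorm_le_eLpNorm_mul_rpow_measure_univ hp hw).trans (mul_le_mul_left hM _)

lemma integrable_clm_apply {μ : Measure ℝ} {h : ℝ → E3 →L[ℝ] F} {v : ℝ → E3} {H : ℝ}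
    (hm : AEStronglyMeasurable h μ) (hb : ∀ᵐ s ∂μ, ‖h s‖ ≤ H) (hv : Integrable v μ) :
    Integrable (fun s => h s (v s)) μ := by
  refine (hv.norm.const_mul H).mono'
    ((ContinuousLinearMap.apply ℝ F).flip.aestronglyMeasurable_comp₂ hm hv.aestronglyMeasurable) ?_
  filter_upwards [hb] with s hs
  exact (ContinuousLinearMap.le_opNorm _ _).trans (by gcongr)

/-- The limit of convex combinations of the tails has the same moments as the sequence. -/
lemma integral_clm_eq_of_convexHull [CompleteSpace F] {μ : Measure ℝ} {w v : ℕ → ℝ → E3} {u : ℝ → E3}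
    (hw : ∀ k, Integrable (w k) μ) (hu : Integrable u μ)
    (hv : ∀ k, v k ∈ convexHull ℝ (w '' Ici k))
    (hlim : Tendsto (fun k => ∫ s, ‖v k s - u s‖ ∂μ) atTop (𝓝 0))
    {h : ℝ → E3 →L[ℝ] F} {H : ℝ} (hm : AEStronglyMeasurable h μ) (hb : ∀ᵐ s ∂μ, ‖h s‖ ≤ H) {c : F}
    (hc : Tendsto (fun k => ∫ s, h s (w k s) ∂μ) atTop (𝓝 c)) : ∫ s, h s (u s) ∂μ = c := by
  have hconvI : Convex ℝ {f : ℝ → E3 | Integrable f μ} := fun f hf g hg a b _ _ _ =>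
    (hf.smul a).add (hg.smul b)
  have hvi : ∀ k, Integrable (v k) μ := fun k =>
    convexHull_min (by rintro _ ⟨j, _, rfl⟩; exact hw j) hconvI (hv k)
  have h1 : Tendsto (fun k => ∫ s, h s (v k s) ∂μ) atTop (𝓝 c) := by
    rw [Metric.tendsto_atTop] at hc ⊢
    intro ε hε
    obtain ⟨N, hN⟩ := hc ε hε
    refine ⟨N, fun k hk => ?_⟩
    -- Having its moment in a given ball is a convex condition on `f`, so it passes from the tail of
    -- `w` to convex combinations of that tail.
    have hconv : Convex ℝ {f : ℝ → E3 | Integrable f μ ∧ ∫ s, h s (f s) ∂μ ∈ Metric.ball c ε} := by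
      rintro f ⟨hf, hf'⟩ g ⟨hg, hg'⟩ a b ha hb' hab
      refine ⟨hconvI hf hg ha hb' hab, ?_⟩
      have e : ∫ s, h s ((a • f + b • g) s) ∂μ = a • ∫ s, h s (f s) ∂μ + b • ∫ s, h s (g s) ∂μ := by
        have := integral_add ((integrable_clm_apply hm hb hf).smul a)
          ((integrable_clm_apply hm hb hg).smul b)
        simp only [Pi.smul_apply, integral_smul] at this
        rw [← this]
        simp
      rw [e]
      exact convex_ball c ε hf' hg' ha hb' hab
    exact (convexHull_min (by
      rintro _ ⟨j, hj, rfl⟩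
      exact ⟨hw j, hN j (hk.trans hj)⟩) hconv (hv k)).2
  have h2 : Tendsto (fun k => ∫ s, h s (v k s) ∂μ) atTop (𝓝 (∫ s, h s (u s) ∂μ)) := by
    rw [tendsto_iff_norm_sub_tendsto_zero]
    refine squeeze_zero (fun _ => norm_nonneg _) (fun k => ?_) (by simpa using hlim.const_mul H)
    rw [← integral_sub (integrable_clm_apply hm hb (hvi k)) (integrable_clm_apply hm hb hu),
      ← integral_const_mul]
    refine norm_integral_le_of_norm_le (((hvi k).sub hu).norm.const_mul H) ?_
    filter_upwards [hb] with s hs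
    rw [← map_sub]
    exact (ContinuousLinearMap.le_opNorm _ _).trans (by gcongr)
  exact tendsto_nhds_unique h2 h1

lemma intervalIntegral_eq_setIntegral {L s : ℝ} (hs : s ∈ Icc 0 L) (f : ℝ → F) :
    ∫ r in (0 : ℝ)..s, f r = ∫ r, (Icc 0 s).indicator f r ∂(arcMeasure L) := by
  rw [intervalIntegral.integral_of_le hs.1, integral_indicator measurableSet_Icc,
    Measure.restrict_restrict measurableSet_Icc, inter_eq_self_of_subset_left
      (Icc_subset_Icc_right hs.2), integral_Icc_eq_integral_Ioc]

/-- Both integrands are almost everywhere the derivative of the common primitive. -/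
lemma ae_eq_of_primitives_eq {L : ℝ} {u v : ℝ → E3} (hL : 0 ≤ L)
    (hu : Integrable u (arcMeasure L)) (hv : Integrable v (arcMeasure L))
    (h : ∀ s ∈ Icc 0 L, ∫ r in (0 : ℝ)..s, u r = ∫ r in (0 : ℝ)..s, v r) : u =ᵐ[arcMeasure L] v := by
  have h1 := (isPrimitive_integral (L := L) hu).ae_hasDerivAt hL
  have h2 := (isPrimitive_integral (L := L) hv).ae_hasDerivAt hL
  have e0 : ∀ᵐ s : ℝ, s ≠ 0 := by simp [ae_iff, measure_singleton]
  have e1 : ∀ᵐ s : ℝ, s ≠ L := by simp [ae_iff, measure_singleton]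
  rw [EventuallyEq, ae_restrict_iff' measurableSet_Icc]
  filter_upwards [h1, h2, e0, e1] with s h1 h2 s0 s1 hs
  refine (h1 hs).unique ((h2 hs).congr_of_eventuallyEq ?_)
  filter_upwards [Icc_mem_nhds (lt_of_le_of_ne hs.1 (Ne.symm s0)) (lt_of_le_of_ne hs.2 s1)]
    with r hr using h r hr

/-- The convex hulls of the tails decrease and stay in the ball of radius `M`. This plays the part
of weak compactness and Mazur's lemma together. -/
lemma exists_convexHull_tendsto {L : ℝ} {p : ℝ≥0∞} (hp : 1 < p) (hp' : p < ⊤) {w : ℕ → ℝ → E3}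
    {M : NNReal} (hw : ∀ k, AEStronglyMeasurable (w k) (arcMeasure L) ∧
      eLpNorm (w k) p (arcMeasure L) ≤ M) :
    ∃ (v : ℕ → ℝ → E3) (u : ℝ → E3), (∀ k, v k ∈ convexHull ℝ (w '' Ici k)) ∧
      AEStronglyMeasurable u (arcMeasure L) ∧ eLpNorm u p (arcMeasure L) ≤ M ∧
      (∀ᵐ s ∂(arcMeasure L), Tendsto (fun k => v k s) atTop (𝓝 (u s))) ∧
      Tendsto (fun k => ∫ s, ‖v k s - u s‖ ∂(arcMeasure L)) atTop (𝓝 0) := by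
  refine exists_tendsto_of_convex hp hp' (C := fun k => convexHull ℝ (w '' Ici k))
    (fun k l hkl => convexHull_mono (image_mono (Ici_subset_Ici.2 hkl)))
    (fun k => convex_convexHull ℝ _)
    (fun k => ⟨w k, subset_convexHull ℝ _ ⟨k, self_mem_Ici, rfl⟩⟩) fun k v hv => ?_
  have hconv : Convex ℝ {f : ℝ → E3 | AEStronglyMeasurable f (arcMeasure L) ∧
      eLpNorm f p (arcMeasure L) ≤ M} := by
    rintro f ⟨hf, hf'⟩ g ⟨hg, hg'⟩ a b ha hb hab
    refine ⟨(hf.const_smul a).add (hg.const_smul b), ?_⟩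
    refine (eLpNorm_add_le (hf.const_smul a) (hg.const_smul b) hp.le).trans ?_
    rw [eLpNorm_const_smul, eLpNorm_const_smul, Real.enorm_eq_ofReal ha, Real.enorm_eq_ofReal hb]
    calc _ ≤ ENNReal.ofReal a * M + ENNReal.ofReal b * M := by gcongr
      _ = M := by rw [← add_mul, ← ENNReal.ofReal_add ha hb, hab]; simp
  exact convexHull_min (by rintro _ ⟨j, _, rfl⟩; exact hw j) hconv hv

lemma integrable_of_eLpNorm_le {L : ℝ} {p : ℝ≥0∞} (hp : 1 < p) {v : ℝ → E3} {M : NNReal}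
    (hv : AEStronglyMeasurable v (arcMeasure L) ∧ eLpNorm v p (arcMeasure L) ≤ M) :
    Integrable v (arcMeasure L) :=
  MemLp.integrable hp.le ⟨hv.1, hv.2.trans_lt ENNReal.coe_lt_top⟩

/-- Limits of convex combinations of a weakly convergent sequence agree with the weak limit. -/
lemma WeakTendsto.ae_eq {L : ℝ} (hL : 0 ≤ L) {p : ℝ≥0∞} (hp : 1 < p) {w v : ℕ → ℝ → E3} {u u' : ℝ → E3}
    (h : WeakTendsto L p w u) (hu' : Integrable u' (arcMeasure L))
    (hv : ∀ k, v k ∈ convexHull ℝ (w '' Ici k))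
    (hlim : Tendsto (fun k => ∫ s, ‖v k s - u' s‖ ∂(arcMeasure L)) atTop (𝓝 0)) :
    u' =ᵐ[arcMeasure L] u := by
  obtain ⟨M, hM⟩ := h.bounded
  refine ae_eq_of_primitives_eq hL hu' h.integrable fun s hs => ?_
  let g : ℝ → E3 →L[ℝ] E3 := (Icc 0 s).indicator fun _ => ContinuousLinearMap.id ℝ E3
  have hg : ∀ f : ℝ → E3, (fun r => g r (f r)) = (Icc 0 s).indicator f := fun f => by
    ext1 r
    by_cases hr : r ∈ Icc 0 s <;> simp [g, hr]
  have key := integral_clm_eq_of_convexHull (μ := arcMeasure L) (h := g) (H := 1)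
    (c := ∫ r in (0 : ℝ)..s, u r)
    (fun k => integrable_of_eLpNorm_le hp (hM k)) hu' hv hlim
    (aestronglyMeasurable_const.indicator measurableSet_Icc)
    (Eventually.of_forall fun r => (norm_indicator_le_norm_self _ r).trans
      ContinuousLinearMap.norm_id_le)
    (by simp_rw [hg, ← intervalIntegral_eq_setIntegral hs]; exact h.tendsto s hs)
  rw [hg, ← intervalIntegral_eq_setIntegral hs] at key
  exact key

lemma WeakTendsto.comp {L : ℝ} {p : ℝ≥0∞} {w : ℕ → ℝ → E3} {u : ℝ → E3}
    (h : WeakTendsto L p w u) {φ : ℕ → ℕ} (hφ : Tendsto φ atTop atTop) :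
    WeakTendsto L p (fun k => w (φ k)) u where
  bounded := let ⟨M, hM⟩ := h.bounded; ⟨M, fun k => hM (φ k)⟩
  integrable := h.integrable
  tendsto s hs := (h.tendsto s hs).comp hφ

/-- Weakly convergent sequences can be tested with bounded functions. -/
lemma WeakTendsto.tendsto_integral_clm [FiniteDimensional ℝ F] {L : ℝ} (hL : 0 ≤ L) {p : ℝ≥0∞}
    (hp : 1 < p) (hp' : p < ⊤) {w : ℕ → ℝ → E3} {u : ℝ → E3} (hw : WeakTendsto L p w u)
    {h : ℝ → E3 →L[ℝ] F} {H : ℝ} (hm : AEStronglyMeasurable h (arcMeasure L))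
    (hb : ∀ᵐ s ∂(arcMeasure L), ‖h s‖ ≤ H) :
    Tendsto (fun k => ∫ s, h s (w k s) ∂(arcMeasure L)) atTop
      (𝓝 (∫ s, h s (u s) ∂(arcMeasure L))) := by
  have : CompleteSpace F := FiniteDimensional.complete ℝ F
  have : ProperSpace F := FiniteDimensional.proper ℝ F
  -- Along any subsequence the moments are bounded, so a further subsequence has moments converging
  -- to some `c`. Convex combinations of that subsequence converge in `L¹` to `u`, which forces `c`
  -- to be the moment of `u`. No density of step functions is needed.
  refine tendsto_of_subseq_tendsto fun ns hns => ?_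
  obtain ⟨M, hM⟩ := hw.bounded
  obtain ⟨K, hK0, hK⟩ := integral_norm_le_of_eLpNorm_le (L := L) hp.le M
  have hwi := fun k => integrable_of_eLpNorm_le hp (hM k)
  have hbd : ∀ k, ∫ s, h s (w (ns k) s) ∂(arcMeasure L) ∈ Metric.closedBall (0 : F) (|H| * K) := by
    intro k
    rw [mem_closedBall_zero_iff]
    calc _ ≤ ∫ s, |H| * ‖w (ns k) s‖ ∂(arcMeasure L) := by
          refine norm_integral_le_of_norm_le ((hwi _).norm.const_mul |H|) ?_
          filter_upwards [hb] with s hs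
          exact (ContinuousLinearMap.le_opNorm _ _).trans (by gcongr; exact hs.trans (le_abs_self H))
      _ ≤ |H| * K := by
          rw [integral_const_mul]; gcongr; exact hK _ (hM _).1 (hM _).2
  obtain ⟨c, -, φ, hφ, hc⟩ := tendsto_subseq_of_bounded Metric.isBounded_closedBall hbd
  refine ⟨φ, ?_⟩
  have hw' := hw.comp (hns.comp hφ.tendsto_atTop)
  obtain ⟨v, u', hv, hu'm, hu'M, -, hlim⟩ := exists_convexHull_tendsto hp hp'
    (w := fun k => w (ns (φ k))) (fun k => hM _)
  have hu'i := integrable_of_eLpNorm_le hp ⟨hu'm, hu'M⟩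
  have hae := hw'.ae_eq hL hp hu'i hv hlim
  have key := integral_clm_eq_of_convexHull (fun k => hwi _) hu'i hv hlim hm hb hc
  have e : ∫ s, h s (u s) ∂(arcMeasure L) = c := by
    rw [← key]
    refine integral_congr_ae ?_
    filter_upwards [hae] with s hs
    rw [hs]
  rw [e]
  exact hc

/-- Weakly convergent sequences can be tested with uniformly convergent functions. -/
lemma WeakTendsto.tendsto_integral_clm_of_uniform [FiniteDimensional ℝ F] {L : ℝ} (hL : 0 ≤ L)
    {p : ℝ≥0∞} (hp : 1 < p) (hp' : p < ⊤) {w : ℕ → ℝ → E3} {u : ℝ → E3} (hw : WeakTendsto L p w u)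
    {h : ℕ → ℝ → E3 →L[ℝ] F} {g : ℝ → E3 →L[ℝ] F} {H : ℝ}
    (hm : ∀ k, AEStronglyMeasurable (h k) (arcMeasure L)) (hgm : AEStronglyMeasurable g (arcMeasure L))
    (hb : ∀ s ∈ Icc 0 L, ‖g s‖ ≤ H) (hlim : TendstoUniformlyOn h g atTop (Icc 0 L)) :
    Tendsto (fun k => ∫ s, h k s (w k s) ∂(arcMeasure L)) atTop
      (𝓝 (∫ s, g s (u s) ∂(arcMeasure L))) := by
  have hb' : ∀ᵐ s ∂(arcMeasure L), ‖g s‖ ≤ H := by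
    filter_upwards [ae_restrict_mem measurableSet_Icc] with s hs using hb s hs
  have h1 := hw.tendsto_integral_clm hL hp hp' hgm hb'
  obtain ⟨M, hM⟩ := hw.bounded
  obtain ⟨K, hK0, hK⟩ := integral_norm_le_of_eLpNorm_le (L := L) hp.le M
  have hwi := fun k => integrable_of_eLpNorm_le hp (hM k)
  refine tendsto_of_tendsto_of_dist h1 ?_
  rw [Metric.tendsto_atTop]
  intro ε hε
  have hδ : 0 < ε / (K + 1) := by positivity
  obtain ⟨N, hN⟩ := eventually_atTop.1 (Metric.tendstoUniformlyOn_iff.1 hlim _ hδ)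
  refine ⟨N, fun k hk => ?_⟩
  have hNk : ∀ᵐ s ∂(arcMeasure L), ‖g s - h k s‖ ≤ ε / (K + 1) := by
    filter_upwards [ae_restrict_mem measurableSet_Icc] with s hs
    rw [← dist_eq_norm]; exact (hN k hk s hs).le
  have hbk : ∀ᵐ s ∂(arcMeasure L), ‖h k s‖ ≤ H + ε / (K + 1) := by
    filter_upwards [hNk, hb'] with s h1 h2
    have := norm_sub_norm_le (h k s) (g s)
    rw [norm_sub_rev] at this
    linarith
  rw [Real.dist_0_eq_abs, abs_of_nonneg dist_nonneg, dist_eq_norm,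
    ← integral_sub (integrable_clm_apply hgm hb' (hwi k)) (integrable_clm_apply (hm k) hbk (hwi k))]
  calc _ ≤ ∫ s, ε / (K + 1) * ‖w k s‖ ∂(arcMeasure L) := by
        refine norm_integral_le_of_norm_le ((hwi _).norm.const_mul _) ?_
        filter_upwards [hNk] with s hs
        rw [← sub_apply]
        exact (ContinuousLinearMap.le_opNorm _ _).trans (by gcongr)
    _ ≤ ε / (K + 1) * K := by
        rw [integral_const_mul]; gcongr; exact hK _ (hM _).1 (hM _).2
    _ < ε / (K + 1) * (K + 1) := by gcongr; linarith
    _ = ε := by field_simp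

end WeakConvergence

/-! ### Uniform convergence and equicontinuity. -/

section ArzelaAscoli

/-- Composition with a continuous function preserves uniform convergence of bounded functions. -/
lemma tendstoUniformlyOn_comp_of_bounded {X E G : Type*} [NormedAddCommGroup E] [ProperSpace E]
    [PseudoMetricSpace G] {F : ℕ → X → E} {f : X → E} {K : Set X} {C : ℝ} {φ : E → G}
    (hF : ∀ n, ∀ a ∈ K, ‖F n a‖ ≤ C) (hf : ∀ a ∈ K, ‖f a‖ ≤ C)
    (h : TendstoUniformlyOn F f atTop K) (hφ : ContinuousOn φ (Metric.closedBall 0 C)) :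
    TendstoUniformlyOn (fun n a => φ (F n a)) (fun a => φ (f a)) atTop K := by
  have huc := (isCompact_closedBall (0 : E) C).uniformContinuousOn_of_continuous hφ
  rw [Metric.uniformContinuousOn_iff] at huc
  rw [Metric.tendstoUniformlyOn_iff] at h ⊢
  intro ε hε
  obtain ⟨δ, hδ, hh⟩ := huc ε hε
  filter_upwards [h δ hδ] with n hn a ha
  exact hh _ (by simpa using hf a ha) _ (by simpa using hF n a ha) (hn a ha)

/-- The theorem of Arzelà and Ascoli for functions on `[0, L]` with a common modulus of continuity. -/
lemma exists_subseq_tendstoUniformlyOn {E : Type*} [NormedAddCommGroup E] [ProperSpace E]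
    {L C : ℝ} (hL : 0 ≤ L) {f : ℕ → ℝ → E} {b : ℝ → ℝ} (hb : Tendsto b (𝓝 0) (𝓝 0))
    (hC : ∀ k, ∀ s ∈ Icc 0 L, ‖f k s‖ ≤ C)
    (hf : ∀ k, ∀ r ∈ Icc 0 L, ∀ s ∈ Icc 0 L, dist (f k r) (f k s) ≤ b (dist r s)) :
    ∃ (φ : ℕ → ℕ) (g : ℝ → E), StrictMono φ ∧ ContinuousOn g (Icc 0 L) ∧
      TendstoUniformlyOn (fun k => f (φ k)) g atTop (Icc 0 L) := by
  have heq : Equicontinuous fun (k : ℕ) (s : Icc (0 : ℝ) L) => f k s :=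
    Metric.equicontinuous_of_continuity_modulus b hb _ fun r s k => hf k r r.2 s s.2
  let G : ℕ → BoundedContinuousFunction (Icc (0 : ℝ) L) E := fun k =>
    BoundedContinuousFunction.mkOfCompact ⟨fun s => f k s, heq.continuous k⟩
  have hcomp : IsCompact (closure (range G)) := by
    refine BoundedContinuousFunction.arzela_ascoli (Metric.closedBall 0 C) (isCompact_closedBall _ _)
      (range G) ?_ ?_
    · rintro _ s ⟨k, rfl⟩
      simpa using! hC k s s.2
    · refine Metric.equicontinuous_of_continuity_modulus b hb _ ?_
      rintro r s ⟨_, k, rfl⟩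
      exact hf k r r.2 s s.2
  obtain ⟨g, -, φ, hφ, hlim⟩ := hcomp.tendsto_subseq fun k => subset_closure (mem_range_self k)
  refine ⟨φ, IccExtend hL g, hφ, g.continuous.Icc_extend'.continuousOn, ?_⟩
  have := BoundedContinuousFunction.tendsto_iff_tendstoUniformly.1 hlim
  rw [Metric.tendstoUniformly_iff] at this
  rw [Metric.tendstoUniformlyOn_iff]
  intro ε hε
  filter_upwards [this ε hε] with k hk s hs
  rw [IccExtend_of_mem hL _ hs]
  exact hk ⟨s, hs⟩

end ArzelaAscoli

/-! ### Compactness of frames with bounded strains. -/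

section Compactness

variable {L : ℝ} {p : ℝ≥0∞}

/-- Hölder's inequality on a subinterval. -/
lemma integral_norm_le_rpow (hp : 1 < p) (hp' : p < ⊤) {w : ℝ → E3} {M : NNReal}
    (hw : AEStronglyMeasurable w (arcMeasure L) ∧ eLpNorm w p (arcMeasure L) ≤ M) {r s : ℝ}
    (hr : r ∈ Icc 0 L) (hs : s ∈ Icc 0 L) (hrs : r ≤ s) :
    ∫ u in r..s, ‖w u‖ ≤ M * (s - r) ^ (1 - 1 / p.toReal) := by
  have hsub : Ioc r s ⊆ Icc 0 L := fun u hu => ⟨hr.1.trans hu.1.le, hu.2.trans hs.2⟩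
  have hle : volume.restrict (Ioc r s) ≤ arcMeasure L := Measure.restrict_mono hsub le_rfl
  have hm : AEStronglyMeasurable w (volume.restrict (Ioc r s)) := hw.1.mono_measure hle
  have hq : 1 < p.toReal := by
    rw [← ENNReal.toReal_one]; exact (ENNReal.toReal_lt_toReal ENNReal.one_ne_top hp'.ne).2 hp
  have hq' : 0 ≤ 1 - 1 / p.toReal := by
    rw [sub_nonneg]; exact (div_le_one (by linarith)).2 hq.le
  rw [intervalIntegral.integral_of_le hrs, integral_norm_eq_lintegral_enorm hm]
  have h1 := eLpNorm_le_eLpNorm_mul_rpow_measure_univ hp.le hm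
  rw [eLpNorm_one_eq_lintegral_enorm, Measure.restrict_apply_univ, Real.volume_Ioc,
    ENNReal.toReal_one, div_one, ENNReal.ofReal_rpow_of_nonneg (by linarith) hq'] at h1
  have h2 : eLpNorm w p (volume.restrict (Ioc r s)) ≤ M := (eLpNorm_mono_measure _ hle).trans hw.2
  have h3 := h1.trans (mul_le_mul_left h2 _)
  refine (ENNReal.toReal_mono (ENNReal.mul_ne_top ENNReal.coe_ne_top ENNReal.ofReal_ne_top) h3).trans ?_
  rw [ENNReal.toReal_mul, ENNReal.toReal_ofReal (Real.rpow_nonneg (by linarith) _)]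
  rfl

/-- A Hölder modulus depending only on `M` and `p`, hence equicontinuity of all frames of a bounded
sequence. The factor 2 comes from the two terms in each frame equation. -/
lemma dist_primitive_le (hp : 1 < p) (hp' : p < ⊤) {w : ℝ → E3} {M : NNReal}
    (hw : AEStronglyMeasurable w (arcMeasure L) ∧ eLpNorm w p (arcMeasure L) ≤ M)
    {f f' : ℝ → E3} (hf : IsPrimitive L f f') (hle : ∀ u ∈ Icc 0 L, ‖f' u‖ ≤ 2 * ‖w u‖) {r s : ℝ}
    (hr : r ∈ Icc 0 L) (hs : s ∈ Icc 0 L) :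
    dist (f r) (f s) ≤ 2 * (M * (dist r s) ^ (1 - 1 / p.toReal)) := by
  wlog hrs : r ≤ s generalizing r s
  · rw [dist_comm, dist_comm r]; exact this hs hr (le_of_not_ge hrs)
  have hwi := integrable_of_eLpNorm_le hp hw
  have h2 := integral_norm_le_rpow hp hp' hw hr hs hrs
  have hint : IntervalIntegrable (fun u => ‖w u‖) volume r s :=
    IsPrimitive.intervalIntegrable_of (L := L) hwi.norm hr hs
  rw [dist_comm, dist_eq_norm, hf.sub_eq hr hs, Real.dist_eq, abs_sub_comm, abs_of_nonneg (by linarith)]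
  calc _ ≤ ∫ u in r..s, 2 * ‖w u‖ := intervalIntegral.norm_integral_le_of_norm_le hrs
        (Eventually.of_forall fun u hu => hle u ⟨hr.1.trans hu.1.le, hu.2.trans hs.2⟩)
        (hint.const_mul 2)
    _ = 2 * ∫ u in r..s, ‖w u‖ := by rw [intervalIntegral.integral_const_mul]
    _ ≤ _ := by gcongr

/-- A bounded sequence in `L^p` whose primitives converge has a weak limit. -/
lemma exists_weakTendsto (hp : 1 < p) (hp' : p < ⊤) {w : ℕ → ℝ → E3} {M : NNReal}
    (hw : ∀ k, AEStronglyMeasurable (w k) (arcMeasure L) ∧ eLpNorm (w k) p (arcMeasure L) ≤ M)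
    {G : ℝ → E3} (hG : ∀ s ∈ Icc 0 L, Tendsto (fun k => ∫ r in (0 : ℝ)..s, w k r) atTop (𝓝 (G s))) :
    ∃ u, AEStronglyMeasurable u (arcMeasure L) ∧ eLpNorm u p (arcMeasure L) ≤ M ∧
      WeakTendsto L p w u := by
  obtain ⟨v, u, hv, hum, huM, -, hlim⟩ := exists_convexHull_tendsto hp hp' hw
  have hui := integrable_of_eLpNorm_le hp ⟨hum, huM⟩
  refine ⟨u, hum, huM, ⟨M, hw⟩, hui, fun s hs => ?_⟩
  let g : ℝ → E3 →L[ℝ] E3 := (Icc 0 s).indicator fun _ => ContinuousLinearMap.id ℝ E3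
  have hg : ∀ f : ℝ → E3, (fun r => g r (f r)) = (Icc 0 s).indicator f := fun f => by
    ext1 r
    by_cases hr : r ∈ Icc 0 s <;> simp [g, hr]
  have key := integral_clm_eq_of_convexHull (μ := arcMeasure L) (h := g) (H := 1) (c := G s)
    (fun k => integrable_of_eLpNorm_le hp (hw k)) hui hv hlim
    (aestronglyMeasurable_const.indicator measurableSet_Icc)
    (Eventually.of_forall fun r => (norm_indicator_le_norm_self _ r).trans
      ContinuousLinearMap.norm_id_le)
    (by simp_rw [hg, ← intervalIntegral_eq_setIntegral hs]; exact hG s hs)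
  rw [hg, ← intervalIntegral_eq_setIntegral hs] at key
  rw [key]
  exact hG s hs

/-- The linear map `W ↦ κ₂ d - κ₁ n`. -/
def strainT (d n : E3) : E3 →L[ℝ] E3 :=
  (EuclideanSpace.proj (1 : Fin 3) : E3 →L[ℝ] ℝ).smulRight d -
    (EuclideanSpace.proj (0 : Fin 3) : E3 →L[ℝ] ℝ).smulRight n

/-- The linear map `W ↦ ω n - κ₂ t`. -/
def strainD (t n : E3) : E3 →L[ℝ] E3 :=
  (EuclideanSpace.proj (2 : Fin 3) : E3 →L[ℝ] ℝ).smulRight n -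
    (EuclideanSpace.proj (1 : Fin 3) : E3 →L[ℝ] ℝ).smulRight t

@[simp] lemma strainT_apply (d n W : E3) : strainT d n W = W 1 • d - W 0 • n := by
  simp [strainT]

@[simp] lemma strainD_apply (t n W : E3) : strainD t n W = W 2 • n - W 1 • t := by
  simp [strainD]

lemma continuous_smulRight (c : E3 →L[ℝ] ℝ) : Continuous fun v : E3 => c.smulRight v :=
  (ContinuousLinearMap.smulRightL ℝ E3 E3 c).continuous

lemma continuous_strainT : Continuous fun q : E3 × E3 => strainT q.1 (cross q.2 q.1) := by
  unfold strainT
  exact ((continuous_smulRight _).comp continuous_fst).sub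
    ((continuous_smulRight _).comp (continuous_snd.cross continuous_fst))

lemma continuous_strainD : Continuous fun q : E3 × E3 => strainD q.2 (cross q.2 q.1) := by
  unfold strainD
  exact ((continuous_smulRight _).comp (continuous_snd.cross continuous_fst)).sub
    ((continuous_smulRight _).comp continuous_snd)

lemma norm_strainT_le {t d : E3} (ht : ‖t‖ = 1) (hd : ‖d‖ = 1) (W : E3) :
    ‖W 1 • d - W 0 • cross t d‖ ≤ 2 * ‖W‖ := by
  have h3 := norm_cross_le t d
  rw [ht, hd] at h3
  refine (norm_sub_le _ _).trans ?_
  rw [norm_smul, norm_smul, Real.norm_eq_abs, Real.norm_eq_abs, hd]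
  have h1 := abs_apply_le_norm W 1
  have h2 := mul_le_mul (abs_apply_le_norm W 0) h3 (norm_nonneg _) (norm_nonneg _)
  linarith

lemma norm_strainD_le {t d : E3} (ht : ‖t‖ = 1) (hd : ‖d‖ = 1) (W : E3) :
    ‖W 2 • cross t d - W 1 • t‖ ≤ 2 * ‖W‖ := by
  have h3 := norm_cross_le t d
  rw [ht, hd] at h3
  refine (norm_sub_le _ _).trans ?_
  rw [norm_smul, norm_smul, Real.norm_eq_abs, Real.norm_eq_abs, ht]
  have h1 := abs_apply_le_norm W 1
  have h2 := mul_le_mul (abs_apply_le_norm W 2) h3 (norm_nonneg _) (norm_nonneg _)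
  linarith

/-- Passage to the limit in an integral equation that is linear in the strains. -/
lemma WeakTendsto.eq_integral (hL : 0 ≤ L) (hp : 1 < p) (hp' : p < ⊤) {w : ℕ → ℝ → E3} {u : ℝ → E3}
    (hw : WeakTendsto L p w u) {Ψ : E3 × E3 → E3 →L[ℝ] E3} (hΨ : Continuous Ψ)
    {y : ℕ → ℝ → E3 × E3} {z : ℝ → E3 × E3} {C : ℝ} (hy : ∀ k, ∀ s ∈ Icc 0 L, ‖y k s‖ ≤ C)
    (hyc : ∀ k, ContinuousOn (y k) (Icc 0 L)) (hzc : ContinuousOn z (Icc 0 L))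
    (hlim : TendstoUniformlyOn y z atTop (Icc 0 L)) {f : ℕ → ℝ → E3} {g : ℝ → E3} {c : E3}
    (hf : ∀ k, ∀ s ∈ Icc 0 L, f k s = c + ∫ r in (0 : ℝ)..s, Ψ (y k r) (w k r))
    (hfg : ∀ s ∈ Icc 0 L, Tendsto (fun k => f k s) atTop (𝓝 (g s))) :
    IntegrableOn (fun r => Ψ (z r) (u r)) (Icc 0 L) ∧
    ∀ s ∈ Icc 0 L, g s = c + ∫ r in (0 : ℝ)..s, Ψ (z r) (u r) := by
  have hz : ∀ s ∈ Icc 0 L, ‖z s‖ ≤ C := fun s hs =>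
    le_of_tendsto (hlim.tendsto_at hs).norm (Eventually.of_forall fun k => hy k s hs)
  have huni := tendstoUniformlyOn_comp_of_bounded hy hz hlim hΨ.continuousOn
  have hΨz : ContinuousOn (fun s => Ψ (z s)) (Icc 0 L) := hΨ.comp_continuousOn hzc
  obtain ⟨H, hH⟩ := isCompact_Icc.exists_bound_of_continuousOn hΨz
  have hm : ∀ {q : ℝ → E3 × E3}, ContinuousOn q (Icc 0 L) →
      AEStronglyMeasurable (fun s => Ψ (q s)) (arcMeasure L) := fun hq =>
    (hΨ.comp_continuousOn hq).aestronglyMeasurable_of_isCompact isCompact_Icc measurableSet_Icc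
  refine ⟨integrable_clm_apply (H := H) (hm hzc) ?_ hw.integrable, fun s hs => ?_⟩
  · filter_upwards [ae_restrict_mem measurableSet_Icc] with s hs using hH s hs
  -- The indicator of `[0, s]` turns the integral up to `s` into one over the whole interval, where
  -- weak convergence can be tested.
  have key := hw.tendsto_integral_clm_of_uniform hL hp hp' (H := H)
    (h := fun k => (Icc 0 s).indicator fun r => Ψ (y k r)) (g := (Icc 0 s).indicator fun r => Ψ (z r))
    (fun k => (hm (hyc k)).indicator measurableSet_Icc) ((hm hzc).indicator measurableSet_Icc)
    (fun r hr => (norm_indicator_le_norm_self _ r).trans (hH r hr)) (by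
      rw [Metric.tendstoUniformlyOn_iff] at huni ⊢
      intro ε hε
      filter_upwards [huni ε hε] with k hk r hr
      by_cases hrs : r ∈ Icc 0 s
      · simpa [hrs] using hk r hr
      · simpa [hrs] using hε)
  have e : ∀ (A : ℝ → E3 →L[ℝ] E3) (v : ℝ → E3),
      ∫ r, (Icc 0 s).indicator A r (v r) ∂(arcMeasure L) = ∫ r in (0 : ℝ)..s, A r (v r) := by
    intro A v
    rw [intervalIntegral_eq_setIntegral hs]
    congr 1; ext1 r
    by_cases hr : r ∈ Icc 0 s <;> simp [hr]
  simp_rw [e] at key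
  refine tendsto_nhds_unique (hfg s hs) ((key.const_add c).congr fun k => (hf k s hs).symm)

/-- Sequences of frames with bounded strains are compact. -/
theorem exists_subseq_framing (hp : 1 < p) (hp' : p < ⊤) {w x t d : ℕ → ℝ → E3} {x₀ t₀ d₀ : E3}
    {M : NNReal} (hw : ∀ k, eLpNorm (w k) p (arcMeasure L) ≤ M)
    (hf : ∀ k, Framing L (w k) (x k) (t k) (d k)) (hx0 : ∀ k, x k 0 = x₀) (ht0 : ∀ k, t k 0 = t₀)
    (hd0 : ∀ k, d k 0 = d₀) :
    ∃ (φ : ℕ → ℕ) (u x' t' d' : ℝ → E3), StrictMono φ ∧ AEStronglyMeasurable u (arcMeasure L) ∧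
      eLpNorm u p (arcMeasure L) ≤ M ∧ WeakTendsto L p (fun k => w (φ k)) u ∧
      Framing L u x' t' d' ∧ x' 0 = x₀ ∧ t' 0 = t₀ ∧ d' 0 = d₀ ∧
      TendstoUniformlyOn (fun k => x (φ k)) x' atTop (Icc 0 L) ∧
      TendstoUniformlyOn (fun k => t (φ k)) t' atTop (Icc 0 L) ∧
      TendstoUniformlyOn (fun k => d (φ k)) d' atTop (Icc 0 L) := by
  have hL : 0 < L := (hf 0).L_pos
  have h0 : (0 : ℝ) ∈ Icc 0 L := ⟨le_rfl, hL.le⟩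
  have hwm : ∀ k, AEStronglyMeasurable (w k) (arcMeasure L) ∧ eLpNorm (w k) p (arcMeasure L) ≤ M :=
    fun k => ⟨(hf k).integrableOn.aestronglyMeasurable, hw k⟩
  have hq : 1 < p.toReal := by
    rw [← ENNReal.toReal_one]; exact (ENNReal.toReal_lt_toReal ENNReal.one_ne_top hp'.ne).2 hp
  have hq' : 0 < 1 - 1 / p.toReal := by
    rw [sub_pos]; exact (div_lt_one (by linarith)).2 hq
  have hb : Tendsto (fun z : ℝ => 2 * (M * z ^ (1 - 1 / p.toReal))) (𝓝 0) (𝓝 0) := by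
    have h1 : ContinuousAt (fun z : ℝ => 2 * (M * z ^ (1 - 1 / p.toReal))) 0 :=
      ((Real.continuousAt_rpow_const 0 _ (Or.inr hq'.le)).const_mul _).const_mul _
    have h2 := h1.tendsto
    rwa [Real.zero_rpow hq'.ne', mul_zero, mul_zero] at h2
  -- The primitive of the strains is put into one equicontinuous family with the frame: its uniform
  -- limit is what identifies the weak limit of the strains.
  let y : ℕ → ℝ → E3 × E3 × E3 := fun k s => (∫ r in (0 : ℝ)..s, w k r, d k s, t k s)
  have hmod : ∀ k, ∀ r ∈ Icc 0 L, ∀ s ∈ Icc 0 L,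
      dist (y k r) (y k s) ≤ 2 * (M * (dist r s) ^ (1 - 1 / p.toReal)) := by
    intro k r hr s hs
    refine max_le ?_ (max_le ?_ ?_)
    · exact dist_primitive_le hp hp' (hwm k) (isPrimitive_integral (hf k).integrableOn)
        (fun u _ => by linarith [norm_nonneg (w k u)]) hr hs
    · exact dist_primitive_le hp hp' (hwm k) (hf k).primitive_d
        (fun u hu => norm_strainD_le ((hf k).norm_t u hu) ((hf k).norm_d u hu) _) hr hs
    · exact dist_primitive_le hp hp' (hwm k) (hf k).primitive_t
        (fun u hu => norm_strainT_le ((hf k).norm_t u hu) ((hf k).norm_d u hu) _) hr hs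
  obtain ⟨K, hK0, hK⟩ := integral_norm_le_of_eLpNorm_le (L := L) hp.le M
  have hyb : ∀ k, ∀ s ∈ Icc 0 L, ‖y k s‖ ≤ K + 1 := by
    intro k s hs
    refine max_le ?_ (max_le ?_ ?_)
    · refine le_trans ?_ ((hK (w k) (hwm k).1 (hwm k).2).trans (by linarith))
      refine (intervalIntegral.norm_integral_le_integral_norm hs.1).trans ?_
      rw [intervalIntegral.integral_of_le hs.1]
      exact setIntegral_mono_set (hf k).integrableOn.norm
        (Eventually.of_forall fun _ => norm_nonneg _)
        (Eventually.of_forall fun u hu => ⟨hu.1.le, hu.2.trans hs.2⟩)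
    · exact ((hf k).norm_d s hs).le.trans (by linarith)
    · exact ((hf k).norm_t s hs).le.trans (by linarith)
  obtain ⟨φ, g, hφ, hgc, hlim⟩ := exists_subseq_tendstoUniformlyOn hL.le hb hyb hmod
  obtain ⟨u, hum, huM, hwu⟩ := exists_weakTendsto hp hp' (w := fun k => w (φ k))
    (fun k => hwm (φ k)) (G := fun s => (g s).1) fun s hs =>
      (continuous_fst.tendsto _).comp (hlim.tendsto_at hs)
  have hz : TendstoUniformlyOn (fun k s => (d (φ k) s, t (φ k) s)) (fun s => (g s).2) atTop
      (Icc 0 L) := by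
    rw [Metric.tendstoUniformlyOn_iff] at hlim ⊢
    intro ε hε
    filter_upwards [hlim ε hε] with k hk s hs
    exact (le_max_right _ _).trans_lt (hk s hs)
  have hd : TendstoUniformlyOn (fun k s => d (φ k) s) (fun s => (g s).2.1) atTop (Icc 0 L) := by
    rw [Metric.tendstoUniformlyOn_iff] at hz ⊢
    intro ε hε
    filter_upwards [hz ε hε] with k hk s hs
    exact (le_max_left _ _).trans_lt (hk s hs)
  have ht : TendstoUniformlyOn (fun k s => t (φ k) s) (fun s => (g s).2.2) atTop (Icc 0 L) := by
    rw [Metric.tendstoUniformlyOn_iff] at hz ⊢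
    intro ε hε
    filter_upwards [hz ε hε] with k hk s hs
    exact (le_max_right _ _).trans_lt (hk s hs)
  have hbd : ∀ k, ∀ s ∈ Icc 0 L, ‖((d (φ k) s, t (φ k) s) : E3 × E3)‖ ≤ 1 := fun k s hs =>
    max_le ((hf _).norm_d s hs).le ((hf _).norm_t s hs).le
  have hyc : ∀ k, ContinuousOn (fun s => ((d (φ k) s, t (φ k) s) : E3 × E3)) (Icc 0 L) := fun k =>
    ((hf _).primitive_d.continuousOn hL.le).prodMk ((hf _).primitive_t.continuousOn hL.le)
  have hgc2 : ContinuousOn (fun s => (g s).2) (Icc 0 L) := continuous_snd.comp_continuousOn hgc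
  obtain ⟨it, et⟩ := hwu.eq_integral hL.le hp hp' continuous_strainT hbd hyc hgc2 hz
    (f := fun k => t (φ k)) (c := t₀) (fun k s hs => by
      rw [(hf _).primitive_t.eq_add s hs, ht0]; simp only [strainT_apply])
    fun s hs => ht.tendsto_at hs
  obtain ⟨id', ed⟩ := hwu.eq_integral hL.le hp hp' continuous_strainD hbd hyc hgc2 hz
    (f := fun k => d (φ k)) (c := d₀) (fun k s hs => by
      rw [(hf _).primitive_d.eq_add s hs, hd0]; simp only [strainD_apply])
    fun s hs => hd.tendsto_at hs
  simp only [strainT_apply] at it et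
  simp only [strainD_apply] at id' ed
  have et0 : (g 0).2.2 = t₀ := by simpa using et 0 h0
  have ed0 : (g 0).2.1 = d₀ := by simpa using ed 0 h0
  have hti : IntegrableOn (fun s => (g s).2.2) (Icc 0 L) :=
    (continuous_snd.comp_continuousOn hgc2).integrableOn_Icc
  have n_t : ‖t₀‖ = 1 := by rw [← ht0 0]; exact (hf 0).norm_t 0 h0
  have n_d : ‖d₀‖ = 1 := by rw [← hd0 0]; exact (hf 0).norm_d 0 h0
  have n_td : inner ℝ t₀ d₀ = 0 := by rw [← hd0 0, ← ht0 0]; exact (hf 0).inner_td 0 h0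
  have hui := integrable_of_eLpNorm_le hp ⟨hum, huM⟩
  refine ⟨φ, u, fun s => x₀ + ∫ r in (0 : ℝ)..s, (g r).2.2, fun s => (g s).2.2, fun s => (g s).2.1,
    hφ, hum, huM, hwu, Framing.of_isPrimitive hL hui ⟨hti, fun s hs => by simp⟩
      ⟨it, fun s hs => by rw [et0]; exact et s hs⟩ ⟨id', fun s hs => by rw [ed0]; exact ed s hs⟩
      (by rw [et0, n_t]) (by rw [ed0, n_d]) (by rw [et0, ed0, n_td]), by simp, et0, ed0, ?_, ht, hd⟩
  -- The midlines converge as primitives of uniformly convergent tangents with a common initial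
  -- value.
  rw [Metric.tendstoUniformlyOn_iff] at ht ⊢
  intro ε hε
  filter_upwards [ht (ε / (2 * L)) (by positivity)] with k hk s hs
  rw [(hf _).primitive_x.eq_add s hs, hx0, dist_add_left, dist_eq_norm,
    ← intervalIntegral.integral_sub (IsPrimitive.intervalIntegrable_of hti h0 hs)
      ((hf _).primitive_x.intervalIntegrable h0 hs)]
  have hle : ‖∫ r in (0 : ℝ)..s, ((g r).2.2 - t (φ k) r)‖ ≤ ε / (2 * L) * |s - 0| :=
    intervalIntegral.norm_integral_le_of_norm_le_const fun r hr => by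
      rw [uIoc_of_le hs.1] at hr
      rw [← dist_eq_norm]
      exact (hk r ⟨hr.1.le, hr.2.trans hs.2⟩).le
  refine hle.trans_lt ?_
  rw [sub_zero, abs_of_nonneg hs.1]
  calc ε / (2 * L) * s ≤ ε / (2 * L) * L := by gcongr; exact hs.2
    _ = ε / 2 := by field_simp
    _ < ε := by linarith

end Compactness

/-! ### Lower semicontinuity and coercivity of the shape energy. -/

section LowerSemicontinuity

/-- A convex condition that is stable under almost everywhere limits is stable under weak limits. -/
lemma WeakTendsto.mem_of_convex {L : ℝ} (hL : 0 ≤ L) {p : ℝ≥0∞} (hp : 1 < p) (hp' : p < ⊤)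
    {w : ℕ → ℝ → E3} {u : ℝ → E3} (h : WeakTendsto L p w u) {S : Set (ℝ → E3)} (hS : Convex ℝ S)
    (hw : ∀ᶠ k in atTop, w k ∈ S)
    (hcl : ∀ (v : ℕ → ℝ → E3) (u : ℝ → E3), (∀ k, v k ∈ S) → AEStronglyMeasurable u (arcMeasure L) →
      (∀ k, AEStronglyMeasurable (v k) (arcMeasure L)) →
      (∀ᵐ s ∂(arcMeasure L), Tendsto (fun k => v k s) atTop (𝓝 (u s))) → u ∈ S) : u ∈ S := by
  obtain ⟨N, hN⟩ := eventually_atTop.1 hw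
  have h' := h.comp (φ := fun k => k + N) (tendsto_add_atTop_nat N)
  obtain ⟨M, hM⟩ := h'.bounded
  obtain ⟨v, u', hv, hum, huM, hae, hlim⟩ := exists_convexHull_tendsto hp hp' hM
  have hae' := h'.ae_eq hL hp (integrable_of_eLpNorm_le hp ⟨hum, huM⟩) hv hlim
  -- Measurability is joined to `S` so that both properties pass to the convex combinations.
  have hvS : ∀ k, v k ∈ S ∩ {f | AEStronglyMeasurable f (arcMeasure L)} := fun k => by
    have hmc : Convex ℝ {f : ℝ → E3 | AEStronglyMeasurable f (arcMeasure L)} := by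
      rintro f (hf : AEStronglyMeasurable f _) g (hg : AEStronglyMeasurable g _) a b _ _ _
      exact (hf.const_smul a).add (hg.const_smul b)
    refine convexHull_min ?_ (hS.inter hmc) (hv k)
    rintro _ ⟨j, _, rfl⟩
    exact ⟨hN _ (Nat.le_add_left _ _), (hM j).1⟩
  refine hcl v u (fun k => (hvS k).1) h.integrable.aestronglyMeasurable (fun k => (hvS k).2) ?_
  filter_upwards [hae, hae'] with s h1 h2
  rwa [← h2]

/-- The shift by `c` makes both values nonnegative, so convexity can be stated in `ℝ≥0∞`. An
infinite value at either point makes the right side infinite, because both weights are positive. -/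
lemma ereal_convex_shift {a b z : EReal} {c α β : ℝ} (hα : 0 < α) (hβ : 0 < β) (hαβ : α + β = 1)
    (ha : (-c : ℝ) ≤ a) (hb : (-c : ℝ) ≤ b) (hz : z ≤ α * a + β * b) :
    (z + c).toENNReal ≤ ENNReal.ofReal α * (a + c).toENNReal + ENNReal.ofReal β * (b + c).toENNReal := by
  induction a with
  | bot => simp at ha
  | top =>
    rw [EReal.top_add_coe, EReal.toENNReal_top, ENNReal.mul_top (by simpa using hα)]
    simp
  | coe a =>
    induction b with
    | bot => simp at hb
    | top =>
      rw [EReal.top_add_coe, EReal.toENNReal_top, ENNReal.mul_top (by simpa using hβ)]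
      simp
    | coe b =>
      rw [EReal.coe_le_coe_iff] at ha hb
      have h1 : z + c ≤ ((α * (a + c) + β * (b + c) : ℝ) : EReal) := by
        have e : α * (a + c) + β * (b + c) = α * a + β * b + c := by
          have : α * c + β * c = c := by rw [← add_mul, hαβ, one_mul]
          linarith
        rw [e]
        push_cast
        gcongr
      refine (EReal.toENNReal_le_toENNReal h1).trans ?_
      rw [← EReal.coe_add, ← EReal.coe_add, EReal.toENNReal_of_ne_top (EReal.coe_ne_top _),
        EReal.toENNReal_of_ne_top (EReal.coe_ne_top _), EReal.toENNReal_of_ne_top (EReal.coe_ne_top _),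
        EReal.toReal_coe, EReal.toReal_coe, EReal.toReal_coe, ← ENNReal.ofReal_mul hα.le,
        ← ENNReal.ofReal_mul hβ.le, ← ENNReal.ofReal_add (by nlinarith) (by nlinarith)]

namespace Rod

variable {B : Rod}

/-- The shape energy, shifted by a constant so that its density is nonnegative. -/
def shiftEnergy (B : Rod) (c : ℝ) (v : ℝ → E3) : ℝ≥0∞ :=
  ∫⁻ s, (B.f (v s) s + c).toENNReal ∂(arcMeasure B.L)

/-- The Carathéodory argument: `f` is measurable along simple functions, and continuity in the first
variable carries this to their pointwise limit. -/
lemma aemeasurable_f_comp (B : Rod) {v : ℝ → E3} (hv : AEStronglyMeasurable v (arcMeasure B.L)) :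
    AEMeasurable (fun s => B.f (v s) s) (arcMeasure B.L) := by
  set μ := arcMeasure B.L
  set V := hv.mk v
  have hV : StronglyMeasurable V := hv.stronglyMeasurable_mk
  refine aemeasurable_of_tendsto_metrizable_ae' (f := fun n s => B.f (hV.approx n s) s)
    (fun n => ?_) ?_
  · refine ⟨fun s => (B.measurable_f (hV.approx n s)).mk _ s,
      SimpleFunc.measurable_bind (hV.approx n) (fun a s => (B.measurable_f a).mk _ s)
        (fun a => (B.measurable_f a).measurable_mk), ?_⟩
    have : ∀ᵐ s ∂μ, ∀ a ∈ (hV.approx n).range, B.f a s = (B.measurable_f a).mk _ s :=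
      (Finset.eventually_all _).2 fun a _ => (B.measurable_f a).ae_eq_mk
    filter_upwards [this] with s hs
    exact hs _ (SimpleFunc.mem_range_self _ s)
  · filter_upwards [hv.ae_eq_mk, ae_restrict_mem measurableSet_Icc] with s hs hsL
    rw [hs]
    exact ((B.continuous_f s hsL).tendsto _).comp (hV.tendsto_approx s)

lemma aemeasurable_shift (B : Rod) (c : ℝ) {v : ℝ → E3}
    (hv : AEStronglyMeasurable v (arcMeasure B.L)) :
    AEMeasurable (fun s => (B.f (v s) s + c).toENNReal) (arcMeasure B.L) :=
  ((B.aemeasurable_f_comp hv).add_const _).ereal_toENNReal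

lemma continuous_shift (c : ℝ) : Continuous fun z : EReal => (z + c).toENNReal := by
  refine EReal.continuous_toENNReal.comp (continuous_iff_continuousAt.2 fun z => ?_)
  have := EReal.continuousAt_add (p := (z, (c : EReal))) (by simp) (by simp)
  exact ContinuousAt.comp (f := fun z : EReal => (z, (c : EReal))) this (by fun_prop)

lemma convex_shiftEnergy_le {c : ℝ} (hc : ∀ s ∈ Icc 0 B.L, ∀ a, ((-c : ℝ) : EReal) ≤ B.f a s)
    (T : ℝ≥0∞) : Convex ℝ {v : ℝ → E3 | AEStronglyMeasurable v (arcMeasure B.L) ∧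
      B.shiftEnergy c v ≤ T} := by
  rw [convex_iff_forall_pos]
  rintro v ⟨hv, hvT⟩ w ⟨hw, hwT⟩ α β hα hβ hαβ
  refine ⟨(hv.const_smul α).add (hw.const_smul β), ?_⟩
  calc B.shiftEnergy c (α • v + β • w)
      ≤ ∫⁻ s, (ENNReal.ofReal α * (B.f (v s) s + c).toENNReal +
          ENNReal.ofReal β * (B.f (w s) s + c).toENNReal) ∂(arcMeasure B.L) := by
        refine lintegral_mono_ae ?_
        filter_upwards [ae_restrict_mem measurableSet_Icc] with s hs
        exact ereal_convex_shift hα hβ hαβ (hc s hs _) (hc s hs _)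
          (B.convex_f s hs (v s) (w s) α β hα hβ hαβ)
    _ = ENNReal.ofReal α * B.shiftEnergy c v + ENNReal.ofReal β * B.shiftEnergy c w := by
        rw [lintegral_add_left' ((B.aemeasurable_shift c hv).const_mul _),
          lintegral_const_mul' _ _ ENNReal.ofReal_ne_top, lintegral_const_mul' _ _ ENNReal.ofReal_ne_top]
        rfl
    _ ≤ ENNReal.ofReal α * T + ENNReal.ofReal β * T := by gcongr
    _ = T := by rw [← add_mul, ← ENNReal.ofReal_add hα.le hβ.le, hαβ]; simp

/-- The shape energy is weakly lower semicontinuous. -/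
lemma shiftEnergy_le_of_weakTendsto {c : ℝ} (hc : ∀ s ∈ Icc 0 B.L, ∀ a, ((-c : ℝ) : EReal) ≤ B.f a s)
    {w : ℕ → ℝ → E3} {u : ℝ → E3} (h : WeakTendsto B.L B.p w u) {T : ℝ≥0∞}
    (hT : ∀ T' > T, ∀ᶠ k in atTop, B.shiftEnergy c (w k) ≤ T') : B.shiftEnergy c u ≤ T := by
  -- For `T' > T` the sublevel set at `T'` contains a tail of the sequence, is convex and, by
  -- Fatou's lemma, is closed under almost everywhere limits.
  refine le_of_forall_gt_imp_ge_of_dense fun T' hT' => ?_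
  obtain ⟨M, hM⟩ := h.bounded
  refine (h.mem_of_convex B.L_pos.le B.one_lt_p B.p_lt_top (convex_shiftEnergy_le hc T') ?_ ?_).2
  · filter_upwards [hT T' hT'] with k hk using ⟨(hM k).1, hk⟩
  · intro v u hv hu hvm hae
    refine ⟨hu, ?_⟩
    calc B.shiftEnergy c u
        = ∫⁻ s, liminf (fun k => (B.f (v k s) s + c).toENNReal) atTop ∂(arcMeasure B.L) := by
          refine lintegral_congr_ae ?_
          filter_upwards [hae, ae_restrict_mem measurableSet_Icc] with s hs hsL
          exact ((((continuous_shift c).comp (B.continuous_f s hsL)).tendsto _).comp hs).liminf_eq.symm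
      _ ≤ liminf (fun k => B.shiftEnergy c (v k)) atTop :=
          lintegral_liminf_le' fun k => B.aemeasurable_shift c (hvm k)
      _ ≤ T' := liminf_le_of_le (by isBoundedDefault) fun b hb => by
          obtain ⟨k, hk⟩ := hb.exists
          exact hk.trans (hv k).2

lemma exists_lower_bound (B : Rod) : ∃ c C₁ : ℝ, 0 ≤ c ∧ 0 < C₁ ∧
    (∀ s ∈ Icc 0 B.L, ∀ a, ((-c : ℝ) : EReal) ≤ B.f a s) ∧
    ∀ s ∈ Icc 0 B.L, ∀ a : E3, ((C₁ * ‖a‖ ^ B.p.toReal : ℝ) : EReal) ≤ B.f a s + c := by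
  obtain ⟨C₁, C₂, hC, h⟩ := B.growth_f
  refine ⟨|C₂|, C₁, abs_nonneg _, hC, fun s hs a => le_trans ?_ (h s hs a), fun s hs a => ?_⟩
  · rw [EReal.coe_le_coe_iff]
    have : 0 ≤ C₁ * ‖a‖ ^ B.p.toReal := by positivity
    linarith [neg_abs_le C₂]
  · refine le_trans ?_ (add_le_add_left (h s hs a) _)
    rw [← EReal.coe_add, EReal.coe_le_coe_iff]
    linarith [neg_abs_le C₂]

/-- The negative part of the density is at most `c`, so its integral is finite and the difference in
`extIntegral` is never `⊤ - ⊤`. -/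
lemma Esh_eq (w : B.V) {c : ℝ} (hc0 : 0 ≤ c)
    (hc : ∀ s ∈ Icc 0 B.L, ∀ a, ((-c : ℝ) : EReal) ≤ B.f a s) :
    Esh w = (B.shiftEnergy c w.1 : EReal) - ((c * B.L : ℝ) : EReal) := by
  have hm := B.aemeasurable_f_comp (integrableOn_strain w).aestronglyMeasurable
  set h : ℝ → EReal := fun s => B.f (w.1 s) s
  set μ := arcMeasure B.L
  have hb : ∀ᵐ s ∂μ, ((-c : ℝ) : EReal) ≤ h s := by
    filter_upwards [ae_restrict_mem measurableSet_Icc] with s hs using hc s hs _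
  have hcm : ∫⁻ _, ENNReal.ofReal c ∂μ = ENNReal.ofReal (c * B.L) := by
    rw [lintegral_const, Measure.restrict_apply_univ, Real.volume_Icc, sub_zero,
      ← ENNReal.ofReal_mul hc0]
  -- Pointwise this is `h⁺ + c = (h + c) + h⁻`, written without subtraction so that it also holds
  -- where `h = ⊤`.
  have key : (∫⁻ s, (h s).toENNReal ∂μ) + ENNReal.ofReal (c * B.L) =
      B.shiftEnergy c w.1 + ∫⁻ s, (-(h s)).toENNReal ∂μ := by
    rw [← hcm, ← lintegral_add_right _ measurable_const]
    have e2 := lintegral_add_left' (μ := μ) (f := fun s => (h s + c).toENNReal)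
      ((hm.add_const _).ereal_toENNReal) (fun s => (-(h s)).toENNReal)
    refine Eq.trans ?_ e2
    refine lintegral_congr_ae ?_
    filter_upwards [hb] with s hs
    generalize h s = y at hs
    induction y with
    | bot => simp at hs
    | top => simp
    | coe a =>
      rw [EReal.coe_le_coe_iff] at hs
      rw [← EReal.coe_add, ← EReal.coe_neg, EReal.toENNReal_of_ne_top (EReal.coe_ne_top _),
        EReal.toENNReal_of_ne_top (EReal.coe_ne_top _), EReal.toENNReal_of_ne_top (EReal.coe_ne_top _),
        EReal.toReal_coe, EReal.toReal_coe, EReal.toReal_coe]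
      rcases le_total 0 a with ha | ha
      · rw [← ENNReal.ofReal_add ha hc0, ENNReal.ofReal_of_nonpos (neg_nonpos.2 ha), add_zero]
      · rw [ENNReal.ofReal_of_nonpos ha, zero_add, ← ENNReal.ofReal_add (by linarith) (by linarith)]
        congr 1; ring
  have hN : ∫⁻ s, (-(h s)).toENNReal ∂μ ≤ ENNReal.ofReal (c * B.L) := by
    rw [← hcm]
    refine lintegral_mono_ae ?_
    filter_upwards [hb] with s hs
    have h1 : -(h s) ≤ ((c : ℝ) : EReal) := by
      rw [EReal.neg_le]; simpa using hs
    refine (EReal.toENNReal_le_toENNReal h1).trans ?_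
    rw [EReal.toENNReal_of_ne_top (EReal.coe_ne_top _), EReal.toReal_coe]
  unfold Esh extIntegral
  change ((∫⁻ s, (h s).toENNReal ∂μ : ℝ≥0∞) : EReal) - ((∫⁻ s, (-(h s)).toENNReal ∂μ : ℝ≥0∞) : EReal)
    = _
  set P := ∫⁻ s, (h s).toENNReal ∂μ
  set N := ∫⁻ s, (-(h s)).toENNReal ∂μ
  set I := B.shiftEnergy c w.1
  have hNt : N ≠ ⊤ := (hN.trans_lt ENNReal.ofReal_lt_top).ne
  have hcL : 0 ≤ c * B.L := mul_nonneg hc0 B.L_pos.le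
  clear_value P N I
  lift N to NNReal using hNt
  by_cases hP : P = ⊤
  · have hI : I = ⊤ := by
      rw [hP, top_add] at key
      by_contra hI
      exact (ENNReal.add_ne_top.2 ⟨hI, ENNReal.coe_ne_top⟩) key.symm
    rw [hP, hI]
    simp only [EReal.coe_ennreal_top, EReal.coe_nnreal_eq_coe_real]
    rw [EReal.top_sub_coe, EReal.top_sub_coe]
  · have hI : I ≠ ⊤ := by
      intro hI
      rw [hI, top_add] at key
      exact (ENNReal.add_ne_top.2 ⟨hP, ENNReal.ofReal_ne_top⟩) key
    lift P to NNReal using hP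
    lift I to NNReal using hI
    simp only [EReal.coe_nnreal_eq_coe_real, ← EReal.coe_sub]
    rw [EReal.coe_eq_coe_iff]
    have := congrArg ENNReal.toReal key
    rw [ENNReal.toReal_add ENNReal.coe_ne_top ENNReal.ofReal_ne_top,
      ENNReal.toReal_add ENNReal.coe_ne_top ENNReal.coe_ne_top, ENNReal.toReal_ofReal hcL] at this
    simp only [ENNReal.coe_toReal] at this
    linarith

/-- Coercivity of the shape energy. -/
lemma eLpNorm_le_of_shiftEnergy_le {c C₁ : ℝ} (hC : 0 < C₁)
    (h : ∀ s ∈ Icc 0 B.L, ∀ a : E3, ((C₁ * ‖a‖ ^ B.p.toReal : ℝ) : EReal) ≤ B.f a s + c)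
    (T : NNReal) : ∃ M : NNReal, ∀ v : ℝ → E3, B.shiftEnergy c v ≤ T →
      eLpNorm v B.p (arcMeasure B.L) ≤ M := by
  have hp0 : B.p ≠ 0 := (zero_lt_one.trans B.one_lt_p).ne'
  set M : ℝ≥0∞ := (T / ENNReal.ofReal C₁) ^ (1 / B.p.toReal)
  have hM : M ≠ ⊤ := ENNReal.rpow_ne_top_of_nonneg (by positivity)
    (ENNReal.div_ne_top ENNReal.coe_ne_top (by simpa using hC))
  refine ⟨M.toNNReal, fun v hv => ?_⟩
  rw [ENNReal.coe_toNNReal hM, eLpNorm_eq_lintegral_rpow_enorm_toReal hp0 B.p_lt_top.ne]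
  refine ENNReal.rpow_le_rpow ?_ (by positivity)
  rw [ENNReal.le_div_iff_mul_le (Or.inl (by simpa using hC)) (Or.inl ENNReal.ofReal_ne_top),
    ← lintegral_mul_const' _ _ ENNReal.ofReal_ne_top]
  refine le_trans (lintegral_mono_ae ?_) hv
  filter_upwards [ae_restrict_mem measurableSet_Icc] with s hs
  have h1 := EReal.toENNReal_le_toENNReal (h s hs (v s))
  rw [EReal.toENNReal_of_ne_top (EReal.coe_ne_top _), EReal.toReal_coe, ENNReal.ofReal_mul hC.le,
    ← ENNReal.ofReal_rpow_of_nonneg (norm_nonneg _) ENNReal.toReal_nonneg, ofReal_norm] at h1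
  rwa [mul_comm]

/-- Local non-interpenetration is preserved by weak limits. -/
lemma localNI_of_weakTendsto {w : ℕ → ℝ → E3} {u : ℝ → E3} (h : WeakTendsto B.L B.p w u)
    (hw : ∀ k, ∀ᵐ s ∂(arcMeasure B.L), ∀ ζ ∈ B.A s, ζ.1 * w k s 1 - ζ.2 * w k s 0 ≤ 1) :
    ∀ᵐ s ∂(arcMeasure B.L), ∀ ζ ∈ B.A s, ζ.1 * u s 1 - ζ.2 * u s 0 ≤ 1 := by
  refine h.mem_of_convex B.L_pos.le B.one_lt_p B.p_lt_top
    (S := {v | ∀ᵐ s ∂(arcMeasure B.L), ∀ ζ ∈ B.A s, ζ.1 * v s 1 - ζ.2 * v s 0 ≤ 1}) ?_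
    (Eventually.of_forall hw) ?_
  · intro v hv w hw α β hα hβ hαβ
    simp only [mem_ofPred_eq] at hv hw ⊢
    filter_upwards [hv, hw] with s h1 h2 ζ hζ
    have e : ζ.1 * (α • v + β • w) s 1 - ζ.2 * (α • v + β • w) s 0 =
        α * (ζ.1 * v s 1 - ζ.2 * v s 0) + β * (ζ.1 * w s 1 - ζ.2 * w s 0) := by
      simp; ring
    rw [e]
    calc _ ≤ α * 1 + β * 1 := by gcongr; exacts [h1 ζ hζ, h2 ζ hζ]
      _ = 1 := by linarith
  · intro v u hv _ _ hae
    simp only [mem_ofPred_eq] at hv ⊢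
    filter_upwards [hae, ae_all_iff.2 hv] with s hs h1 ζ hζ
    have hc : Continuous fun a : E3 => ζ.1 * a 1 - ζ.2 * a 0 := by fun_prop
    exact le_of_tendsto ((hc.tendsto _).comp hs) (Eventually.of_forall fun k => h1 k ζ hζ)

end Rod

end LowerSemicontinuity

/-! ### Null sets under Lipschitz and absolutely continuous maps. -/

section NullSets

/-- Sets that are null in the larger of two comparable pseudometrics are null in the smaller. -/
lemma volume_image_eq_zero_of_dist_le {f g : E3 → E3} {S : Set E3} {K : NNReal}
    (h : ∀ y ∈ S, ∀ z ∈ S, dist (f y) (f z) ≤ K * dist (g y) (g z))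
    (hg : volume (g '' S) = 0) : volume (f '' S) = 0 := by
  have hfin : Module.finrank ℝ E3 = 3 := by simp
  have hac : (volume : Measure E3) ≪ μH[(Module.finrank ℝ E3 : ℝ)] :=
    Measure.absolutelyContinuous_isAddHaarMeasure _ _
  have hac' : μH[(Module.finrank ℝ E3 : ℝ)] ≪ (volume : Measure E3) :=
    Measure.absolutelyContinuous_isAddHaarMeasure _ _
  rcases S.eq_empty_or_nonempty with rfl | ⟨y₀, hy₀⟩
  · simp
  have : Nonempty E3 := ⟨0⟩
  -- On `S` the map `f` factors through `g` by a Lipschitz map, and Lipschitz maps preserve sets of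
  -- three-dimensional Hausdorff measure zero.
  have hl : LipschitzOnWith K (f ∘ Function.invFunOn g S) (g '' S) := by
    refine LipschitzOnWith.of_dist_le_mul fun a ha b hb => ?_
    have h1 := h _ (Function.invFunOn_mem ha) _ (Function.invFunOn_mem hb)
    rwa [Function.invFunOn_eq ha, Function.invFunOn_eq hb] at h1
  have him : f '' S = (f ∘ Function.invFunOn g S) '' (g '' S) := by
    rw [image_image]
    refine image_congr fun y hy => ?_
    have hgy : g y ∈ g '' S := mem_image_of_mem g hy
    have h1 := h y hy _ (Function.invFunOn_mem hgy)
    rw [Function.invFunOn_eq hgy, dist_self, mul_zero] at h1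
    exact dist_le_zero.1 h1
  rw [him]
  refine hac (le_antisymm ((hl.hausdorffMeasure_image_le (by positivity)).trans ?_) zero_le)
  rw [hac' hg, mul_zero]

/-- Links `ℝ × ℝ × ℝ`, where the material points live, with `E3`, where the area inequality for
differentiable maps is applied. -/
lemma measurePreserving_coords : MeasurePreserving (fun y : E3 => (y 0, y 1, y 2)) := by
  have h1 := EuclideanSpace.volume_preserving_symm_measurableEquiv_toLp (Fin 3)
  have h2 := volume_preserving_piFinSuccAbove (fun _ : Fin 3 => ℝ) 0
  have h3 := (MeasurePreserving.id (volume : Measure ℝ)).prod (volume_preserving_finTwoArrow ℝ)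
  exact (h3.comp h2).comp h1

lemma measurableEmbedding_coords : MeasurableEmbedding (fun y : E3 => (y 0, y 1, y 2)) := by
  refine measurePreserving_coords.measurable.measurableEmbedding fun y z h => ?_
  simp only [Prod.mk.injEq] at h
  exact E3.ext h.1 h.2.1 h.2.2

lemma surjective_coords : Function.Surjective (fun y : E3 => (y 0, y 1, y 2)) := fun q =>
  ⟨!₂[q.1, q.2.1, q.2.2], by simp⟩

/-- The set where `P` holds need not be measurable; removing a measurable hull of the exceptional
set makes it so. -/
lemma exists_measurable_derivSet {L : ℝ} {P : ℝ → Prop} (h : ∀ᵐ s, s ∈ Icc 0 L → P s) :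
    ∃ G ⊆ Icc 0 L, MeasurableSet G ∧ volume (Icc 0 L \ G) = 0 ∧ ∀ s ∈ G, P s := by
  set N := toMeasurable volume {s | ¬ (s ∈ Icc 0 L → P s)}
  have hN : volume N = 0 := by rw [measure_toMeasurable]; exact h
  refine ⟨Icc 0 L \ N, sdiff_subset, measurableSet_Icc.diff (measurableSet_toMeasurable _ _), ?_,
    fun s hs => ?_⟩
  · rw [sdiff_sdiff_right_self]
    exact measure_mono_null inter_subset_right hN
  · by_contra hP
    exact hs.2 (subset_toMeasurable _ _ fun h => hP (h hs.1))

/-- A strictly increasing absolutely continuous function maps null sets to null sets. -/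
lemma volume_image_primitive_eq_zero {L : ℝ} (hL : 0 ≤ L) {σ h : ℝ → ℝ} (hσ : IsPrimitive L σ h)
    (hh : ∀ s ∈ Icc 0 L, 0 ≤ h s)
    (hmono : StrictMonoOn σ (Icc 0 L)) {N : Set ℝ} (hNL : N ⊆ Icc 0 L) (hN : volume N = 0) :
    volume (σ '' N) = 0 := by
  have h0 : (0 : ℝ) ∈ Icc 0 L := ⟨le_rfl, hL⟩
  have h1 : L ∈ Icc 0 L := ⟨hL, le_rfl⟩
  obtain ⟨G', hG'L, hG'm, hG'0, hG'd⟩ := exists_measurable_derivSet (hσ.ae_hasDerivAt hL)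
  set N' := toMeasurable volume N
  have hN' : volume N' = 0 := by rw [measure_toMeasurable]; exact hN
  set G := G' \ N'
  have hGL : G ⊆ Icc 0 L := sdiff_subset.trans hG'L
  have hGm : MeasurableSet G := hG'm.diff (measurableSet_toMeasurable _ _)
  have hG0 : volume (Icc 0 L \ G) = 0 := by
    refine measure_mono_null (t := (Icc 0 L \ G') ∪ N') (fun s hs => ?_) (measure_union_null hG'0 hN')
    by_cases hs' : s ∈ N'
    · exact Or.inr hs'
    · exact Or.inl ⟨hs.1, fun h => hs.2 ⟨h, hs'⟩⟩
  have hcont : ContinuousOn σ (Icc 0 L) := hσ.continuousOn hL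
  -- The set `G` of differentiability points outside a hull of `N` already has an image of full
  -- length `σ L - σ 0`. By injectivity `σ '' N` lies in the remaining null set.
  have hvol : volume (σ '' G) = ENNReal.ofReal (σ L - σ 0) := by
    rw [← lintegral_deriv_eq_volume_image_of_monotoneOn hGm
      (fun s hs => (hG'd s hs.1).hasDerivWithinAt) (hmono.monotoneOn.mono hGL)]
    have hge : Icc 0 L =ᵐ[volume] G := by
      refine (ae_eq_set.2 ⟨hG0, ?_⟩)
      rw [sdiff_eq_empty.2 hGL]; simp
    have hnn : 0 ≤ᵐ[volume.restrict G] h := by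
      exact (ae_restrict_iff' hGm).2 (Eventually.of_forall fun s hs => hh s (hGL hs))
    rw [← ofReal_integral_eq_lintegral_ofReal (hσ.integrableOn.mono_set hGL) hnn,
      ← setIntegral_congr_set hge, hσ.sub_eq h0 h1, intervalIntegral.integral_of_le hL,
      integral_Icc_eq_integral_Ioc]
  have hsub : σ '' N ⊆ Icc (σ 0) (σ L) \ σ '' G := by
    rintro _ ⟨s, hs, rfl⟩
    refine ⟨⟨hmono.monotoneOn h0 (hNL hs) (hNL hs).1, hmono.monotoneOn (hNL hs) h1 (hNL hs).2⟩, ?_⟩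
    rintro ⟨r, hr, hrs⟩
    have : r = s := hmono.injOn (hGL hr) (hNL hs) hrs
    subst this
    exact hr.2 (subset_toMeasurable _ _ hs)
  refine measure_mono_null hsub ?_
  have hGi : MeasurableSet (σ '' G) :=
    hGm.image_of_continuousOn_injOn (hcont.mono hGL) (hmono.injOn.mono hGL)
  rw [measure_sdiff _ hGi.nullMeasurableSet (by rw [hvol]; exact ENNReal.ofReal_ne_top), hvol,
    Real.volume_Icc, tsub_self]
  rintro _ ⟨s, hs, rfl⟩
  exact ⟨hmono.monotoneOn h0 (hGL hs) (hGL hs).1, hmono.monotoneOn (hGL hs) h1 (hGL hs).2⟩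

end NullSets

/-! ### The differential of the configuration map. -/

section Tube

/-- The map `(s, ζ₁, ζ₂) ↦ x(s) + ζ₁ d(s) + ζ₂ t(s) × d(s)`. -/
def tube (x t d : ℝ → E3) (q : ℝ × ℝ × ℝ) : E3 :=
  x q.1 + q.2.1 • d q.1 + q.2.2 • cross (t q.1) (d q.1)

/-- The Jacobian determinant `1 - ζ₁ κ₂ + ζ₂ κ₁` of the configuration map. -/
def tubeJac (W : ℝ → E3) (q : ℝ × ℝ × ℝ) : ℝ := 1 - q.2.1 * W q.1 1 + q.2.2 * W q.1 0

/-- The left side is what the product rule gives for the derivative of `t × d`; the double vector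
products collapse by orthonormality. -/
lemma cross_derivative {t d W : E3} (ht : ‖t‖ = 1) (hd : ‖d‖ = 1) (htd : inner ℝ t d = 0) :
    cross t (W 2 • cross t d - W 1 • t) + cross (W 1 • d - W 0 • cross t d) d
      = W 0 • t - W 2 • d := by
  have ht' := norm_sq_eq_sum t
  have hd' := norm_sq_eq_sum d
  rw [ht] at ht'
  rw [hd] at hd'
  rw [inner_eq_sum] at htd
  apply E3.ext <;> simp only [PiLp.add_apply, PiLp.sub_apply, PiLp.smul_apply, cross_apply_zero,
    cross_apply_one, cross_apply_two, smul_eq_mul]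
  · linear_combination (-W 0 * t 0) * hd' + W 2 * d 0 * ht' + (W 2 * t 0 - W 0 * d 0) * htd
  · linear_combination (-W 0 * t 1) * hd' + W 2 * d 1 * ht' + (W 2 * t 1 - W 0 * d 1) * htd
  · linear_combination (-W 0 * t 2) * hd' + W 2 * d 2 * ht' + (W 2 * t 2 - W 0 * d 2) * htd

lemma det_frame (P d n : E3) (A : E3 →L[ℝ] E3)
    (hA : ∀ v : E3, A v = v 0 • P + v 1 • d + v 2 • n) : A.det = inner ℝ P (cross d n) := by
  rw [ContinuousLinearMap.det, ← LinearMap.det_toMatrix (EuclideanSpace.basisFun (Fin 3) ℝ).toBasis,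
    Matrix.det_fin_three, inner_eq_sum]
  simp [LinearMap.toMatrix_apply, hA]
  ring

/-- Since `d × (t × d) = t`, only the tangential component of the derivative in `s` contributes, and
the twist drops out. -/
lemma inner_frame {t d W : E3} (ht : ‖t‖ = 1) (hd : ‖d‖ = 1) (htd : inner ℝ t d = 0) (a b : ℝ) :
    inner ℝ (t + a • (W 2 • cross t d - W 1 • t) + b • (W 0 • t - W 2 • d))
      (cross d (cross t d)) = 1 - a * W 1 + b * W 0 := by
  have ht' := norm_sq_eq_sum t
  have hd' := norm_sq_eq_sum d
  rw [ht] at ht'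
  rw [hd] at hd'
  rw [inner_eq_sum] at htd
  have h1 : cross d (cross t d) = t := by
    apply E3.ext <;> simp only [cross_apply_zero, cross_apply_one, cross_apply_two]
    · linear_combination (-t 0) * hd' - d 0 * htd
    · linear_combination (-t 1) * hd' - d 1 * htd
    · linear_combination (-t 2) * hd' - d 2 * htd
  rw [h1, inner_eq_sum]
  simp only [PiLp.add_apply, PiLp.sub_apply, PiLp.smul_apply, cross_apply_zero,
    cross_apply_one, cross_apply_two, smul_eq_mul]
  linear_combination (-(1 - a * W 1 + b * W 0)) * ht' - b * W 2 * htd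

variable {L : ℝ} {W x t d : ℝ → E3}

lemma Framing.norm_cross (h : Framing L W x t d) {s : ℝ} (hs : s ∈ Icc 0 L) :
    ‖cross (t s) (d s)‖ = 1 := by
  have h1 := norm_cross_sq (t s) (d s)
  rw [h.norm_t s hs, h.norm_d s hs, h.inner_td s hs] at h1
  nlinarith [norm_nonneg (cross (t s) (d s))]

/-- Almost everywhere differentiability of the configuration map, with its Jacobian. -/
lemma Framing.ae_hasFDerivAt_tube (h : Framing L W x t d) :
    ∀ᵐ s, s ∈ Icc 0 L → ∀ y : E3, y 0 = s → ∃ A : E3 →L[ℝ] E3,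
      HasFDerivAt (fun z : E3 => tube x t d (z 0, z 1, z 2)) A y ∧
        A.det = tubeJac W (y 0, y 1, y 2) := by
  have hL := h.L_pos.le
  filter_upwards [h.primitive_x.ae_hasDerivAt hL, h.primitive_t.ae_hasDerivAt hL,
    h.primitive_d.ae_hasDerivAt hL] with s hx ht hd hs y hy
  have h1 := hx hs
  have h3 := hd hs
  have h4 := (ht hs).cross h3
  rw [cross_derivative (h.norm_t s hs) (h.norm_d s hs) (h.inner_td s hs)] at h4
  subst hy
  have p (i : Fin 3) : HasFDerivAt (fun z : E3 => z i) (EuclideanSpace.proj i : E3 →L[ℝ] ℝ) y :=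
    (EuclideanSpace.proj i : E3 →L[ℝ] ℝ).hasFDerivAt
  have q1 := h1.hasFDerivAt.comp y (p 0)
  have q3 := (p 1).smul (h3.hasFDerivAt.comp y (p 0))
  have q4 := (p 2).smul (h4.hasFDerivAt.comp y (p 0))
  refine ⟨_, (q1.add q3).add q4, ?_⟩
  rw [det_frame (t (y 0) + y 1 • (W (y 0) 2 • cross (t (y 0)) (d (y 0)) - W (y 0) 1 • t (y 0))
    + y 2 • (W (y 0) 0 • t (y 0) - W (y 0) 2 • d (y 0))) (d (y 0)) (cross (t (y 0)) (d (y 0)))]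
  · exact inner_frame (h.norm_t _ hs) (h.norm_d _ hs) (h.inner_td _ hs) _ _
  · intro v
    simp
    module

lemma IsPrimitive.norm_sub_le_abs_sub {f f' : ℝ → E3} (hf : IsPrimitive L f f') {k σ : ℝ → ℝ}
    (hσ : IsPrimitive L σ k) (hle : ∀ s ∈ Icc 0 L, ‖f' s‖ ≤ k s) {r s : ℝ} (hr : r ∈ Icc 0 L)
    (hs : s ∈ Icc 0 L) : ‖f r - f s‖ ≤ |σ r - σ s| := by
  wlog hrs : r ≤ s generalizing r s
  · rw [norm_sub_rev, abs_sub_comm]; exact this hs hr (le_of_not_ge hrs)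
  rw [norm_sub_rev, abs_sub_comm, hf.sub_eq hr hs, hσ.sub_eq hr hs]
  refine (intervalIntegral.norm_integral_le_of_norm_le hrs
    (Eventually.of_forall fun u hu => hle u ⟨hr.1.trans hu.1.le, hu.2.trans hs.2⟩)
    (hσ.intervalIntegrable hr hs)).trans (le_abs_self _)

/-- `σ` is the primitive of `1 + 2‖W‖`. The summand 1 makes it strictly increasing and dominates `x'
= t`, the other one dominates `t'` and `d'`. As functions of `σ` all three fields are 1-Lipschitz,
although the strains are only integrable. -/
lemma Framing.exists_arcLength (h : Framing L W x t d) : ∃ σ k : ℝ → ℝ, IsPrimitive L σ k ∧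
    (∀ s ∈ Icc 0 L, 0 ≤ k s) ∧ StrictMonoOn σ (Icc 0 L) ∧ ∀ r ∈ Icc 0 L, ∀ s ∈ Icc 0 L,
      ‖x r - x s‖ ≤ |σ r - σ s| ∧ ‖t r - t s‖ ≤ |σ r - σ s| ∧ ‖d r - d s‖ ≤ |σ r - σ s| := by
  have hk : IntegrableOn (fun s => 1 + 2 * ‖W s‖) (Icc 0 L) :=
    (integrableOn_const (by simp)).add (h.integrableOn.norm.const_mul 2)
  have hσ : IsPrimitive L (fun s => ∫ r in (0 : ℝ)..s, (1 + 2 * ‖W r‖)) fun s => 1 + 2 * ‖W s‖ :=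
    ⟨hk, fun s _ => by simp⟩
  refine ⟨_, _, hσ, fun s _ => by positivity, fun r hr s hs hrs => ?_, fun r hr s hs => ⟨?_, ?_, ?_⟩⟩
  · have h1 := hσ.sub_eq hr hs
    have h2 : ∫ u in r..s, (1 : ℝ) ≤ ∫ u in r..s, (1 + 2 * ‖W u‖) :=
      intervalIntegral.integral_mono_on hrs.le (by simp) (hσ.intervalIntegrable hr hs)
        fun u _ => by linarith [norm_nonneg (W u)]
    simp only [intervalIntegral.integral_const, smul_eq_mul, mul_one] at h2
    linarith
  · exact h.primitive_x.norm_sub_le_abs_sub hσ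
      (fun u hu => by rw [h.norm_t u hu]; linarith [norm_nonneg (W u)]) hr hs
  · exact h.primitive_t.norm_sub_le_abs_sub hσ (fun u hu => by
      linarith [norm_strainT_le (h.norm_t u hu) (h.norm_d u hu) (W u)]) hr hs
  · exact h.primitive_d.norm_sub_le_abs_sub hσ (fun u hu => by
      linarith [norm_strainD_le (h.norm_t u hu) (h.norm_d u hu) (W u)]) hr hs

end Tube

/-! ### The area inequality for the configuration map. -/

section Area

variable {L : ℝ} {W x t d : ℝ → E3}

lemma Framing.norm_cross_sub_le (h : Framing L W x t d) {r s : ℝ} (hr : r ∈ Icc 0 L)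
    (hs : s ∈ Icc 0 L) :
    ‖cross (t r) (d r) - cross (t s) (d s)‖ ≤ ‖t r - t s‖ + ‖d r - d s‖ := by
  have e : cross (t r) (d r) - cross (t s) (d s)
      = cross (t r - t s) (d r) + cross (t s) (d r - d s) := by
    apply E3.ext <;> simp <;> ring
  rw [e]
  refine (norm_add_le _ _).trans (add_le_add ((norm_cross_le _ _).trans ?_)
    ((norm_cross_le _ _).trans ?_))
  · rw [h.norm_d r hr, mul_one]
  · rw [h.norm_t s hs, one_mul]

/-- The constant is `1 + (R + 1) + (2 R + 1)`, from the midline, the `d`-term and the `t × d`-term;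
the increment of `t × d` is at most `2 m`. -/
lemma Framing.norm_tube_sub_le (h : Framing L W x t d) {q q' : ℝ × ℝ × ℝ} (hq : q.1 ∈ Icc 0 L)
    (hq' : q'.1 ∈ Icc 0 L) {m R : ℝ} (hx : ‖x q.1 - x q'.1‖ ≤ m) (ht : ‖t q.1 - t q'.1‖ ≤ m)
    (hd : ‖d q.1 - d q'.1‖ ≤ m) (h1 : |q.2.1 - q'.2.1| ≤ m) (h2 : |q.2.2 - q'.2.2| ≤ m)
    (hR1 : |q.2.1| ≤ R) (hR2 : |q.2.2| ≤ R) :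
    ‖tube x t d q - tube x t d q'‖ ≤ (3 + 3 * R) * m := by
  have hn := h.norm_cross_sub_le hq hq'
  have hm : 0 ≤ m := (norm_nonneg _).trans hx
  have e : tube x t d q - tube x t d q' = (x q.1 - x q'.1) +
      (q.2.1 • (d q.1 - d q'.1) + (q.2.1 - q'.2.1) • d q'.1) +
      (q.2.2 • (cross (t q.1) (d q.1) - cross (t q'.1) (d q'.1)) +
        (q.2.2 - q'.2.2) • cross (t q'.1) (d q'.1)) := by
    unfold tube; module
  rw [e]
  refine (norm_add₃_le).trans ?_
  have a1 := norm_add_le (q.2.1 • (d q.1 - d q'.1)) ((q.2.1 - q'.2.1) • d q'.1)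
  have a2 := norm_add_le (q.2.2 • (cross (t q.1) (d q.1) - cross (t q'.1) (d q'.1)))
    ((q.2.2 - q'.2.2) • cross (t q'.1) (d q'.1))
  rw [norm_smul, norm_smul, Real.norm_eq_abs, Real.norm_eq_abs, h.norm_d _ hq'] at a1
  rw [norm_smul, norm_smul, Real.norm_eq_abs, Real.norm_eq_abs, h.norm_cross hq'] at a2
  have hR : 0 ≤ R := (abs_nonneg _).trans hR1
  have b1 := mul_le_mul hR1 hd (norm_nonneg _) hR
  have b2 := mul_le_mul hR2 (hn.trans (add_le_add ht hd)) (norm_nonneg _) hR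
  linarith

/-- The area inequality for the configuration map. -/
theorem Framing.volume_tube_image_le (h : Framing L W x t d) {S : Set (ℝ × ℝ × ℝ)}
    (hS : MeasurableSet S) (hSL : ∀ q ∈ S, q.1 ∈ Icc 0 L) {R : ℝ}
    (hR : ∀ q ∈ S, |q.2.1| ≤ R ∧ |q.2.2| ≤ R) :
    volume (tube x t d '' S) ≤ ∫⁻ q in S, ENNReal.ofReal |tubeJac W q| := by
  set c : E3 → ℝ × ℝ × ℝ := fun y => (y 0, y 1, y 2)
  have hc : MeasurePreserving c := measurePreserving_coords
  obtain ⟨G, hGL, hGm, hG0, hGd⟩ := exists_measurable_derivSet h.ae_hasFDerivAt_tube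
  have h0m : Measurable fun y : E3 => y 0 := (EuclideanSpace.proj (0 : Fin 3) : E3 →L[ℝ] ℝ).measurable
  -- Over `S₁` the configuration map is differentiable with known Jacobian. `S₂` lies over a null
  -- set of parameters.
  set S₁ : Set E3 := c ⁻¹' S ∩ {y | y 0 ∈ G}
  set S₂ : Set E3 := c ⁻¹' S ∩ {y | y 0 ∈ Icc 0 L \ G}
  have hS₁ : MeasurableSet S₁ := (hc.measurable hS).inter (h0m hGm)
  have himage : tube x t d '' S ⊆ (tube x t d ∘ c) '' S₁ ∪ (tube x t d ∘ c) '' S₂ := by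
    rintro _ ⟨q, hq, rfl⟩
    obtain ⟨y, rfl⟩ := surjective_coords q
    by_cases hy : y 0 ∈ G
    · exact Or.inl ⟨y, ⟨hq, hy⟩, rfl⟩
    · exact Or.inr ⟨y, ⟨hq, hSL _ hq, hy⟩, rfl⟩
  have hfd : ∀ y ∈ S₁, ∃ A : E3 →L[ℝ] E3, HasFDerivAt (tube x t d ∘ c) A y ∧
      A.det = tubeJac W (c y) := fun y hy => hGd (y 0) hy.2 y rfl
  choose! A hA hAdet using hfd
  have hone : volume ((tube x t d ∘ c) '' S₁) ≤ ∫⁻ q in S, ENNReal.ofReal |tubeJac W q| :=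
    calc _ ≤ ∫⁻ y in S₁, ENNReal.ofReal |(A y).det| :=
          addHaar_image_le_lintegral_abs_det_fderiv volume hS₁ fun y hy => (hA y hy).hasFDerivWithinAt
      _ = ∫⁻ y in S₁, ENNReal.ofReal |tubeJac W (c y)| :=
          setLIntegral_congr_fun hS₁ fun y hy => by simp only [hAdet y hy]
      _ ≤ ∫⁻ y in c ⁻¹' S, ENNReal.ofReal |tubeJac W (c y)| := lintegral_mono_set inter_subset_left
      _ = _ := hc.setLIntegral_comp_preimage_emb measurableEmbedding_coords
          (fun q => ENNReal.ofReal |tubeJac W q|) S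
  have htwo : volume ((tube x t d ∘ c) '' S₂) = 0 := by
    obtain ⟨σ, k, hσ, hk, hmono, hle⟩ := h.exists_arcLength
    have hnull := volume_image_primitive_eq_zero h.L_pos.le hσ hk hmono sdiff_subset hG0
    -- The configuration map need not be Lipschitz in `s`, but it is Lipschitz in `(σ s, ζ₁, ζ₂)`,
    -- and in these coordinates `S₂` lies over the null set `σ '' (Icc 0 L \ G)`.
    refine volume_image_eq_zero_of_dist_le (g := fun y => !₂[σ (y 0), y 1, y 2])
      (K := (3 + 3 * R).toNNReal) (fun y hy z hz => ?_) ?_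
    · have hRy := hR _ hy.1
      have hR0 : 0 ≤ R := (abs_nonneg _).trans hRy.1
      have i0 := abs_apply_le_norm (!₂[σ (y 0), y 1, y 2] - !₂[σ (z 0), z 1, z 2]) 0
      have i1 := abs_apply_le_norm (!₂[σ (y 0), y 1, y 2] - !₂[σ (z 0), z 1, z 2]) 1
      have i2 := abs_apply_le_norm (!₂[σ (y 0), y 1, y 2] - !₂[σ (z 0), z 1, z 2]) 2
      simp only [PiLp.sub_apply] at i0 i1 i2
      obtain ⟨e1, e2, e3⟩ := hle _ hy.2.1 _ hz.2.1
      rw [Real.coe_toNNReal _ (by positivity), dist_eq_norm, dist_eq_norm]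
      exact h.norm_tube_sub_le hy.2.1 hz.2.1 (e1.trans i0) (e2.trans i0) (e3.trans i0) i1 i2
        hRy.1 hRy.2
    · refine measure_mono_null (t := c ⁻¹' ((σ '' (Icc 0 L \ G)) ×ˢ univ)) ?_
        (hc.quasiMeasurePreserving.preimage_null ?_)
      · rintro _ ⟨y, hy, rfl⟩
        exact ⟨⟨y 0, hy.2, by simp [c]⟩, mem_univ _⟩
      · rw [Measure.volume_eq_prod, Measure.prod_prod, hnull, zero_mul]
  calc _ ≤ volume ((tube x t d ∘ c) '' S₁ ∪ (tube x t d ∘ c) '' S₂) := measure_mono himage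
    _ ≤ _ := measure_union_le _ _
    _ ≤ _ := by rw [htwo, add_zero]; exact hone

end Area

/-! ### Thin tubes cover neighbourhoods of midline points. -/

section LocalOpenness

variable {L : ℝ} {W x t d : ℝ → E3}

/-- The residual `u` is orthogonal to all three vectors. From `u ⟂ t, d` follows `u × (t × d) = 0`,
and together with `u ⟂ t × d` this leaves `‖u‖ = 0`. -/
lemma orthonormal_expansion {t d : E3} (ht : ‖t‖ = 1) (hd : ‖d‖ = 1) (htd : inner ℝ t d = 0) (v : E3) :
    v = inner ℝ v t • t + inner ℝ v d • d + inner ℝ v (cross t d) • cross t d := by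
  have ht' := norm_sq_eq_sum t
  have hd' := norm_sq_eq_sum d
  have hn := norm_cross_sq t d
  rw [ht, hd, htd] at hn
  have hn' := norm_sq_eq_sum (cross t d)
  rw [hn] at hn'
  rw [ht] at ht'
  rw [hd] at hd'
  have htd' := htd
  rw [inner_eq_sum] at htd'
  set n := cross t d with hndef
  have htn : inner ℝ t n = 0 := by rw [inner_eq_sum, hndef]; simp; ring
  have hdn : inner ℝ d n = 0 := by rw [inner_eq_sum, hndef]; simp; ring
  have htt : inner ℝ t t = (1 : ℝ) := by rw [real_inner_self_eq_norm_sq, ht]; norm_num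
  have hdd : inner ℝ d d = (1 : ℝ) := by rw [real_inner_self_eq_norm_sq, hd]; norm_num
  have hnn : inner ℝ n n = (1 : ℝ) := by rw [real_inner_self_eq_norm_sq, hn]; norm_num
  set u := v - (inner ℝ v t • t + inner ℝ v d • d + inner ℝ v n • n) with hu
  have hdt : inner ℝ d t = 0 := by rw [real_inner_comm]; exact htd
  have hnt : inner ℝ n t = 0 := by rw [real_inner_comm]; exact htn
  have hnd : inner ℝ n d = 0 := by rw [real_inner_comm]; exact hdn
  have u1 : inner ℝ u t = 0 := by
    simp only [hu, inner_sub_left, inner_add_left, real_inner_smul_left, htt, hdt, hnt]; ring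
  have u2 : inner ℝ u d = 0 := by
    simp only [hu, inner_sub_left, inner_add_left, real_inner_smul_left, htd, hdd, hnd]; ring
  have u3 : inner ℝ u n = 0 := by
    simp only [hu, inner_sub_left, inner_add_left, real_inner_smul_left, htn, hdn, hnn]; ring
  have hcr : cross u n = 0 := by
    rw [inner_eq_sum] at u1 u2
    apply E3.ext <;> simp only [hndef, cross_apply_zero, cross_apply_one, cross_apply_two,
      PiLp.zero_apply]
    · linear_combination t 0 * u2 - d 0 * u1
    · linear_combination t 1 * u2 - d 1 * u1
    · linear_combination t 2 * u2 - d 2 * u1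
  have h1 := norm_cross_sq u n
  rw [hcr, u3, hn] at h1
  have h2 : ‖u‖ ^ 2 = 0 := by simpa using h1.symm
  have h3 : u = 0 := by simpa using h2
  exact sub_eq_zero.1 h3

lemma IsPrimitive.norm_sub_sub_smul_le {f f' : ℝ → E3} (h : IsPrimitive L f f') {a b c : ℝ} {T : E3}
    (ha : a ∈ Icc 0 L) (hb : b ∈ Icc 0 L) (hc : ∀ r ∈ uIcc a b, ‖f' r - T‖ ≤ c) :
    ‖f b - f a - (b - a) • T‖ ≤ c * |b - a| := by
  rw [h.sub_eq ha hb, ← intervalIntegral.integral_const,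
    ← intervalIntegral.integral_sub (h.intervalIntegrable ha hb) (by simp)]
  exact intervalIntegral.norm_integral_le_of_norm_le_const fun r hr => hc r (uIoc_subset_uIcc hr)

/-- Thin tubes around a piece of the midline cover a neighbourhood of its interior points. -/
lemma Framing.exists_ball_subset (h : Framing L W x t d) {s₀ r : ℝ} (hs₀ : s₀ ∈ Ioo 0 L)
    (hr : 0 < r) : ∃ η > 0, ∀ z, dist z (x s₀) < η →
      ∃ s a b, |s - s₀| < r ∧ s ∈ Ioo 0 L ∧ |a| < r ∧ |b| < r ∧ tube x t d (s, a, b) = z := by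
  have hL := h.L_pos.le
  have hs₀' := Ioo_subset_Icc_self hs₀
  have htc := h.primitive_t.continuousOn hL
  have hxc := h.primitive_x.continuousOn hL
  have hn : Icc 0 L ∈ 𝓝 s₀ := Icc_mem_nhds hs₀.1 hs₀.2
  obtain ⟨δ₁, hδ₁, hδt⟩ := Metric.continuousAt_iff.1 (htc.continuousAt hn) (1 / 2) (by norm_num)
  obtain ⟨δ, hδ, hδr, hδ1, hδ0, hδL⟩ : ∃ δ > 0, δ ≤ r ∧ δ < δ₁ ∧ δ < s₀ ∧ δ < L - s₀ := by
    refine ⟨min (min r (δ₁ / 2)) (min (s₀ / 2) ((L - s₀) / 2)), ?_, ?_, ?_, ?_, ?_⟩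
    · exact lt_min (lt_min hr (by linarith)) (lt_min (by linarith [hs₀.1]) (by linarith [hs₀.2]))
    · exact (min_le_left _ _).trans (min_le_left _ _)
    · exact lt_of_le_of_lt ((min_le_left _ _).trans (min_le_right _ _)) (by linarith)
    · exact lt_of_le_of_lt ((min_le_right _ _).trans (min_le_left _ _)) (by linarith [hs₀.1])
    · exact lt_of_le_of_lt ((min_le_right _ _).trans (min_le_right _ _)) (by linarith [hs₀.2])
  have hsub : Icc (s₀ - δ) (s₀ + δ) ⊆ Ioo 0 L := fun s hs =>
    ⟨by linarith [hs.1], by linarith [hs.2]⟩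
  -- On this interval the tangent stays within 1/2 of `t s₀`, so chords from `x s₀` are at least
  -- half as long as the arcs.
  have hchord : ∀ s ∈ Icc (s₀ - δ) (s₀ + δ), |s - s₀| / 2 ≤ ‖x s - x s₀‖ := by
    intro s hs
    have h1 := h.primitive_x.norm_sub_sub_smul_le (c := 1 / 2) (T := t s₀) hs₀'
      (Ioo_subset_Icc_self (hsub hs)) fun u hu => by
        rw [← dist_eq_norm]
        refine (hδt ?_).le
        have : |u - s₀| ≤ |s - s₀| := abs_sub_left_of_mem_uIcc hu
        rw [Real.dist_eq]
        refine lt_of_le_of_lt (this.trans (abs_le.2 ⟨?_, ?_⟩)) hδ1 <;> linarith [hs.1, hs.2]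
    have h2 : ‖(s - s₀) • t s₀‖ = |s - s₀| := by
      rw [norm_smul, h.norm_t s₀ hs₀', mul_one, Real.norm_eq_abs]
    have h3 := norm_sub_norm_le ((s - s₀) • t s₀) (x s - x s₀)
    rw [h2, norm_sub_rev ((s - s₀) • t s₀)] at h3
    linarith
  refine ⟨min (δ / 8) (r / 2), by positivity, fun z hz => ?_⟩
  -- `s` is the parameter of a midline point nearest to `z`. By the chord estimate the radius `δ /
  -- 8` keeps it off the ends of the interval.
  obtain ⟨s, hs, hmin⟩ := isCompact_Icc.exists_isMinOn (nonempty_Icc.2 (by linarith : s₀ - δ ≤ s₀ + δ))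
    (f := fun s => ‖x s - z‖ ^ 2)
    (((hxc.mono (hsub.trans Ioo_subset_Icc_self)).sub continuousOn_const).norm.pow 2)
  have hle : ‖x s - z‖ ≤ ‖x s₀ - z‖ :=
    le_of_sq_le_sq (hmin (⟨by linarith, by linarith⟩ : s₀ ∈ Icc (s₀ - δ) (s₀ + δ))) (norm_nonneg _)
  rw [dist_comm, dist_eq_norm] at hz
  have hz1 := hz.trans_le (min_le_left _ _)
  have hz2 := hz.trans_le (min_le_right _ _)
  have hclose : |s - s₀| < δ := by
    have h1 := hchord s hs
    have h2 := norm_sub_le_norm_sub_add_norm_sub (x s) z (x s₀)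
    rw [norm_sub_rev z] at h2
    linarith
  have hsI := hsub hs
  have hsI' := Ioo_subset_Icc_self hsI
  have hd1 : HasDerivAt (fun u => ‖x u - z‖ ^ 2) (2 * inner ℝ (x s - z) (t s)) s :=
    ((h.primitive_x.hasDerivAt htc hsI).sub_const z).norm_sq
  have hloc : IsLocalMin (fun u => ‖x u - z‖ ^ 2) s :=
    hmin.isLocalMin (Icc_mem_nhds (by linarith [(abs_lt.1 hclose).1]) (by linarith [(abs_lt.1 hclose).2]))
  -- At an interior minimum `z - x s` is normal to the midline, hence a combination of `d s` and `t
  -- s × d s`: its coefficients are the wanted cross-sectional coordinates.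
  have horth : inner ℝ (z - x s) (t s) = 0 := by
    have h1 := hloc.hasDerivAt_eq_zero hd1
    rw [← neg_sub, inner_neg_left]
    linarith
  have hexp := orthonormal_expansion (h.norm_t s hsI') (h.norm_d s hsI') (h.inner_td s hsI') (z - x s)
  rw [horth, zero_smul, zero_add] at hexp
  have hzs : ‖z - x s‖ < r := by rw [norm_sub_rev]; linarith
  refine ⟨s, inner ℝ (z - x s) (d s), inner ℝ (z - x s) (cross (t s) (d s)), hclose.trans_le hδr, hsI,
    ?_, ?_, ?_⟩
  · refine ((abs_real_inner_le_norm _ _).trans ?_).trans_lt hzs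
    rw [h.norm_d s hsI', mul_one]
  · refine ((abs_real_inner_le_norm _ _).trans ?_).trans_lt hzs
    rw [h.norm_cross hsI', mul_one]
  · unfold tube
    simp only
    rw [add_assoc, ← hexp]; abel

end LocalOpenness

/-! ### Global injectivity excludes self-contact of the midline. -/

namespace Rod

variable {B : Rod} {W x t d : ℝ → E3}

lemma exists_bound (B : Rod) : ∃ R : ℝ, 0 ≤ R ∧ ∀ q ∈ B.Ω, |q.2.1| ≤ R ∧ |q.2.2| ≤ R := by
  obtain ⟨R, hR⟩ := B.isCompact_domain.isBounded.exists_norm_le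
  refine ⟨max R 0, le_max_right _ _, fun q hq => ?_⟩
  have h1 := (norm_snd_le q).trans ((hR q hq).trans (le_max_left R 0))
  exact ⟨(norm_fst_le q.2).trans h1, (norm_snd_le q.2).trans h1⟩

lemma measurableSet_Ω (B : Rod) : MeasurableSet B.Ω := B.isCompact_domain.isClosed.measurableSet

lemma integrableOn_box_mul (R : ℝ) {L : ℝ} {f : ℝ → ℝ} (hf : IntegrableOn f (Icc 0 L)) {g : ℝ × ℝ → ℝ}
    (hg : Continuous g) : IntegrableOn (fun q : ℝ × ℝ × ℝ => f q.1 * g q.2)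
      (Icc 0 L ×ˢ (Icc (-R) R ×ˢ Icc (-R) R)) := by
  have hg' : IntegrableOn g (Icc (-R) R ×ˢ Icc (-R) R) :=
    hg.continuousOn.integrableOn_compact (isCompact_Icc.prod isCompact_Icc)
  rw [IntegrableOn, Measure.volume_eq_prod, ← Measure.prod_restrict]
  exact Integrable.mul_prod hf hg'

lemma subset_box {R : ℝ} (hR : ∀ q ∈ B.Ω, |q.2.1| ≤ R ∧ |q.2.2| ≤ R) :
    B.Ω ⊆ Icc 0 B.L ×ˢ (Icc (-R) R ×ˢ Icc (-R) R) := fun q hq =>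
  ⟨hq.1, abs_le.1 (hR q hq).1, abs_le.1 (hR q hq).2⟩

lemma integrableOn_tubeJac (B : Rod) (hW : IntegrableOn W (Icc 0 B.L)) :
    IntegrableOn (tubeJac W) B.Ω := by
  obtain ⟨R, -, hR⟩ := B.exists_bound
  have h1 := integrableOn_box_mul R (integrableOn_apply hW 1) (g := fun ζ => ζ.1) continuous_fst
  have h0 := integrableOn_box_mul R (integrableOn_apply hW 0) (g := fun ζ => ζ.2) continuous_snd
  have h2 : IntegrableOn (fun _ : ℝ × ℝ × ℝ => (1 : ℝ)) B.Ω :=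
    integrableOn_const B.isCompact_domain.measure_lt_top.ne
  refine ((h2.sub (h1.mono_set (subset_box hR))).add (h0.mono_set (subset_box hR))).congr ?_
  refine Eventually.of_forall fun q => ?_
  simp [tubeJac, mul_comm]

lemma ae_domain (B : Rod) {P : ℝ → Prop} (h : ∀ᵐ s ∂(volume.restrict (Icc 0 B.L)), P s) :
    ∀ᵐ q ∂(volume.restrict B.Ω), P q.1 := by
  rw [ae_restrict_iff' measurableSet_Icc] at h
  rw [ae_restrict_iff' B.measurableSet_Ω]
  have hq : Measure.QuasiMeasurePreserving (Prod.fst : ℝ × ℝ × ℝ → ℝ) volume volume := by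
    rw [Measure.volume_eq_prod]; exact Measure.quasiMeasurePreserving_fst
  filter_upwards [hq.ae h] with q hq hqΩ using hq hqΩ.1

lemma tubeJac_nonneg (B : Rod) (h : ∀ᵐ s ∂(volume.restrict (Icc 0 B.L)),
      ∀ ζ ∈ B.A s, ζ.1 * W s 1 - ζ.2 * W s 0 ≤ 1) :
    0 ≤ᵐ[volume.restrict B.Ω] tubeJac W := by
  filter_upwards [B.ae_domain h, ae_restrict_mem B.measurableSet_Ω] with q hq hqΩ
  have := hq q.2 hqΩ.2
  simp only [tubeJac, Pi.zero_apply]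
  linarith

lemma continuousOn_tube (h : Framing B.L W x t d) :
    ContinuousOn (tube x t d) {q | q.1 ∈ Icc 0 B.L} := by
  have hL := B.L_pos.le
  have hm : MapsTo (Prod.fst : ℝ × ℝ × ℝ → ℝ) {q | q.1 ∈ Icc 0 B.L} (Icc 0 B.L) := fun q hq => hq
  have hx := (h.primitive_x.continuousOn hL).comp continuousOn_fst hm
  have ht := (h.primitive_t.continuousOn hL).comp continuousOn_fst hm
  have hd := (h.primitive_d.continuousOn hL).comp continuousOn_fst hm
  exact (hx.add ((continuous_fst.comp continuous_snd).continuousOn.smul hd)).add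
    ((continuous_snd.comp continuous_snd).continuousOn.smul (ht.cross hd))

/-- Global injectivity forbids that two disjoint parts of the rod overlap in an open set. -/
lemma not_overlap (h : Framing B.L W x t d) (hJ : 0 ≤ᵐ[volume.restrict B.Ω] tubeJac W)
    (hG : ENNReal.ofReal (∫ q in B.Ω, tubeJac W q) ≤ volume (tube x t d '' B.Ω))
    {U₁ U₂ : Set (ℝ × ℝ × ℝ)} (h₁ : U₁ ⊆ B.Ω) (h₂ : U₂ ⊆ B.Ω) (hU : Disjoint U₁ U₂) (hU₂ : IsOpen U₂)
    {O : Set E3} (hO : IsOpen O) (hO₁ : O ⊆ tube x t d '' U₁) (hO₂ : O ⊆ tube x t d '' U₂) :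
    O = ∅ := by
  obtain ⟨R, -, hR⟩ := B.exists_bound
  have hc := continuousOn_tube h
  have hΩ := B.measurableSet_Ω
  have hΩL : B.Ω ⊆ {q | q.1 ∈ Icc 0 B.L} := fun q hq => hq.1
  -- `E` is the part of `U₂` mapped into `O`. Since `U₁` covers `O` as well, removing `E` from `Ω`
  -- does not change the image, while the Jacobian integral over `E` is at least the volume of `O`.
  set E := U₂ ∩ tube x t d ⁻¹' O
  have hEm : MeasurableSet E := ((hc.mono (h₂.trans hΩL)).isOpen_inter_preimage hU₂ hO).measurableSet
  have hEΩ : E ⊆ B.Ω := inter_subset_left.trans h₂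
  have i1 : volume (tube x t d '' B.Ω) ≤ ∫⁻ q in B.Ω \ E, ENNReal.ofReal |tubeJac W q| := by
    refine (measure_mono ?_).trans (h.volume_tube_image_le (hΩ.diff hEm) (fun q hq => hq.1.1)
      fun q hq => hR q hq.1)
    rintro _ ⟨q, hq, rfl⟩
    by_cases hqE : q ∈ E
    · obtain ⟨q', hq', e⟩ := hO₁ hqE.2
      exact ⟨q', ⟨h₁ hq', fun hE => hU.ne_of_mem hq' hE.1 rfl⟩, e⟩
    · exact ⟨q, ⟨hq, hqE⟩, rfl⟩
  have i2 : volume O ≤ ∫⁻ q in E, ENNReal.ofReal |tubeJac W q| := by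
    refine (measure_mono ?_).trans (h.volume_tube_image_le hEm (fun q hq => (hEΩ hq).1)
      fun q hq => hR q (hEΩ hq))
    intro z hz
    obtain ⟨q, hq, rfl⟩ := hO₂ hz
    exact ⟨q, ⟨hq, hz⟩, rfl⟩
  have i3 : ∫⁻ q in B.Ω, ENNReal.ofReal |tubeJac W q| ≤ volume (tube x t d '' B.Ω) := by
    rw [ofReal_integral_eq_lintegral_ofReal (B.integrableOn_tubeJac h.integrableOn) hJ] at hG
    refine le_trans (le_of_eq (lintegral_congr_ae ?_)) hG
    filter_upwards [hJ] with q hq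
    rw [abs_of_nonneg hq]
  have hfin : volume (tube x t d '' B.Ω) ≠ ⊤ :=
    (B.isCompact_domain.image_of_continuousOn (hc.mono hΩL)).measure_lt_top.ne
  have i4 : ∫⁻ q in B.Ω, ENNReal.ofReal |tubeJac W q| =
      (∫⁻ q in E, ENNReal.ofReal |tubeJac W q|) + ∫⁻ q in B.Ω \ E, ENNReal.ofReal |tubeJac W q| := by
    rw [← lintegral_inter_add_sdiff _ B.Ω hEm, inter_eq_self_of_subset_right hEΩ]
  -- The volume of `O` plus that of the whole image is at most the Jacobian integral over `Ω`, hence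
  -- at most the volume of the image; so the open set `O` is null.
  have i5 : volume O + volume (tube x t d '' B.Ω) ≤ 0 + volume (tube x t d '' B.Ω) := by
    rw [zero_add]
    calc _ ≤ _ := add_le_add i2 i1
      _ ≤ _ := by rw [← i4]; exact i3
  have i6 := (ENNReal.add_le_add_iff_right hfin).1 i5
  exact hO.measure_eq_zero_iff volume |>.1 (le_antisymm i6 zero_le)

/-- The midline of a globally injective rod has no self-contacts except possibly at its ends. -/
theorem midline_ne (h : Framing B.L W x t d) (hJ : 0 ≤ᵐ[volume.restrict B.Ω] tubeJac W)
    (hG : ENNReal.ofReal (∫ q in B.Ω, tubeJac W q) ≤ volume (tube x t d '' B.Ω)) {s s' : ℝ}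
    (hs : s ∈ Ioo 0 B.L) (hs' : s' ∈ Icc 0 B.L) (hne : s ≠ s') : x s ≠ x s' := by
  intro hx
  have hbox : ∀ {u r : ℝ}, u ∈ Ioo 0 B.L → 0 < r → ∃ r' > 0, r' ≤ r ∧ Metric.ball (u, (0 : ℝ), (0 : ℝ)) r' ⊆ B.Ω ∧
      ∃ η > 0, Metric.ball (x u) η ⊆ tube x t d '' Metric.ball (u, (0 : ℝ), (0 : ℝ)) r' := by
    intro u r hu hr
    obtain ⟨r₁, hr₁, hsub⟩ := Metric.isOpen_iff.1 isOpen_interior _ (B.midline_mem_interior u hu)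
    refine ⟨min r r₁, by positivity, min_le_left _ _,
      (Metric.ball_subset_ball (min_le_right _ _)).trans (hsub.trans interior_subset), ?_⟩
    obtain ⟨η, hη, hz⟩ := h.exists_ball_subset hu (r := min r r₁) (by positivity)
    refine ⟨η, hη, fun z hzb => ?_⟩
    obtain ⟨v, a, b, hv, -, ha, hb, e⟩ := hz z hzb
    refine ⟨(v, a, b), ?_, e⟩
    rw [Metric.mem_ball, Prod.dist_eq, Prod.dist_eq]
    simp only [Real.dist_eq, sub_zero]
    exact max_lt hv (max_lt ha hb)
  have hpos : 0 < |s - s'| := abs_pos.2 (sub_ne_zero.2 hne)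
  obtain ⟨r₁, hr₁, hr₁', hΩ₁, η₁, hη₁, hb₁⟩ := hbox hs (by positivity : 0 < |s - s'| / 4)
  have hxc := h.primitive_x.continuousOn B.L_pos.le
  -- `s'` may be an endpoint, around which no ball of material points is available. It is replaced
  -- by a nearby interior parameter `u` with `x u` still in the ball around `x s`.
  obtain ⟨u, hu, hus, hux⟩ : ∃ u ∈ Ioo 0 B.L, |u - s'| < |s - s'| / 4 ∧ x u ∈ Metric.ball (x s) η₁ := by
    have hcl : s' ∈ closure (Ioo 0 B.L) := by rwa [closure_Ioo B.L_pos.ne]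
    have hne' : (𝓝[Ioo 0 B.L] s').NeBot := mem_closure_iff_nhdsWithin_neBot.1 hcl
    have h1 : ∀ᶠ u in 𝓝[Ioo 0 B.L] s', x u ∈ Metric.ball (x s) η₁ := by
      refine ((hxc s' hs').mono Ioo_subset_Icc_self) (Metric.isOpen_ball.mem_nhds ?_)
      rw [hx]; exact Metric.mem_ball_self hη₁
    have h2 : ∀ᶠ u in 𝓝[Ioo 0 B.L] s', |u - s'| < |s - s'| / 4 :=
      nhdsWithin_le_nhds (Metric.ball_mem_nhds s' (by positivity))
    obtain ⟨u, hu1, hu2, hu3⟩ := (h1.and (h2.and self_mem_nhdsWithin)).exists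
    exact ⟨u, hu3, hu2, hu1⟩
  obtain ⟨r₂, hr₂, hr₂', hΩ₂, η₂, hη₂, hb₂⟩ := hbox hu (by positivity : 0 < |s - s'| / 4)
  have hdisj : Disjoint (Metric.ball (s, (0 : ℝ), (0 : ℝ)) r₁) (Metric.ball (u, (0 : ℝ), (0 : ℝ)) r₂) := by
    refine Metric.ball_disjoint_ball ?_
    have h1 : |s - s'| ≤ |s - u| + |u - s'| := abs_sub_le _ _ _
    have h2 : |s - u| ≤ dist (s, (0 : ℝ), (0 : ℝ)) (u, (0 : ℝ), (0 : ℝ)) := by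
      rw [Prod.dist_eq, ← Real.dist_eq]; exact le_max_left _ _
    linarith
  have hempty := not_overlap h hJ hG hΩ₁ hΩ₂ hdisj Metric.isOpen_ball
    (Metric.isOpen_ball.inter (Metric.isOpen_ball (x := x u) (ε := η₂)))
    (inter_subset_left.trans hb₁) (inter_subset_right.trans hb₂)
  have : x u ∈ (∅ : Set E3) := by rw [← hempty]; exact ⟨hux, Metric.mem_ball_self hη₂⟩
  exact this

end Rod

/-! ### The chord-arc estimate for closed embedded curves. -/

section ChordArc

variable {L : ℝ} {x t z z' : ℝ → E3}

/-- The distance between two parameters on the circle of length `L`. -/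
def arcDist (L s s' : ℝ) : ℝ := min |s - s'| (L - |s - s'|)

lemma arcDist_comm (L s s' : ℝ) : arcDist L s s' = arcDist L s' s := by
  rw [arcDist, arcDist, abs_sub_comm]

lemma arcDist_nonneg {s s' : ℝ} (hs : s ∈ Icc 0 L) (hs' : s' ∈ Icc 0 L) : 0 ≤ arcDist L s s' := by
  refine le_min (abs_nonneg _) (sub_nonneg.2 (abs_le.2 ⟨?_, ?_⟩)) <;> linarith [hs.1, hs.2, hs'.1, hs'.2]

/-- Chords of a closed curve are compared with `T`-translations along the shorter arc. -/
lemma IsPrimitive.norm_sub_le_arcDist (h : IsPrimitive L z z') (hz : z L = z 0) {ε : ℝ}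
    (hε : ∀ s ∈ Icc 0 L, ‖z' s‖ ≤ ε) {s s' : ℝ} (hs : s ∈ Icc 0 L) (hs' : s' ∈ Icc 0 L) :
    ‖z s - z s'‖ ≤ ε * arcDist L s s' := by
  have hL : 0 ≤ L := hs.1.trans hs.2
  have key : ∀ {a b : ℝ}, a ∈ Icc 0 L → b ∈ Icc 0 L → ‖z b - z a‖ ≤ ε * |b - a| := fun ha hb => by
    have := h.norm_sub_sub_smul_le (T := 0) (c := ε) ha hb
      fun r hr => by simpa using hε r (uIcc_subset_Icc ha hb hr)
    simpa using this
  wlog hle : s' ≤ s generalizing s s'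
  · rw [norm_sub_rev, arcDist_comm]; exact this hs' hs (le_of_not_ge hle)
  have hε0 : 0 ≤ ε := (norm_nonneg _).trans (hε s hs)
  rw [arcDist, mul_min_of_nonneg _ _ hε0]
  refine le_min (key hs' hs) ?_
  have k1 := key hs (⟨hL, le_rfl⟩ : L ∈ Icc 0 L)
  have k2 := key (⟨le_rfl, hL⟩ : (0 : ℝ) ∈ Icc 0 L) hs'
  have e : z s - z s' = -(z L - z s) - (z s' - z 0) := by rw [hz]; abel
  rw [e]
  refine (norm_sub_le _ _).trans ?_
  rw [norm_neg]
  rw [abs_of_nonneg (by linarith [hs.2])] at k1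
  rw [sub_zero, abs_of_nonneg hs'.1] at k2
  rw [abs_of_nonneg (by linarith)]
  linarith

/-- The chord-arc property of closed embedded `C¹` curves. -/
lemma exists_chordArc (hL : 0 < L) (h : IsPrimitive L x t) (ht : ContinuousOn t (Icc 0 L))
    (h1 : ∀ s ∈ Icc 0 L, ‖t s‖ = 1) (hx : x L = x 0) (htL : t L = t 0)
    (hinj : ∀ s ∈ Ioo 0 L, ∀ s' ∈ Icc 0 L, s ≠ s' → x s ≠ x s') :
    ∃ c > 0, ∀ s ∈ Icc 0 L, ∀ s' ∈ Icc 0 L, c * arcDist L s s' ≤ ‖x s - x s'‖ := by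
  have h0 : (0 : ℝ) ∈ Icc 0 L := ⟨le_rfl, hL.le⟩
  have hLm : L ∈ Icc 0 L := ⟨hL.le, le_rfl⟩
  obtain ⟨δ, hδ, hδt⟩ := Metric.uniformContinuousOn_iff.1
    (isCompact_Icc.uniformContinuousOn_of_continuous ht) (1 / 2) (by norm_num)
  have near : ∀ {a b T₀ : ℝ}, a ∈ Icc 0 L → b ∈ Icc 0 L → T₀ ∈ Icc 0 L →
      (∀ r ∈ uIcc a b, |r - T₀| < δ) → ‖x b - x a - (b - a) • t T₀‖ ≤ 1 / 2 * |b - a| :=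
    fun ha hb hT hr => h.norm_sub_sub_smul_le ha hb fun r hr' => by
      rw [← dist_eq_norm]
      exact (hδt r (uIcc_subset_Icc ha hb hr') _ hT (by rw [Real.dist_eq]; exact hr r hr')).le
  -- Pairs of parameters are close, or close across the closing point, or in the compact set `K`, on
  -- which injectivity makes the distance bounded below.
  set K : Set (ℝ × ℝ) := (Icc 0 L ×ˢ Icc 0 L) ∩ {q | δ ≤ |q.1 - q.2| ∧ |q.1 - q.2| ≤ L - δ}
  have hKc : IsCompact K := by
    refine (isCompact_Icc.prod isCompact_Icc).inter_right ?_
    have hab : Continuous fun q : ℝ × ℝ => |q.1 - q.2| := by fun_prop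
    exact (isClosed_le continuous_const hab).inter (isClosed_le hab continuous_const)
  have hxc := h.continuousOn hL.le
  have hKcont : ContinuousOn (fun q : ℝ × ℝ => ‖x q.1 - x q.2‖) K :=
    ((hxc.comp continuousOn_fst fun q hq => hq.1.1).sub
      (hxc.comp continuousOn_snd fun q hq => hq.1.2)).norm
  have hKpos : ∀ q ∈ K, 0 < ‖x q.1 - x q.2‖ := by
    rintro ⟨s, s'⟩ ⟨⟨hs, hs'⟩, hq1, hq2⟩
    simp only at hs hs' hq1 hq2
    have hne : s ≠ s' := fun e => by rw [e, sub_self, abs_zero] at hq1; linarith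
    rw [norm_pos_iff, sub_ne_zero]
    -- A pair with `|a - b| ≤ L - δ` cannot be `(0, L)`, so one of its members is interior, as
    -- `hinj` requires.
    have hI : ∀ {a b : ℝ}, a ∈ Icc 0 L → b ∈ Icc 0 L → a < b → |a - b| ≤ L - δ → x a ≠ x b := by
      intro a b ha hb hab hq
      rw [abs_sub_comm, abs_of_pos (by linarith)] at hq
      by_cases ha0 : a = 0
      · refine (hinj b ⟨by linarith [ha.1], by linarith⟩ a ha hab.ne').symm
      · exact hinj a ⟨lt_of_le_of_ne ha.1 (Ne.symm ha0), by linarith [hb.2]⟩ b hb hab.ne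
    rcases lt_or_gt_of_ne hne with hlt | hlt
    · exact hI hs hs' hlt hq2
    · exact (hI hs' hs hlt (by rwa [abs_sub_comm])).symm
  obtain ⟨m, hm, hmK⟩ : ∃ m > 0, ∀ q ∈ K, m ≤ ‖x q.1 - x q.2‖ := by
    rcases K.eq_empty_or_nonempty with hK | hK
    · exact ⟨1, one_pos, by simp [hK]⟩
    · obtain ⟨q, hq, hmin⟩ := hKc.exists_isMinOn hK hKcont
      exact ⟨_, hKpos q hq, fun q' hq' => hmin hq'⟩
  refine ⟨min (1 / 2) (m / L), by positivity, fun s hs s' hs' => ?_⟩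
  wlog hle : s' ≤ s generalizing s s'
  · rw [norm_sub_rev, arcDist_comm]; exact this s' hs' s hs (le_of_not_ge hle)
  have hnn := arcDist_nonneg hs hs'
  have habs : |s - s'| = s - s' := abs_of_nonneg (by linarith)
  by_cases c1 : |s - s'| < δ
  · have n1 := near hs' hs hs' fun r hr => (abs_sub_left_of_mem_uIcc hr).trans_lt c1
    have n2 : ‖(s - s') • t s'‖ = |s - s'| := by rw [norm_smul, h1 s' hs', mul_one, Real.norm_eq_abs]
    have n3 := norm_sub_norm_le ((s - s') • t s') (x s - x s')
    rw [norm_sub_rev ((s - s') • t s')] at n3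
    calc _ ≤ 1 / 2 * |s - s'| := mul_le_mul (min_le_left _ _) (min_le_left _ _) hnn (by norm_num)
      _ ≤ _ := by linarith
  by_cases c2 : L - |s - s'| < δ
  -- The short arc runs through the closing point. Since `t L = t 0`, its two pieces have nearly the
  -- same direction and their chords add up.
  · rw [habs] at c2
    have n1 := near hs hLm hLm fun r hr => by
      rw [uIcc_of_le hs.2] at hr
      rw [abs_sub_comm, abs_of_nonneg (by linarith [hr.2])]; linarith [hr.1, hs'.1]
    have n2 := near h0 hs' h0 fun r hr => by
      rw [uIcc_of_le hs'.1] at hr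
      rw [sub_zero, abs_of_nonneg hr.1]; linarith [hr.2, hs.2]
    have n3 : ‖(L - s + s') • t 0‖ = L - s + s' := by
      rw [norm_smul, h1 0 h0, mul_one, Real.norm_eq_abs, abs_of_nonneg (by linarith [hs.2, hs'.1])]
    rw [abs_of_nonneg (by linarith [hs.2]), htL] at n1
    rw [sub_zero, abs_of_nonneg hs'.1] at n2
    have e : (L - s + s') • t 0 = -(x s - x s') - ((x L - x s - (L - s) • t 0) + (x s' - x 0 - s' • t 0)) := by
      rw [hx]; module
    have n4 := norm_sub_le (-(x s - x s')) ((x L - x s - (L - s) • t 0) + (x s' - x 0 - s' • t 0))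
    rw [← e, n3, norm_neg] at n4
    have n5 := norm_add_le (x L - x s - (L - s) • t 0) (x s' - x 0 - s' • t 0)
    have hr : arcDist L s s' ≤ L - s + s' := (min_le_right _ _).trans (by rw [habs]; linarith)
    calc _ ≤ 1 / 2 * (L - s + s') := mul_le_mul (min_le_left _ _) hr hnn (by norm_num)
      _ ≤ _ := by linarith
  · have n1 := hmK (s, s') ⟨⟨hs, hs'⟩, not_lt.1 c1, by linarith [not_lt.1 c2]⟩
    have hr : arcDist L s s' ≤ L := (min_le_left _ _).trans (by rw [habs]; linarith [hs.2, hs'.1])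
    calc _ ≤ m / L * L := mul_le_mul (min_le_right _ _) hr hnn (by positivity)
      _ = m := by field_simp
      _ ≤ _ := n1

/-- The chord-arc property is stable under `C¹`-small perturbations. -/
lemma chordArc_of_close (h : IsPrimitive L x t) (h' : IsPrimitive L z z') (hx : x L = x 0)
    (hz : z L = z 0) {c : ℝ}
    (hc : ∀ s ∈ Icc 0 L, ∀ s' ∈ Icc 0 L, c * arcDist L s s' ≤ ‖x s - x s'‖)
    (hclose : ∀ s ∈ Icc 0 L, ‖z' s - t s‖ ≤ c / 2) {s s' : ℝ} (hs : s ∈ Icc 0 L) (hs' : s' ∈ Icc 0 L) :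
    c / 2 * arcDist L s s' ≤ ‖z s - z s'‖ := by
  have hd : IsPrimitive L (fun s => z s - x s) fun s => z' s - t s := by
    refine ⟨h'.integrableOn.sub h.integrableOn, fun s hs => ?_⟩
    have h0 : (0 : ℝ) ∈ Icc 0 L := ⟨le_rfl, hs.1.trans hs.2⟩
    rw [intervalIntegral.integral_sub (h'.intervalIntegrable h0 hs) (h.intervalIntegrable h0 hs),
      h'.eq_add s hs, h.eq_add s hs]
    abel
  have k1 := hd.norm_sub_le_arcDist (by rw [hx, hz]) hclose hs hs'
  have k2 := hc s hs s' hs'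
  have k3 := norm_sub_norm_le (x s - x s') (z s - z s')
  have e : x s - x s' - (z s - z s') = -(z s - x s - (z s' - x s')) := by abel
  rw [e, norm_neg] at k3
  linarith

end ChordArc

/-! ### Isotopies from small Lipschitz perturbations of the identity. -/

section Isotopy

variable {L : ℝ} {x₁ x₂ x₃ : ℝ → E3}

/-- The perturbation `τ • F` can shorten a distance by at most half of it. -/
lemma antilipschitz_id_add {F : E3 → E3} (hF : LipschitzWith (1 / 2) F) {τ : ℝ} (hτ : τ ∈ Icc (0 : ℝ) 1) :
    AntilipschitzWith 2 fun y => y + τ • F y := by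
  refine AntilipschitzWith.of_le_mul_dist fun y z => ?_
  have h1 := hF.dist_le_mul y z
  rw [dist_eq_norm, dist_eq_norm] at *
  have h2 := norm_sub_norm_le (y - z) (-(τ • (F y - F z)))
  have e : y - z - -(τ • (F y - F z)) = y + τ • F y - (z + τ • F z) := by module
  rw [e, norm_neg, norm_smul, Real.norm_eq_abs, abs_of_nonneg hτ.1] at h2
  have h3 : τ * ‖F y - F z‖ ≤ 1 * ‖F y - F z‖ := by gcongr; exact hτ.2
  simp only [NNReal.coe_div, NNReal.coe_one, NNReal.coe_ofNat] at h1 ⊢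
  linarith

lemma isEmbedding_id_add {F : E3 → E3} (hF : LipschitzWith (1 / 2) F) {τ : ℝ}
    (hτ : τ ∈ Icc (0 : ℝ) 1) : IsEmbedding fun y => y + τ • F y :=
  ((antilipschitz_id_add hF hτ).isUniformEmbedding
    (uniformContinuous_id.add (hF.uniformContinuous.const_smul τ))).isEmbedding

/-- A preimage of `z` is a fixed point of the contraction `y ↦ z - F y`. Surjectivity makes the
straight-line isotopy end in the whole of the next neighbourhood. -/
lemma surjective_id_add {F : E3 → E3} (hF : LipschitzWith (1 / 2) F) :
    Function.Surjective fun y => y + F y := by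
  intro z
  have hc : ContractingWith (1 / 2) fun y => z - F y := by
    refine ⟨by norm_num [← NNReal.coe_lt_coe], ?_⟩
    refine LipschitzWith.of_dist_le_mul fun a b => ?_
    rw [dist_sub_left]
    exact hF.dist_le_mul a b
  refine ⟨hc.fixedPoint, ?_⟩
  have := hc.fixedPoint_isFixedPt
  unfold Function.IsFixedPt at this
  simp only at this ⊢
  nth_rewrite 1 [← this]
  abel

/-- Precomposing an isotopy with the straight-line isotopy to `id + F` for contractive `F`. -/
lemma Isotopic.of_id_add {F : E3 → E3} (hF : LipschitzWith (1 / 2) F)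
    (h : ∀ s ∈ Icc 0 L, x₁ s + F (x₁ s) = x₂ s) (h' : Isotopic L x₂ x₃) : Isotopic L x₁ x₃ := by
  classical
  obtain ⟨N₁, N₂, Φ, hN₁, hN₂, hx₂, hx₃, hΦ, hemb, hid, himg, hcurve⟩ := h'
  have h1 : (1 : ℝ) ∈ Icc (0 : ℝ) 1 := ⟨zero_le_one, le_rfl⟩
  have hG : Continuous fun y => y + F y := continuous_id.add hF.continuous
  set M : Set E3 := (fun y => y + F y) ⁻¹' N₁
  have hx₁ : (fun y => y + F y) '' (x₁ '' Icc 0 L) = x₂ '' Icc 0 L := by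
    rw [image_image]; exact image_congr h
  have hM : (fun y => y + F y) '' M = N₁ := image_preimage_eq _ (surjective_id_add hF)
  -- The straight-line isotopy runs on `[0, 1/2]` and the given one on `[1/2, 1]`; they agree at
  -- `1/2` because `Φ (·, 0)` is the identity.
  refine ⟨M, N₂, fun q => if q.2 ≤ 1 / 2 then q.1 + (2 * q.2) • F q.1 else
    Φ (q.1 + F q.1, 2 * q.2 - 1), hN₁.preimage hG, hN₂, ?_, hx₃, ?_, ?_, ?_, ?_, ?_⟩
  · rw [← image_subset_iff, hx₁]; exact hx₂
  · refine ContinuousOn.if ?_ ?_ ?_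
    · rintro ⟨y, τ⟩ ⟨⟨hy, hτ⟩, hfr⟩
      have hτ2 : τ = 1 / 2 := by
        have := frontier_le_subset_eq (continuous_snd (X := E3) (Y := ℝ)) continuous_const hfr
        exact this
      subst hτ2
      have := hid _ hy
      norm_num
      exact this.symm
    · exact (continuous_fst.add ((continuous_const.mul continuous_snd).smul
        (hF.continuous.comp continuous_fst))).continuousOn
    · refine hΦ.comp ((hG.comp continuous_fst).prodMk (by fun_prop)).continuousOn ?_
      rintro ⟨y, τ⟩ ⟨⟨hy, hτ⟩, hcl⟩
      have h2 : 1 / 2 ≤ τ := by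
        have := closure_mono (t := {q : E3 × ℝ | 1 / 2 ≤ q.2}) (fun q hq => (not_le.1 hq).le) hcl
        rwa [(isClosed_le continuous_const continuous_snd).closure_eq] at this
      exact ⟨hy, by simp only; linarith, by simp only; linarith [hτ.2]⟩
  · intro τ hτ
    by_cases hτ2 : τ ≤ 1 / 2
    · simp only [hτ2, if_true]
      exact (isEmbedding_id_add hF ⟨by linarith [hτ.1], by linarith⟩).comp IsEmbedding.subtypeVal
    · simp only [hτ2, if_false]
      have e1 := hemb (2 * τ - 1) ⟨by linarith [not_le.1 hτ2], by linarith [hτ.2]⟩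
      have e2 : IsEmbedding fun y : M => (⟨y + F y, y.2⟩ : N₁) := by
        have := (isEmbedding_id_add hF h1).comp (IsEmbedding.subtypeVal (p := (· ∈ M)))
        simp only [one_smul] at this
        exact this.codRestrict _ _
      exact e1.comp e2
  · intro y hy
    norm_num
  · have e : (fun y => if ((1 : ℝ) ≤ 1 / 2) then y + (2 * (1 : ℝ)) • F y else Φ (y + F y, 2 * 1 - 1))
        = (fun y => Φ (y, 1)) ∘ fun y => y + F y := by
      funext y; norm_num
    simp only
    rw [e, image_comp, hM, himg]
  · have e : (fun y => if ((1 : ℝ) ≤ 1 / 2) then y + (2 * (1 : ℝ)) • F y else Φ (y + F y, 2 * 1 - 1))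
        = (fun y => Φ (y, 1)) ∘ fun y => y + F y := by
      funext y; norm_num
    simp only
    rw [e, image_comp, hx₁, hcurve]

/-- Curves that are `C¹`-close to a closed embedded `C¹` curve have the same knot type. -/
lemma exists_isotopic_of_close {x t : ℝ → E3} (h : IsPrimitive L x t) (hx : x L = x 0) {c : ℝ}
    (hc0 : 0 < c) (hc : ∀ s ∈ Icc 0 L, ∀ s' ∈ Icc 0 L, c * arcDist L s s' ≤ ‖x s - x s'‖) :
    ∃ ε > 0, ∀ {z z' : ℝ → E3}, IsPrimitive L z z' → z L = z 0 →
      (∀ s ∈ Icc 0 L, ‖z' s - t s‖ ≤ ε) → ∀ {ℓ : ℝ → E3}, Isotopic L z ℓ → Isotopic L x ℓ := by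
  -- Extending a Lipschitz map from a subset of the space may enlarge its constant by the factor
  -- `C`; the closeness `c / (2 C)` leaves 1/2 after the extension.
  set C := lipschitzExtensionConstant E3
  have hC : 0 < C := lipschitzExtensionConstant_pos E3
  refine ⟨c / (2 * C), by positivity, fun {z z'} hz hzL hclose ℓ hℓ => ?_⟩
  have hd : IsPrimitive L (fun s => z s - x s) fun s => z' s - t s := by
    refine ⟨hz.integrableOn.sub h.integrableOn, fun s hs => ?_⟩
    have h0 : (0 : ℝ) ∈ Icc 0 L := ⟨le_rfl, hs.1.trans hs.2⟩
    rw [intervalIntegral.integral_sub (hz.intervalIntegrable h0 hs) (h.intervalIntegrable h0 hs),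
      hz.eq_add s hs, h.eq_add s hs]
    abel
  have key : ∀ s ∈ Icc 0 L, ∀ s' ∈ Icc 0 L,
      ‖z s - x s - (z s' - x s')‖ ≤ 1 / (2 * C) * ‖x s - x s'‖ := fun s hs s' hs' =>
    calc _ ≤ c / (2 * C) * arcDist L s s' := hd.norm_sub_le_arcDist (by rw [hx, hzL]) hclose hs hs'
      _ = 1 / (2 * C) * (c * arcDist L s s') := by ring
      _ ≤ _ := by have := hc s hs s' hs'; gcongr
  -- The displacement `z - x` is needed as a function of the point `x s`, so `g` chooses a
  -- parameter. By `key` the displacement is the same for all parameters of one point.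
  set g := Function.invFunOn x (Icc 0 L)
  have hl : LipschitzOnWith (1 / (2 * C)) (fun y => z (g y) - x (g y)) (x '' Icc 0 L) := by
    refine LipschitzOnWith.of_dist_le_mul fun a ha b hb => ?_
    have := key _ (Function.invFunOn_mem ha) _ (Function.invFunOn_mem hb)
    rw [← dist_eq_norm (x _), Function.invFunOn_eq ha, Function.invFunOn_eq hb] at this
    rw [dist_eq_norm]
    simp only [g, Function.invFunOn_eq ha, Function.invFunOn_eq hb]
    simpa using this
  obtain ⟨F, hF, hFe⟩ := hl.extend_finite_dimension
  have e : lipschitzExtensionConstant E3 * (1 / (2 * C)) = 1 / 2 := by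
    change C * (1 / (2 * C)) = 1 / 2
    field_simp
  rw [e] at hF
  refine Isotopic.of_id_add hF (fun s hs => ?_) hℓ
  have hxs : x s ∈ x '' Icc 0 L := mem_image_of_mem x hs
  rw [← hFe hxs]
  have := key s hs _ (Function.invFunOn_mem hxs)
  rw [Function.invFunOn_eq hxs, sub_self, norm_zero, mul_zero] at this
  have h2 := sub_eq_zero.1 (norm_le_zero_iff.1 this)
  simp only [g]
  rw [Function.invFunOn_eq hxs, ← h2]
  abel

end Isotopy

/-! ### The Gauss kernel and its derivative along closed curves. -/

section GaussKernel

/-- The Gauss kernel `v · (p × q) / |v|³`. -/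
def gauss (v p q : E3) : ℝ := inner ℝ v (cross p q) / ‖v‖ ^ 3

/-- The derivative of the Gauss kernel in its first argument in the direction `h`. -/
def dgauss (v p q h : E3) : ℝ :=
  inner ℝ h (cross p q) / ‖v‖ ^ 3 - 3 * inner ℝ v h * inner ℝ v (cross p q) / ‖v‖ ^ 5

lemma gauss_add (v p q r : E3) : gauss v p (q + r) = gauss v p q + gauss v p r := by
  simp only [gauss, inner_eq_sum, cross_apply_zero, cross_apply_one, cross_apply_two, PiLp.add_apply]
  ring

lemma gauss_smul (v p q : E3) (c : ℝ) : gauss v p (c • q) = c * gauss v p q := by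
  simp only [gauss, inner_eq_sum, cross_apply_zero, cross_apply_one, cross_apply_two,
    PiLp.smul_apply, smul_eq_mul]
  ring

/-- The one-form `q ↦ gauss v p q` is closed up to a derivative along `p`. -/
lemma dgauss_neg (v p q h : E3) (hv : v ≠ 0) :
    dgauss v p q (-h) = dgauss v p h (-q) - dgauss v h q p := by
  have hv' : ‖v‖ ≠ 0 := norm_ne_zero_iff.2 hv
  -- Over the common denominator `‖v‖ ^ 5` a polynomial identity remains. It says that `G v = v /
  -- ‖v‖ ^ 3` has divergence zero: the cyclic sum of `DG[h] · (p × q)` is the trace of `DG` times a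
  -- determinant.
  have e : ∀ c : ℝ, c / ‖v‖ ^ 3 = c * ‖v‖ ^ 2 / ‖v‖ ^ 5 := fun c => by field_simp
  simp only [dgauss, e]
  rw [← sub_div, ← sub_div, ← sub_div, ← sub_div]
  congr 1
  rw [norm_sq_eq_sum]
  simp only [inner_eq_sum, cross_apply_zero, cross_apply_one, cross_apply_two, PiLp.neg_apply]
  ring

lemma abs_gauss_le {v p q : E3} {m : ℝ} (hm : 0 < m) (hv : m ≤ ‖v‖) :
    |gauss v p q| ≤ ‖p‖ * ‖q‖ / m ^ 2 := by
  have hv0 : 0 < ‖v‖ := hm.trans_le hv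
  rw [gauss, abs_div, abs_of_pos (by positivity : 0 < ‖v‖ ^ 3)]
  calc |inner ℝ v (cross p q)| / ‖v‖ ^ 3 ≤ ‖v‖ * (‖p‖ * ‖q‖) / ‖v‖ ^ 3 := by
        gcongr
        exact (abs_real_inner_le_norm _ _).trans (by gcongr; exact norm_cross_le _ _)
    _ = ‖p‖ * ‖q‖ / ‖v‖ ^ 2 := by field_simp
    _ ≤ _ := by gcongr

lemma abs_dgauss_le {v p q h : E3} {m : ℝ} (hm : 0 < m) (hv : m ≤ ‖v‖) :
    |dgauss v p q h| ≤ 4 * (‖p‖ * ‖q‖ * ‖h‖) / m ^ 3 := by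
  have hv0 : 0 < ‖v‖ := hm.trans_le hv
  have h1 : |inner ℝ h (cross p q) / ‖v‖ ^ 3| ≤ ‖p‖ * ‖q‖ * ‖h‖ / ‖v‖ ^ 3 := by
    rw [abs_div, abs_of_pos (by positivity : 0 < ‖v‖ ^ 3)]
    gcongr
    calc _ ≤ ‖h‖ * ‖cross p q‖ := abs_real_inner_le_norm _ _
      _ ≤ ‖h‖ * (‖p‖ * ‖q‖) := by gcongr; exact norm_cross_le _ _
      _ = _ := by ring
  have h2 : |3 * inner ℝ v h * inner ℝ v (cross p q) / ‖v‖ ^ 5| ≤ 3 * (‖p‖ * ‖q‖ * ‖h‖) / ‖v‖ ^ 3 := by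
    rw [abs_div, abs_of_pos (by positivity : 0 < ‖v‖ ^ 5), abs_mul, abs_mul, abs_of_pos (by norm_num : (0 : ℝ) < 3)]
    calc _ ≤ 3 * (‖v‖ * ‖h‖) * (‖v‖ * (‖p‖ * ‖q‖)) / ‖v‖ ^ 5 := by
          gcongr
          · exact abs_real_inner_le_norm _ _
          · exact (abs_real_inner_le_norm _ _).trans (by gcongr; exact norm_cross_le _ _)
      _ = _ := by field_simp
  calc _ ≤ ‖p‖ * ‖q‖ * ‖h‖ / ‖v‖ ^ 3 + 3 * (‖p‖ * ‖q‖ * ‖h‖) / ‖v‖ ^ 3 :=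
        (abs_sub _ _).trans (add_le_add h1 h2)
    _ = 4 * (‖p‖ * ‖q‖ * ‖h‖) / ‖v‖ ^ 3 := by ring
    _ ≤ _ := by gcongr

lemma measurable_gauss : Measurable fun z : E3 × E3 × E3 => gauss z.1 z.2.1 z.2.2 := by
  have hc : Continuous fun z : E3 × E3 × E3 => cross z.2.1 z.2.2 :=
    (continuous_fst.comp continuous_snd).cross (continuous_snd.comp continuous_snd)
  exact (continuous_fst.inner hc).measurable.div (continuous_fst.norm.pow 3).measurable

lemma measurable_dgauss :
    Measurable fun z : E3 × E3 × E3 × E3 => dgauss z.1 z.2.1 z.2.2.1 z.2.2.2 := by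
  have hc : Continuous fun z : E3 × E3 × E3 × E3 => cross z.2.1 z.2.2.1 :=
    (continuous_fst.comp continuous_snd).cross
      (continuous_fst.comp (continuous_snd.comp continuous_snd))
  have hh : Continuous fun z : E3 × E3 × E3 × E3 => z.2.2.2 := by fun_prop
  exact ((hh.inner hc).measurable.div (continuous_fst.norm.pow 3).measurable).sub
    (((continuous_const.mul (continuous_fst.inner hh)).mul (continuous_fst.inner hc)).measurable.div
      (continuous_fst.norm.pow 5).measurable)

lemma hasDerivAt_gauss {v q : ℝ → E3} {v' q' p : E3} {τ : ℝ} (hv : HasDerivAt v v' τ)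
    (hq : HasDerivAt q q' τ) (h0 : v τ ≠ 0) :
    HasDerivAt (fun r => gauss (v r) p (q r))
      (dgauss (v τ) p (q τ) v' + gauss (v τ) p q') τ := by
  have hv0 : 0 < ‖v τ‖ := norm_pos_iff.2 h0
  have h1 := hv.inner ℝ ((hasDerivAt_const τ p).cross hq)
  have h2 : HasDerivAt (fun r => ‖v r‖) (inner ℝ (v τ) v' / ‖v τ‖) τ := by
    have := (hv.norm_sq).sqrt (by positivity)
    simp only [Real.sqrt_sq (norm_nonneg _)] at this
    convert this using 1
    field_simp
  have h3 := h1.div (h2.pow 3) (by simp only [Pi.pow_apply]; positivity)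
  refine h3.congr_deriv ?_
  have hz : cross 0 (q τ) = 0 := by apply E3.ext <;> simp
  simp only [dgauss, gauss, Pi.pow_apply, hz, add_zero]
  field_simp
  push_cast
  ring

lemma _root_.AbsolutelyContinuousOnInterval.inv_norm {v : ℝ → E3} {b c m : ℝ}
    (hv : AbsolutelyContinuousOnInterval v b c) (hm : 0 < m) (h : ∀ r ∈ uIcc b c, m ≤ ‖v r‖) :
    AbsolutelyContinuousOnInterval (fun r => ‖v r‖⁻¹) b c := by
  refine hv.of_dist_le (K := 1 / m ^ 2) fun r hr s hs => ?_
  have hr' := h r hr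
  have hs' := h s hs
  have hr0 : 0 < ‖v r‖ := hm.trans_le hr'
  have hs0 : 0 < ‖v s‖ := hm.trans_le hs'
  rw [Real.dist_eq, inv_sub_inv hr0.ne' hs0.ne', abs_div, abs_of_pos (by positivity : 0 < ‖v r‖ * ‖v s‖),
    abs_sub_comm, dist_eq_norm]
  calc _ ≤ ‖v r - v s‖ / (m * m) := by
        gcongr
        exact abs_norm_sub_norm_le _ _
    _ = _ := by ring

lemma _root_.AbsolutelyContinuousOnInterval.gauss {v q : ℝ → E3} {b c m : ℝ} (p : E3)
    (hv : AbsolutelyContinuousOnInterval v b c) (hq : AbsolutelyContinuousOnInterval q b c)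
    (hm : 0 < m) (h : ∀ r ∈ uIcc b c, m ≤ ‖v r‖) :
    AbsolutelyContinuousOnInterval (fun r => KirchhoffRod.gauss (v r) p (q r)) b c := by
  have h1 := hv.realInner ((absolutelyContinuous_const p b c).cross hq)
  have h2 := hv.inv_norm hm h
  have h3 := h1.mul ((h2.mul h2).mul h2)
  refine h3.of_dist_le (K := 1) fun r _ s _ => le_of_eq ?_
  have e : ∀ r, KirchhoffRod.gauss (v r) p (q r) = ((fun s => inner ℝ (v s) (KirchhoffRod.cross p (q s))) *
      ((fun r => ‖v r‖⁻¹) * (fun r => ‖v r‖⁻¹) * fun r => ‖v r‖⁻¹)) r := fun r => by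
    simp only [KirchhoffRod.gauss, Pi.mul_apply, div_eq_mul_inv]
    rw [pow_succ, pow_two, mul_inv, mul_inv]
  rw [e, e, one_mul]

/-- The derivative of the Gauss kernel along a closed curve has integral zero. -/
lemma integral_deriv_gauss_eq_zero {M m : ℝ} (hM : 0 ≤ M) {v v' q q' : ℝ → E3} {p : E3}
    (hv : IsPrimitive M v v') (hq : IsPrimitive M q q') (hvc : v M = v 0) (hqc : q M = q 0)
    (hm : 0 < m) (h : ∀ r ∈ Icc 0 M, m ≤ ‖v r‖)
    (hi : Integrable (fun r => dgauss (v r) p (q r) (v' r) + gauss (v r) p (q' r)) (arcMeasure M)) :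
    ∫ r, (dgauss (v r) p (q r) (v' r) + gauss (v r) p (q' r)) ∂(arcMeasure M) = 0 := by
  have hu : uIcc 0 M = Icc 0 M := uIcc_of_le hM
  have h1 := AbsolutelyContinuousOnInterval.integral_eq_sub
    ((hv.absolutelyContinuous hM).gauss p (hq.absolutelyContinuous hM) hm (by rwa [hu]))
    (f' := fun r => dgauss (v r) p (q r) (v' r) + gauss (v r) p (q' r)) (by
      filter_upwards [hv.ae_hasDerivAt hM, hq.ae_hasDerivAt hM] with r h1 h2 hr
      rw [hu] at hr
      exact hasDerivAt_gauss (h1 hr) (h2 hr) (norm_pos_iff.1 (hm.trans_le (h r hr))))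
    (IsPrimitive.intervalIntegrable_of (L := M) hi ⟨le_rfl, hM⟩ ⟨hM, le_rfl⟩)
  rw [hvc, hqc, sub_self, intervalIntegral.integral_of_le hM] at h1
  rw [arcMeasure, integral_Icc_eq_integral_Ioc, h1]

end GaussKernel

/-! ### Invariance of the Gauss integral under variation of one curve. -/

section LinkingConstant

variable {ℓ M : ℝ} {a a' X X' D D' : ℝ → E3}

lemma ae_prod_mem (ℓ M : ℝ) :
    ∀ᵐ q ∂((arcMeasure ℓ).prod (arcMeasure M)), q.1 ∈ Icc 0 ℓ ∧ q.2 ∈ Icc 0 M := by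
  rw [arcMeasure, arcMeasure, Measure.prod_restrict]
  exact ae_restrict_mem (measurableSet_Icc.prod measurableSet_Icc)

lemma IsPrimitive.aemeasurable {f f' : ℝ → E3} (h : IsPrimitive M f f') (hM : 0 ≤ M) :
    AEMeasurable f (arcMeasure M) :=
  (h.continuousOn hM).aemeasurable measurableSet_Icc

lemma IsPrimitive.add_smul {X X' D D' : ℝ → E3} (hX : IsPrimitive M X X') (hD : IsPrimitive M D D')
    (ε : ℝ) : IsPrimitive M (fun u => X u + ε • D u) fun u => X' u + ε • D' u := by
  refine ⟨hX.integrableOn.add (hD.integrableOn.smul ε), fun s hs => ?_⟩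
  have h0 : (0 : ℝ) ∈ Icc 0 M := ⟨le_rfl, hs.1.trans hs.2⟩
  have h1 := hX.eq_add s hs
  have h2 := hD.eq_add s hs
  have h3 : ∫ r in (0 : ℝ)..s, (X' r + ε • D' r) =
      (∫ r in (0 : ℝ)..s, X' r) + ε • ∫ r in (0 : ℝ)..s, D' r := by
    rw [← intervalIntegral.integral_smul]
    exact intervalIntegral.integral_add (hX.intervalIntegrable h0 hs)
      ((hD.intervalIntegrable h0 hs).smul ε)
  rw [h3, h1, h2]
  module

lemma IsPrimitive.const_sub {f f' : ℝ → E3} (h : IsPrimitive M f f') (c : E3) :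
    IsPrimitive M (fun u => c - f u) fun u => -f' u := by
  refine ⟨h.integrableOn.neg, fun s hs => ?_⟩
  have h3 : ∫ r in (0 : ℝ)..s, -f' r = -∫ r in (0 : ℝ)..s, f' r := intervalIntegral.integral_neg
  rw [h3, h.eq_add s hs]
  abel

lemma IsPrimitive.sub_const {f f' : ℝ → E3} (h : IsPrimitive M f f') (c : E3) :
    IsPrimitive M (fun u => f u - c) f' := by
  refine ⟨h.integrableOn, fun s hs => ?_⟩
  rw [h.eq_add s hs]
  abel

lemma isPrimitive_const (c : E3) : IsPrimitive M (fun _ => c) fun _ => 0 :=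
  ⟨integrableOn_zero, fun s _ => by simp⟩

lemma _root_.AEMeasurable.gauss {α : Type*} [MeasurableSpace α] {μ : Measure α} {v p q : α → E3}
    (hv : AEMeasurable v μ) (hp : AEMeasurable p μ) (hq : AEMeasurable q μ) :
    AEMeasurable (fun z => KirchhoffRod.gauss (v z) (p z) (q z)) μ :=
  measurable_gauss.comp_aemeasurable (f := fun z => (v z, p z, q z)) (hv.prodMk (hp.prodMk hq))

lemma _root_.AEMeasurable.dgauss {α : Type*} [MeasurableSpace α] {μ : Measure α} {v p q h : α → E3}
    (hv : AEMeasurable v μ) (hp : AEMeasurable p μ) (hq : AEMeasurable q μ) (hh : AEMeasurable h μ) :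
    AEMeasurable (fun z => KirchhoffRod.dgauss (v z) (p z) (q z) (h z)) μ :=
  measurable_dgauss.comp_aemeasurable (f := fun z => (v z, p z, q z, h z))
    (hv.prodMk (hp.prodMk (hq.prodMk hh)))

/-- The Gauss integral of two curves with prescribed derivatives. -/
def gaussIntegral (ℓ M : ℝ) (a a' b b' : ℝ → E3) : ℝ :=
  ∫ q, gauss (a q.1 - b q.2) (a' q.1) (b' q.2) ∂((arcMeasure ℓ).prod (arcMeasure M))

lemma aemeasurable_gauss_curves (ha : AEMeasurable a (arcMeasure ℓ)) (ha' : AEMeasurable a' (arcMeasure ℓ))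
    {b q : ℝ → E3} (hb : AEMeasurable b (arcMeasure M)) (hq : AEMeasurable q (arcMeasure M)) :
    AEMeasurable (fun z : ℝ × ℝ => gauss (a z.1 - b z.2) (a' z.1) (q z.2))
      ((arcMeasure ℓ).prod (arcMeasure M)) :=
  (ha.comp_fst.sub hb.comp_snd).gauss ha'.comp_fst hq.comp_snd

lemma integrable_gauss_curves (ha : AEMeasurable a (arcMeasure ℓ)) (ha' : Integrable a' (arcMeasure ℓ))
    {b q : ℝ → E3} (hb : AEMeasurable b (arcMeasure M)) (hq : Integrable q (arcMeasure M)) {m : ℝ}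
    (hm : 0 < m) (h : ∀ s ∈ Icc 0 ℓ, ∀ u ∈ Icc 0 M, m ≤ ‖a s - b u‖) :
    Integrable (fun z : ℝ × ℝ => gauss (a z.1 - b z.2) (a' z.1) (q z.2))
      ((arcMeasure ℓ).prod (arcMeasure M)) := by
  refine ((ha'.norm.mul_prod hq.norm).div_const (m ^ 2)).mono'
    (aemeasurable_gauss_curves ha ha'.1.aemeasurable hb hq.1.aemeasurable).aestronglyMeasurable ?_
  filter_upwards [ae_prod_mem ℓ M] with z hz
  exact abs_gauss_le hm (h _ hz.1 _ hz.2)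

lemma abs_dgauss_add_gauss_le {v p q h q' : E3} {m C β : ℝ} (hm : 0 < m) (hv : m ≤ ‖v‖) (hh : ‖h‖ ≤ C)
    (hq : ‖q‖ ≤ β) (hq' : ‖q'‖ ≤ β) :
    |dgauss v p q (-h) + gauss v p q'| ≤ (4 * C / m ^ 3 + 1 / m ^ 2) * (‖p‖ * β) := by
  have hβ0 : 0 ≤ β := (norm_nonneg _).trans hq
  have h1 := abs_dgauss_le (p := p) (q := q) (h := -h) hm hv
  have h2 := abs_gauss_le (p := p) (q := q') hm hv
  rw [norm_neg] at h1
  calc _ ≤ _ := abs_add_le _ _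
    _ ≤ 4 * (‖p‖ * β * C) / m ^ 3 + ‖p‖ * β / m ^ 2 := by
        refine add_le_add (h1.trans ?_) (h2.trans ?_) <;> gcongr
    _ = _ := by ring

lemma abs_dgauss_add_gauss_le' {v p q h q' : E3} {m C β : ℝ} (hm : 0 < m) (hv : m ≤ ‖v‖) (hh : ‖h‖ ≤ C)
    (hq : ‖q‖ ≤ β) (hq' : ‖q'‖ ≤ β) :
    |dgauss v p h (-q) + gauss v p q'| ≤ (4 * C / m ^ 3 + 1 / m ^ 2) * (‖p‖ * β) := by
  have hC0 : 0 ≤ C := (norm_nonneg _).trans hh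
  have h1 := abs_dgauss_le (p := p) (q := h) (h := -q) hm hv
  have h2 := abs_gauss_le (p := p) (q := q') hm hv
  rw [norm_neg] at h1
  calc _ ≤ _ := abs_add_le _ _
    _ ≤ 4 * (‖p‖ * C * β) / m ^ 3 + ‖p‖ * β / m ^ 2 := by
        refine add_le_add (h1.trans ?_) (h2.trans ?_) <;> gcongr
    _ = _ := by ring

lemma exists_pos_le_norm_sub (hℓ : 0 ≤ ℓ) (hM : 0 ≤ M) (ha : ContinuousOn a (Icc 0 ℓ))
    (hX : ContinuousOn X (Icc 0 M)) (hD : ContinuousOn D (Icc 0 M)) {α β : ℝ} (hαβ : α ≤ β)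
    (hne : ∀ η ∈ Icc α β, ∀ s ∈ Icc 0 ℓ, ∀ u ∈ Icc 0 M, a s ≠ X u + η • D u) :
    ∃ m > 0, ∀ η ∈ Icc α β, ∀ s ∈ Icc 0 ℓ, ∀ u ∈ Icc 0 M, m ≤ ‖a s - (X u + η • D u)‖ := by
  set K : Set (ℝ × ℝ × ℝ) := Icc α β ×ˢ (Icc 0 ℓ ×ˢ Icc 0 M)
  have hK : IsCompact K := isCompact_Icc.prod (isCompact_Icc.prod isCompact_Icc)
  have hKn : K.Nonempty := ⟨(α, 0, 0), ⟨le_rfl, hαβ⟩, ⟨le_rfl, hℓ⟩, le_rfl, hM⟩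
  have hf1 : ContinuousOn (fun z : ℝ × ℝ × ℝ => a z.2.1) K := ha.comp (by fun_prop) fun z hz => hz.2.1
  have hf2 : ContinuousOn (fun z : ℝ × ℝ × ℝ => X z.2.2) K := hX.comp (by fun_prop) fun z hz => hz.2.2
  have hf3 : ContinuousOn (fun z : ℝ × ℝ × ℝ => D z.2.2) K := hD.comp (by fun_prop) fun z hz => hz.2.2
  obtain ⟨z, hz, hzmin⟩ := hK.exists_isMinOn hKn (hf1.sub (hf2.add (continuousOn_fst.smul hf3))).norm
  exact ⟨_, norm_pos_iff.2 (sub_ne_zero.2 (hne z.1 hz.1 _ hz.2.1 _ hz.2.2)),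
    fun η hη s hs u hu => hzmin (a := (η, s, u)) ⟨hη, hs, hu⟩⟩

/-- The derivative of the Gauss integral under a variation `D` of the second curve vanishes. -/
lemma integral_variation_gauss_eq_zero (hℓ : 0 ≤ ℓ) (hM : 0 ≤ M) {b b' : ℝ → E3}
    (ha : IsPrimitive ℓ a a') (hb : IsPrimitive M b b') (hD : IsPrimitive M D D')
    (hac : a ℓ = a 0) (hbc : b M = b 0) (hDc : D M = D 0) {m : ℝ} (hm : 0 < m)
    (hmin : ∀ s ∈ Icc 0 ℓ, ∀ u ∈ Icc 0 M, m ≤ ‖a s - b u‖)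
    (hi : Integrable (fun z : ℝ × ℝ => dgauss (a z.1 - b z.2) (a' z.1) (b' z.2) (-D z.2) +
      gauss (a z.1 - b z.2) (a' z.1) (D' z.2)) ((arcMeasure ℓ).prod (arcMeasure M))) :
    ∫ z, (dgauss (a z.1 - b z.2) (a' z.1) (b' z.2) (-D z.2) +
      gauss (a z.1 - b z.2) (a' z.1) (D' z.2)) ∂((arcMeasure ℓ).prod (arcMeasure M)) = 0 := by
  obtain ⟨C, hC⟩ := isCompact_Icc.exists_bound_of_continuousOn (hD.continuousOn hM)
  have ham := ha.aemeasurable hℓ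
  have ham' : AEMeasurable a' (arcMeasure ℓ) := ha.integrableOn.1.aemeasurable
  have hbm := hb.aemeasurable hM
  have hbm' : AEMeasurable b' (arcMeasure M) := hb.integrableOn.1.aemeasurable
  have hDm := hD.aemeasurable hM
  have hDm' : AEMeasurable D' (arcMeasure M) := hD.integrableOn.1.aemeasurable
  have hvm : AEMeasurable (fun z : ℝ × ℝ => a z.1 - b z.2) ((arcMeasure ℓ).prod (arcMeasure M)) :=
    ham.comp_fst.sub hbm.comp_snd
  have hPi : Integrable (fun z : ℝ × ℝ => dgauss (a z.1 - b z.2) (a' z.1) (D z.2) (-b' z.2) +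
      gauss (a z.1 - b z.2) (a' z.1) (D' z.2)) ((arcMeasure ℓ).prod (arcMeasure M)) := by
    have hbd : Integrable (fun z : ℝ × ℝ => (4 * C / m ^ 3 + 1 / m ^ 2) * (‖a' z.1‖ *
        (‖b' z.2‖ + ‖D' z.2‖))) ((arcMeasure ℓ).prod (arcMeasure M)) :=
      (ha.integrableOn.norm.mul_prod (hb.integrableOn.norm.add hD.integrableOn.norm)).const_mul _
    refine hbd.mono' ((hvm.dgauss ham'.comp_fst hDm.comp_snd hbm'.comp_snd.neg).add
      (hvm.gauss ham'.comp_fst hDm'.comp_snd)).aestronglyMeasurable ?_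
    filter_upwards [ae_prod_mem ℓ M] with z hz
    exact abs_dgauss_add_gauss_le' hm (hmin _ hz.1 _ hz.2) (hC _ hz.2)
      (by linarith [norm_nonneg (D' z.2)]) (by linarith [norm_nonneg (b' z.2)])
  have hg0 : ∀ v p : E3, gauss v p 0 = 0 := fun v p => by simpa using gauss_smul v p 0 0
  -- The variation of the integrand is the derivative in `u` of `gauss (a - b) a' D` minus the
  -- derivative in `s` of `gauss (a - b) D b'`. By Fubini each of the two integrates to zero along a
  -- closed curve.
  have hsplit : ∀ᵐ z ∂((arcMeasure ℓ).prod (arcMeasure M)),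
      dgauss (a z.1 - b z.2) (D z.2) (b' z.2) (a' z.1) + gauss (a z.1 - b z.2) (D z.2) 0 =
      (dgauss (a z.1 - b z.2) (a' z.1) (D z.2) (-b' z.2) + gauss (a z.1 - b z.2) (a' z.1) (D' z.2)) -
      (dgauss (a z.1 - b z.2) (a' z.1) (b' z.2) (-D z.2) + gauss (a z.1 - b z.2) (a' z.1) (D' z.2)) := by
    filter_upwards [ae_prod_mem ℓ M] with z hz
    rw [hg0, dgauss_neg _ (a' z.1) (b' z.2) (D z.2) (norm_pos_iff.1 (hm.trans_le (hmin _ hz.1 _ hz.2)))]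
    ring
  have hQi := (hPi.sub hi).congr (hsplit.mono fun z hz => hz.symm)
  have h1 := integral_prod _ hPi
  rw [integral_eq_zero_of_ae (f := fun s => ∫ u, _ ∂(arcMeasure M)) (by
    filter_upwards [hPi.prod_right_ae, ae_restrict_mem measurableSet_Icc] with s hs hsI
    exact integral_deriv_gauss_eq_zero hM (hb.const_sub (a s)) hD
      (by rw [hbc]) hDc hm (hmin s hsI) hs)] at h1
  have h2 := integral_prod_symm _ hQi
  rw [integral_eq_zero_of_ae (f := fun u => ∫ s, _ ∂(arcMeasure ℓ)) (by
    filter_upwards [hQi.prod_left_ae, ae_restrict_mem measurableSet_Icc] with u hu huI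
    exact integral_deriv_gauss_eq_zero hℓ (ha.sub_const (b u)) (isPrimitive_const (b' u))
      (by rw [hac]) rfl hm (fun s hs => hmin s hs u huI) hu)] at h2
  rw [integral_congr_ae hsplit, integral_sub hPi hi, h1, zero_sub, neg_eq_zero] at h2
  exact h2

/-- Differentiation under the integral sign, with a multiple of `‖a'‖ β` as majorant; the result is
the variation that vanishes. The bound `m` near `ε` keeps the kernel away from its singularity. -/
lemma hasDerivAt_gaussIntegral_family (hℓ : 0 ≤ ℓ) (hM : 0 ≤ M) (ha : IsPrimitive ℓ a a')
    {b b' : ℝ → ℝ → E3} (hb : ∀ η, IsPrimitive M (b η) (b' η)) (hD : IsPrimitive M D D')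
    (hbd : ∀ η u, HasDerivAt (fun η => b η u) (D u) η)
    (hbd' : ∀ η u, HasDerivAt (fun η => b' η u) (D' u) η) (hac : a ℓ = a 0)
    (hbc : ∀ η, b η M = b η 0) (hDc : D M = D 0) {ε m : ℝ} {J : Set ℝ} (hJ : J ∈ 𝓝 ε) (hm : 0 < m)
    (hmin : ∀ η ∈ J, ∀ s ∈ Icc 0 ℓ, ∀ u ∈ Icc 0 M, m ≤ ‖a s - b η u‖) {β : ℝ → ℝ}
    (hβ : Integrable β (arcMeasure M)) (hβb : ∀ η ∈ J, ∀ u, ‖b' η u‖ ≤ β u)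
    (hβD : ∀ u, ‖D' u‖ ≤ β u) :
    HasDerivAt (fun η => gaussIntegral ℓ M a a' (b η) (b' η)) 0 ε := by
  have hεJ := mem_of_mem_nhds hJ
  have ham := ha.aemeasurable hℓ
  have hai : Integrable a' (arcMeasure ℓ) := ha.integrableOn
  have ham' := hai.1.aemeasurable
  have hDm := hD.aemeasurable hM
  have hDm' : AEMeasurable D' (arcMeasure M) := hD.integrableOn.1.aemeasurable
  have hbm : ∀ η : ℝ, AEMeasurable (b η) (arcMeasure M) := fun η => (hb η).aemeasurable hM
  have hbi : ∀ η : ℝ, Integrable (b' η) (arcMeasure M) := fun η => (hb η).integrableOn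
  obtain ⟨C, hC⟩ := isCompact_Icc.exists_bound_of_continuousOn (hD.continuousOn hM)
  have hbound : Integrable (fun z : ℝ × ℝ => (4 * C / m ^ 3 + 1 / m ^ 2) * (‖a' z.1‖ * β z.2))
      ((arcMeasure ℓ).prod (arcMeasure M)) := (hai.norm.mul_prod hβ).const_mul _
  have hFm : ∀ η, AEStronglyMeasurable (fun z : ℝ × ℝ => gauss (a z.1 - b η z.2) (a' z.1) (b' η z.2))
      ((arcMeasure ℓ).prod (arcMeasure M)) := fun η =>
    (aemeasurable_gauss_curves ham ham' (hbm η) (hbi η).1.aemeasurable).aestronglyMeasurable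
  have hFi : Integrable (fun z : ℝ × ℝ => gauss (a z.1 - b ε z.2) (a' z.1) (b' ε z.2))
      ((arcMeasure ℓ).prod (arcMeasure M)) :=
    integrable_gauss_curves ham hai (hbm ε) (hbi ε) hm (hmin ε hεJ)
  have hvm : AEMeasurable (fun z : ℝ × ℝ => a z.1 - b ε z.2) ((arcMeasure ℓ).prod (arcMeasure M)) :=
    ham.comp_fst.sub (hbm ε).comp_snd
  have hF'm : AEStronglyMeasurable (fun z : ℝ × ℝ => dgauss (a z.1 - b ε z.2) (a' z.1) (b' ε z.2)
      (-D z.2) + gauss (a z.1 - b ε z.2) (a' z.1) (D' z.2)) ((arcMeasure ℓ).prod (arcMeasure M)) :=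
    ((hvm.dgauss ham'.comp_fst (hbi ε).1.aemeasurable.comp_snd hDm.comp_snd.neg).add
      (hvm.gauss ham'.comp_fst hDm'.comp_snd)).aestronglyMeasurable
  have hmain := hasDerivAt_integral_of_dominated_loc_of_deriv_le (x₀ := ε)
    (μ := (arcMeasure ℓ).prod (arcMeasure M))
    (F := fun η z => gauss (a z.1 - b η z.2) (a' z.1) (b' η z.2))
    (F' := fun η z => dgauss (a z.1 - b η z.2) (a' z.1) (b' η z.2) (-D z.2) +
      gauss (a z.1 - b η z.2) (a' z.1) (D' z.2)) hJ (Eventually.of_forall hFm) hFi hF'm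
    (by
      filter_upwards [ae_prod_mem ℓ M] with z hz η hη
      exact abs_dgauss_add_gauss_le hm (hmin η hη _ hz.1 _ hz.2) (hC _ hz.2) (hβb η hη _) (hβD _))
    hbound
    (by
      filter_upwards [ae_prod_mem ℓ M] with z hz η hη
      exact hasDerivAt_gauss ((hbd η z.2).const_sub (a z.1)) (hbd' η z.2)
        (norm_pos_iff.1 (hm.trans_le (hmin η hη _ hz.1 _ hz.2))))
  have hzero := integral_variation_gauss_eq_zero hℓ hM ha (hb ε) hD hac (hbc ε) hDc hm
    (hmin ε hεJ) hmain.1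
  have h2 := hmain.2
  rw [hzero] at h2
  exact h2

/-- The Gauss integral is constant along a family `X + ε D` of closed curves avoiding `a`. -/
theorem hasDerivAt_gaussIntegral (hℓ : 0 ≤ ℓ) (hM : 0 ≤ M) (ha : IsPrimitive ℓ a a')
    (hX : IsPrimitive M X X') (hD : IsPrimitive M D D') (hac : a ℓ = a 0) (hXc : X M = X 0)
    (hDc : D M = D 0) {ε₀ ε : ℝ} (hε : ε ∈ Ioo 0 ε₀)
    (hne : ∀ η ∈ Ioo 0 ε₀, ∀ s ∈ Icc 0 ℓ, ∀ u ∈ Icc 0 M, a s ≠ X u + η • D u) :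
    HasDerivAt (fun η => gaussIntegral ℓ M a a' (fun u => X u + η • D u) fun u => X' u + η • D' u)
      0 ε := by
  -- A compact neighbourhood of `ε` inside `(0, ε₀)`, on which the distance of the curves has a
  -- positive lower bound.
  have hJ : Icc (ε / 2) ((ε + ε₀) / 2) ∈ 𝓝 ε := Icc_mem_nhds (by linarith [hε.1]) (by linarith [hε.2])
  have hεJ := mem_of_mem_nhds hJ
  have hJ' : Icc (ε / 2) ((ε + ε₀) / 2) ⊆ Ioo 0 ε₀ := fun η hη =>
    ⟨by linarith [hη.1, hε.1], by linarith [hη.2, hε.2]⟩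
  obtain ⟨m, hm, hmin⟩ := exists_pos_le_norm_sub hℓ hM (ha.continuousOn hℓ) (hX.continuousOn hM)
    (hD.continuousOn hM) (hεJ.1.trans hεJ.2) fun η hη => hne η (hJ' hη)
  have hε₀ : 0 < ε₀ := hε.1.trans hε.2
  refine hasDerivAt_gaussIntegral_family (b := fun η u => X u + η • D u)
    (b' := fun η u => X' u + η • D' u) hℓ hM ha (hX.add_smul hD) hD (fun η u => ?_) (fun η u => ?_) hac
    (fun η => by simp only [hXc, hDc]) hDc hJ hm hmin (β := fun u => ‖X' u‖ + (ε₀ + 1) * ‖D' u‖)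
    (hX.integrableOn.norm.add (hD.integrableOn.norm.const_mul _)) (fun η hη u => ?_) fun u => ?_
  · simpa using ((hasDerivAt_id η).smul_const (D u)).const_add (X u)
  · simpa using ((hasDerivAt_id η).smul_const (D' u)).const_add (X' u)
  · have hη' := hJ' hη
    refine (norm_add_le _ _).trans ?_
    rw [norm_smul, Real.norm_eq_abs, abs_of_pos hη'.1]
    have h1 := mul_le_mul_of_nonneg_right hη'.2.le (norm_nonneg (D' u))
    linarith [norm_nonneg (D' u)]
  · have h2 := mul_nonneg hε₀.le (norm_nonneg (D' u))
    linarith [norm_nonneg (X' u)]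

theorem gaussIntegral_const (hℓ : 0 ≤ ℓ) (hM : 0 ≤ M) (ha : IsPrimitive ℓ a a')
    (hX : IsPrimitive M X X') (hD : IsPrimitive M D D') (hac : a ℓ = a 0) (hXc : X M = X 0)
    (hDc : D M = D 0) {ε₀ ε ε' : ℝ} (hε : ε ∈ Ioo 0 ε₀) (hε' : ε' ∈ Ioo 0 ε₀)
    (hne : ∀ η ∈ Ioo 0 ε₀, ∀ s ∈ Icc 0 ℓ, ∀ u ∈ Icc 0 M, a s ≠ X u + η • D u) :
    gaussIntegral ℓ M a a' (fun u => X u + ε • D u) (fun u => X' u + ε • D' u) =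
      gaussIntegral ℓ M a a' (fun u => X u + ε' • D u) fun u => X' u + ε' • D' u := by
  have hd := fun η hη => hasDerivAt_gaussIntegral hℓ hM ha hX hD hac hXc hDc (ε := η) hη hne
  exact isOpen_Ioo.is_const_of_deriv_eq_zero isPreconnected_Ioo
    (fun η hη => (hd η hη).differentiableAt.differentiableWithinAt)
    (fun η hη => (hd η hη).deriv) hε hε'

end LinkingConstant

/-! ### The closed-up curve and its distance from the midline. -/

section ClosedUpCurve

variable {L : ℝ}

/-- The matching values at `L` allow the piecewise derivative to be integrated across `L`. -/
lemma isPrimitive_ite {f f' g g' : ℝ → E3} {M : ℝ} (hL : 0 ≤ L) (hLM : L ≤ M) (hf : IsPrimitive L f f')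
    (hg : ∀ u, HasDerivAt g (g' u) u) (hg' : Continuous g') (hfg : f L = g L) :
    IsPrimitive M (fun u => if u ≤ L then f u else g u) fun u => if u ≤ L then f' u else g' u := by
  have hLm : L ∈ Icc 0 L := ⟨hL, le_rfl⟩
  have h0 : (0 : ℝ) ∈ Icc 0 L := ⟨le_rfl, hL⟩
  have hi1 : IntegrableOn (fun u => if u ≤ L then f' u else g' u) (Icc 0 L) :=
    hf.integrableOn.congr_fun (fun u hu => by simp only [hu.2, if_true]) measurableSet_Icc
  have hi2 : IntegrableOn (fun u => if u ≤ L then f' u else g' u) (Ioc L M) :=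
    (hg'.integrableOn_Ioc).congr_fun (fun u hu => by simp only [not_le.2 hu.1, if_false])
      measurableSet_Ioc
  have hi : IntegrableOn (fun u => if u ≤ L then f' u else g' u) (Icc 0 M) := by
    rw [← Icc_union_Ioc_eq_Icc hL hLM]; exact hi1.union hi2
  have h1 : ∀ s ∈ Icc 0 L, ∫ u in (0 : ℝ)..s, (if u ≤ L then f' u else g' u) = ∫ u in (0 : ℝ)..s, f' u :=
    fun s hs => intervalIntegral.integral_congr fun u hu => by
      simp only [(uIcc_subset_Icc h0 hs hu).2, if_true]
  refine ⟨hi, fun s hs => ?_⟩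
  by_cases hsL : s ≤ L
  · simp only [hsL, hL, if_true]
    rw [h1 s ⟨hs.1, hsL⟩, ← hf.eq_add s ⟨hs.1, hsL⟩]
  · have hsL' := not_le.1 hsL
    have h2 : ∫ u in L..s, (if u ≤ L then f' u else g' u) = ∫ u in L..s, g' u := by
      rw [intervalIntegral.integral_of_le hsL'.le, intervalIntegral.integral_of_le hsL'.le]
      exact setIntegral_congr_fun measurableSet_Ioc fun u hu => by simp only [not_le.2 hu.1, if_false]
    have hI : ∀ {a b : ℝ}, a ∈ Icc 0 M → b ∈ Icc 0 M →
      IntervalIntegrable (fun u => if u ≤ L then f' u else g' u) volume a b := fun ha hb =>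
        IsPrimitive.intervalIntegrable_of hi ha hb
    have hLM' : L ∈ Icc 0 M := ⟨hL, hLM⟩
    rw [← intervalIntegral.integral_add_adjacent_intervals (b := L) (hI ⟨le_rfl, hL.trans hLM⟩ hLM')
      (hI hLM' hs), h1 L hLm, h2, intervalIntegral.integral_eq_sub_of_hasDerivAt (fun u _ => hg u)
      (hg'.intervalIntegrable _ _), ← hfg]
    simp only [hsL, hL, if_true, if_false]
    have h3 := hf.eq_add L hLm
    rw [← add_assoc, ← sub_eq_zero] at *
    rw [← sub_eq_zero.1 h3]
    abel

/-- The unit normals of the closing arc. -/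
def arcNormal (t₀ d₀ : E3) (φ : ℝ) : E3 := Real.cos φ • d₀ + Real.sin φ • cross t₀ d₀

/-- The midline rests at `x 0` on `[L, L + 1]` while the director turns back. On the common interval
`[0, L + 1]` the closed-up curve is then `closedMid + ε closedDir`, affine in `ε` as
`gaussIntegral_const` requires. -/
def closedMid (L : ℝ) (x : ℝ → E3) (u : ℝ) : E3 := if u ≤ L then x u else x 0

def closedMid' (L : ℝ) (t : ℝ → E3) (u : ℝ) : E3 := if u ≤ L then t u else 0

def closedDir (L θ : ℝ) (t d : ℝ → E3) (u : ℝ) : E3 :=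
  if u ≤ L then d u else arcNormal (t 0) (d 0) ((1 - (u - L)) * θ)

def arcNormal' (θ : ℝ) (t₀ d₀ : E3) (φ : ℝ) : E3 :=
  (θ * Real.sin φ) • d₀ - (θ * Real.cos φ) • cross t₀ d₀

def closedDir' (L θ : ℝ) (W t d : ℝ → E3) (u : ℝ) : E3 :=
  if u ≤ L then W u 2 • cross (t u) (d u) - W u 1 • t u
  else arcNormal' θ (t 0) (d 0) ((1 - (u - L)) * θ)

lemma hasDerivAt_arcNormal (L θ : ℝ) (t₀ d₀ : E3) (u : ℝ) :
    HasDerivAt (fun u => arcNormal t₀ d₀ ((1 - (u - L)) * θ))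
      (arcNormal' θ t₀ d₀ ((1 - (u - L)) * θ)) u := by
  have h1 : HasDerivAt (fun u : ℝ => (1 - (u - L)) * θ) (-θ) u := by
    simpa using (((hasDerivAt_id u).sub_const L).const_sub 1).mul_const θ
  have h2 := (h1.cos.smul_const d₀).add (h1.sin.smul_const (cross t₀ d₀))
  refine h2.congr_deriv ?_
  simp only [arcNormal']
  module

lemma continuous_arcNormal' (L θ : ℝ) (t₀ d₀ : E3) :
    Continuous fun u => arcNormal' θ t₀ d₀ ((1 - (u - L)) * θ) := by
  unfold arcNormal'; fun_prop

lemma norm_arcNormal' (θ : ℝ) {t₀ d₀ : E3} (ht : ‖t₀‖ = 1) (hd : ‖d₀‖ = 1) (φ : ℝ) :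
    ‖arcNormal' θ t₀ d₀ φ‖ ≤ 2 * |θ| := by
  have h3 := norm_cross_le t₀ d₀
  rw [ht, hd] at h3
  refine (norm_sub_le _ _).trans ?_
  rw [norm_smul, norm_smul, Real.norm_eq_abs, Real.norm_eq_abs, abs_mul, abs_mul, hd]
  have h1 := mul_le_mul_of_nonneg_left (Real.abs_sin_le_one φ) (abs_nonneg θ)
  have h2 := mul_le_mul_of_nonneg_left (Real.abs_cos_le_one φ) (abs_nonneg θ)
  have h4 := mul_le_mul h2 h3 (norm_nonneg _) (by positivity)
  linarith

lemma norm_arcNormal {t₀ d₀ : E3} (ht : ‖t₀‖ = 1) (hd : ‖d₀‖ = 1) (htd : inner ℝ t₀ d₀ = 0) (φ : ℝ) :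
    ‖arcNormal t₀ d₀ φ‖ = 1 := by
  have h2 := norm_cross_sq t₀ d₀
  rw [ht, hd, htd] at h2
  have h1 : ‖arcNormal t₀ d₀ φ‖ ^ 2 = 1 := by
    have hdn : inner ℝ d₀ (cross t₀ d₀) = 0 := by rw [inner_eq_sum]; simp; ring
    rw [arcNormal, norm_add_sq_real, norm_smul, norm_smul, mul_pow, mul_pow, h2, hd,
      real_inner_smul_left, real_inner_smul_right, hdn, Real.norm_eq_abs, Real.norm_eq_abs, sq_abs,
      sq_abs]
    have := Real.cos_sq_add_sin_sq φ
    linarith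
  nlinarith [norm_nonneg (arcNormal t₀ d₀ φ)]

lemma inner_arcNormal {t₀ d₀ : E3} (htd : inner ℝ t₀ d₀ = 0) (φ : ℝ) :
    inner ℝ (arcNormal t₀ d₀ φ) t₀ = 0 := by
  have h1 : inner ℝ (cross t₀ d₀) t₀ = 0 := by rw [inner_eq_sum]; simp; ring
  rw [arcNormal, inner_add_left, real_inner_smul_left, real_inner_smul_left, h1, real_inner_comm, htd]
  ring

variable {W x t d : ℝ → E3} {θ : ℝ}

lemma Framing.isPrimitive_closedMid (h : Framing L W x t d) (hx : x L = x 0) :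
    IsPrimitive (L + 1) (closedMid L x) (closedMid' L t) :=
  isPrimitive_ite h.L_pos.le (by linarith) h.primitive_x (g := fun _ => x 0) (g' := fun _ => 0)
    (fun u => hasDerivAt_const u _) continuous_const hx

lemma Framing.isPrimitive_closedDir (h : Framing L W x t d) (hd : d L = arcNormal (t 0) (d 0) θ) :
    IsPrimitive (L + 1) (closedDir L θ t d) (closedDir' L θ W t d) :=
  isPrimitive_ite h.L_pos.le (by linarith) h.primitive_d (hasDerivAt_arcNormal L θ (t 0) (d 0))
    (continuous_arcNormal' L θ (t 0) (d 0)) (by rw [hd]; simp)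

lemma Framing.closedMid_closed (h : Framing L W x t d) :
    closedMid L x (L + 1) = closedMid L x 0 := by
  simp [closedMid, h.L_pos.le]

lemma Framing.closedDir_closed (h : Framing L W x t d) :
    closedDir L θ t d (L + 1) = closedDir L θ t d 0 := by
  simp [closedDir, h.L_pos.le, arcNormal]

/-- Points at small distance in a normal direction of a closed embedded curve are off the curve. -/
lemma ne_add_smul_normal (h : IsPrimitive L x t) (h1 : ∀ s ∈ Icc 0 L, ‖t s‖ = 1) (hx : x L = x 0)
    (htL : t L = t 0) {c δ : ℝ} (hc0 : 0 < c)
    (hc : ∀ s ∈ Icc 0 L, ∀ s' ∈ Icc 0 L, c * arcDist L s s' ≤ ‖x s - x s'‖)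
    (hδ : ∀ r ∈ Icc 0 L, ∀ s ∈ Icc 0 L, |r - s| < δ → ‖t r - t s‖ ≤ 1 / 4) {ε : ℝ}
    (hε : ε ∈ Ioo 0 (c * δ)) {s u : ℝ} (hs : s ∈ Icc 0 L) (hu : u ∈ Icc 0 L) {ν : E3} (hν : ‖ν‖ = 1)
    (hνt : inner ℝ ν (t u) = 0) : x s ≠ x u + ε • ν := by
  intro heq
  have hL : 0 ≤ L := hs.1.trans hs.2
  have h0 : (0 : ℝ) ∈ Icc 0 L := ⟨le_rfl, hL⟩
  have hLm : L ∈ Icc 0 L := ⟨hL, le_rfl⟩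
  have hsub : x s - x u = ε • ν := by rw [heq]; abel
  have hnorm : ‖x s - x u‖ = ε := by
    rw [hsub, norm_smul, hν, mul_one, Real.norm_eq_abs, abs_of_pos hε.1]
  have hA := hc s hs u hu
  -- An intersection would give a chord of length `ε < c δ`, so the two parameters are at arc
  -- distance less than `δ`.
  rw [hnorm] at hA
  have hA' : arcDist L s u < δ := lt_of_mul_lt_mul_left (hA.trans_lt hε.2) hc0.le
  have hne : x s ≠ x u := fun e => by
    rw [e, sub_self, norm_zero] at hnorm; exact hε.1.ne hnorm
  have hin : inner ℝ (x s - x u) (t u) = 0 := by rw [hsub, real_inner_smul_left, hνt, mul_zero]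
  have htt : inner ℝ (t u) (t u) = (1 : ℝ) := by rw [real_inner_self_eq_norm_sq, h1 u hu]; norm_num
  -- The chord is orthogonal to `t u`, so approximating it by `κ t u` costs at least `|κ|`. The
  -- tangent estimates below bound this cost by half of `|κ|` or less, which forces `κ = 0`.
  have key : ∀ {κ b : ℝ}, ‖x s - x u - κ • t u‖ ≤ b → |κ| ≤ b := fun {κ b} hb => by
    have e1 : inner ℝ (x s - x u - κ • t u) (t u) = -κ := by
      rw [inner_sub_left, hin, real_inner_smul_left, htt]; ring
    have e2 := abs_real_inner_le_norm (x s - x u - κ • t u) (t u)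
    rw [e1, abs_neg, h1 u hu, mul_one] at e2
    exact e2.trans hb
  rw [arcDist, min_lt_iff] at hA'
  rcases hA' with hA' | hA'
  · have n1 := h.norm_sub_sub_smul_le (c := 1 / 4) (T := t u) hu hs fun r hr =>
      hδ r (uIcc_subset_Icc hu hs hr) u hu ((abs_sub_left_of_mem_uIcc hr).trans_lt hA')
    have n2 := key n1
    have n3 : |s - u| = 0 := by linarith [abs_nonneg (s - u)]
    exact hne (by rw [sub_eq_zero.1 (abs_eq_zero.1 n3)])
  · rcases le_total u s with hus | hus
    · rw [abs_of_nonneg (by linarith)] at hA'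
      -- Across the closing point the tangent bound is 1/4 + 1/4, joined by `t L = t 0`.
      have n1 := h.norm_sub_sub_smul_le (c := 1 / 2) (T := t u) hs hLm fun r hr => by
        rw [uIcc_of_le hs.2] at hr
        have e1 := hδ r ⟨hs.1.trans hr.1, hr.2⟩ L hLm (by
          rw [abs_sub_comm, abs_of_nonneg (by linarith [hr.2])]; linarith [hr.1, hu.1])
        have e2 := hδ 0 h0 u hu (by rw [zero_sub, abs_neg, abs_of_nonneg hu.1]; linarith [hs.2])
        rw [htL] at e1
        have e3 := norm_sub_le_norm_sub_add_norm_sub (t r) (t 0) (t u)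
        linarith
      have n2 := h.norm_sub_sub_smul_le (c := 1 / 2) (T := t u) h0 hu fun r hr => by
        rw [uIcc_of_le hu.1] at hr
        have := hδ r ⟨hr.1, hr.2.trans hu.2⟩ u hu (by
          rw [abs_sub_comm, abs_of_nonneg (by linarith [hr.2])]; linarith [hr.1, hs.2])
        linarith
      rw [abs_of_nonneg (by linarith [hs.2])] at n1
      rw [sub_zero, abs_of_nonneg hu.1] at n2
      have n3 : ‖x s - x u - (-(L - s + u)) • t u‖ ≤ 1 / 2 * (L - s + u) := by
        have e : x s - x u - (-(L - s + u)) • t u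
            = -((x L - x s - (L - s) • t u) + (x u - x 0 - u • t u)) := by rw [hx]; module
        rw [e, norm_neg]
        exact (norm_add_le _ _).trans (by linarith)
      have n4 := key n3
      rw [abs_neg, abs_of_nonneg (by linarith [hs.2, hu.1])] at n4
      have e1 : s = L := by linarith [hs.2, hu.1]
      have e2 : u = 0 := by linarith [hs.2, hu.1]
      exact hne (by rw [e1, e2, hx])
    · rw [abs_sub_comm, abs_of_nonneg (by linarith)] at hA'
      have n1 := h.norm_sub_sub_smul_le (c := 1 / 2) (T := t u) h0 hs fun r hr => by
        rw [uIcc_of_le hs.1] at hr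
        have e1 := hδ r ⟨hr.1, hr.2.trans hs.2⟩ 0 h0 (by
          rw [sub_zero, abs_of_nonneg hr.1]; linarith [hr.2, hu.2])
        have e2 := hδ L hLm u hu (by rw [abs_of_nonneg (by linarith [hu.2])]; linarith [hs.1])
        rw [htL] at e2
        have e3 := norm_sub_le_norm_sub_add_norm_sub (t r) (t 0) (t u)
        linarith
      have n2 := h.norm_sub_sub_smul_le (c := 1 / 2) (T := t u) hu hLm fun r hr => by
        rw [uIcc_of_le hu.2] at hr
        have := hδ r ⟨hu.1.trans hr.1, hr.2⟩ u hu (by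
          rw [abs_of_nonneg (by linarith [hr.1])]; linarith [hr.2, hs.1])
        linarith
      rw [sub_zero, abs_of_nonneg hs.1] at n1
      rw [abs_of_nonneg (by linarith [hu.2])] at n2
      have n3 : ‖x s - x u - (L - u + s) • t u‖ ≤ 1 / 2 * (L - u + s) := by
        have e : x s - x u - (L - u + s) • t u
            = (x L - x u - (L - u) • t u) + (x s - x 0 - s • t u) := by rw [hx]; module
        rw [e]
        exact (norm_add_le _ _).trans (by linarith)
      have n4 := key n3
      rw [abs_of_nonneg (by linarith [hu.2, hs.1])] at n4
      have e1 : u = L := by linarith [hu.2, hs.1]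
      have e2 : s = 0 := by linarith [hu.2, hs.1]
      exact hne (by rw [e1, e2, hx])

/-- The closed midline is disjoint from its small normal translations along the director. -/
lemma Framing.ne_closed (h : Framing L W x t d) (hx : x L = x 0) (htL : t L = t 0) {c δ : ℝ}
    (hc0 : 0 < c) (hc : ∀ s ∈ Icc 0 L, ∀ s' ∈ Icc 0 L, c * arcDist L s s' ≤ ‖x s - x s'‖)
    (hδ : ∀ r ∈ Icc 0 L, ∀ s ∈ Icc 0 L, |r - s| < δ → ‖t r - t s‖ ≤ 1 / 4) {ε : ℝ}
    (hε : ε ∈ Ioo 0 (c * δ)) {s u : ℝ} (hs : s ∈ Icc 0 L) (hu : u ∈ Icc 0 (L + 1)) :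
    x s ≠ closedMid L x u + ε • closedDir L θ t d u := by
  have h0 : (0 : ℝ) ∈ Icc 0 L := ⟨le_rfl, h.L_pos.le⟩
  unfold closedMid closedDir
  split_ifs with huL
  · have hu' : u ∈ Icc 0 L := ⟨hu.1, huL⟩
    exact ne_add_smul_normal h.primitive_x h.norm_t hx htL hc0 hc hδ hε hs hu' (h.norm_d u hu')
      (by rw [real_inner_comm]; exact h.inner_td u hu')
  · exact ne_add_smul_normal h.primitive_x h.norm_t hx htL hc0 hc hδ hε hs h0
      (norm_arcNormal (h.norm_t 0 h0) (h.norm_d 0 h0) (h.inner_td 0 h0) _)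
      (inner_arcNormal (h.inner_td 0 h0) _)

/-- The linking number in terms of the Gauss integral. -/
lemma linkingNumber_eq {ℓ M : ℝ} {a a' b b' : ℝ → E3} (hℓ : 0 ≤ ℓ) (hM : 0 ≤ M) (ha : IsPrimitive ℓ a a')
    (hb : IsPrimitive M b b') {m : ℝ} (hm : 0 < m)
    (hmin : ∀ s ∈ Icc 0 ℓ, ∀ u ∈ Icc 0 M, m ≤ ‖a s - b u‖) :
    linkingNumber a b ℓ M = 1 / (4 * Real.pi) * gaussIntegral ℓ M a a' b b' := by
  have hi := integrable_gauss_curves (ha.aemeasurable hℓ) ha.integrableOn (hb.aemeasurable hM)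
    hb.integrableOn hm hmin
  rw [linkingNumber, gaussIntegral, integral_prod _ hi, intervalIntegral.integral_of_le hℓ,
    ← integral_Icc_eq_integral_Ioc]
  congr 1
  have hb' : ∀ᵐ u ∂(arcMeasure M), deriv b u = b' u := by
    rw [ae_restrict_iff' measurableSet_Icc]
    filter_upwards [hb.ae_hasDerivAt hM] with u hu huI using (hu huI).deriv
  refine integral_congr_ae ?_
  have ha' : ∀ᵐ s ∂(arcMeasure ℓ), deriv a s = a' s := by
    rw [ae_restrict_iff' measurableSet_Icc]
    filter_upwards [ha.ae_hasDerivAt hℓ] with s hs hsI using (hs hsI).deriv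
  filter_upwards [ha'] with s hs
  rw [intervalIntegral.integral_of_le hM, ← integral_Icc_eq_integral_Ioc]
  refine integral_congr_ae ?_
  filter_upwards [hb'] with u hu
  rw [hs, hu, gauss]

end ClosedUpCurve

/-! ### Limits of Gauss integrals under weak convergence of the strains. -/

section LinkingLimit

variable {L : ℝ} {p : ℝ≥0∞}

lemma tendstoUniformlyOn_prodMk {X E G : Type*} [UniformSpace E] [UniformSpace G] {F : ℕ → X → E}
    {f : X → E} {F' : ℕ → X → G} {f' : X → G} {K : Set X} (h : TendstoUniformlyOn F f atTop K)
    (h' : TendstoUniformlyOn F' f' atTop K) :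
    TendstoUniformlyOn (fun n a => (F n a, F' n a)) (fun a => (f a, f' a)) atTop K :=
  fun u hu => (h.prodMk h' u hu).diag_of_prod

/-- Passage to the limit in integrals that are affine in weakly convergent strains. -/
lemma WeakTendsto.tendsto_integral_affine (hL : 0 ≤ L) (hp : 1 < p) (hp' : p < ⊤) {w : ℕ → ℝ → E3}
    {u : ℝ → E3} (hw : WeakTendsto L p w u) {E : Type*} [NormedAddCommGroup E] [ProperSpace E]
    {y : ℕ → ℝ → E} {z : ℝ → E} {C : ℝ} {φ : E → ℝ} {Φ : E → E3 →L[ℝ] ℝ} (hφ : Continuous φ)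
    (hΦ : Continuous Φ) (hy : ∀ k, ∀ s ∈ Icc 0 L, ‖y k s‖ ≤ C) (hyc : ∀ k, ContinuousOn (y k) (Icc 0 L))
    (hzc : ContinuousOn z (Icc 0 L)) (hlim : TendstoUniformlyOn y z atTop (Icc 0 L)) :
    Tendsto (fun k => ∫ s, (φ (y k s) + Φ (y k s) (w k s)) ∂(arcMeasure L)) atTop
      (𝓝 (∫ s, (φ (z s) + Φ (z s) (u s)) ∂(arcMeasure L))) := by
  have hz : ∀ s ∈ Icc 0 L, ‖z s‖ ≤ C := fun s hs =>
    le_of_tendsto (hlim.tendsto_at hs).norm (Eventually.of_forall fun k => hy k s hs)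
  obtain ⟨H, hH⟩ := (isCompact_closedBall (0 : E) C).exists_bound_of_continuousOn hΦ.continuousOn
  obtain ⟨H₀, hH₀⟩ := (isCompact_closedBall (0 : E) C).exists_bound_of_continuousOn hφ.continuousOn
  have hH' : ∀ {y : ℝ → E}, (∀ s ∈ Icc 0 L, ‖y s‖ ≤ C) → ∀ s ∈ Icc 0 L, ‖Φ (y s)‖ ≤ H :=
    fun h s hs => hH _ (by simpa using h s hs)
  have hm : ∀ {y : ℝ → E}, ContinuousOn y (Icc 0 L) →
      AEStronglyMeasurable (fun s => Φ (y s)) (arcMeasure L) := fun h =>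
    (hΦ.comp_continuousOn h).aestronglyMeasurable measurableSet_Icc
  have hm0 : ∀ {y : ℝ → E}, ContinuousOn y (Icc 0 L) →
      AEStronglyMeasurable (fun s => φ (y s)) (arcMeasure L) := fun h =>
    (hφ.comp_continuousOn h).aestronglyMeasurable measurableSet_Icc
  obtain ⟨M, hM⟩ := hw.bounded
  have i1 : ∀ {y : ℝ → E}, ContinuousOn y (Icc 0 L) → Integrable (fun s => φ (y s)) (arcMeasure L) :=
    fun h => (hφ.comp_continuousOn h).integrableOn_Icc
  have i2 : ∀ {y : ℝ → E} {v : ℝ → E3}, ContinuousOn y (Icc 0 L) → (∀ s ∈ Icc 0 L, ‖y s‖ ≤ C) →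
      Integrable v (arcMeasure L) → Integrable (fun s => Φ (y s) (v s)) (arcMeasure L) :=
    fun h hb hv => integrable_clm_apply (hm h) (by
      filter_upwards [ae_restrict_mem measurableSet_Icc] with s hs using hH' hb s hs) hv
  have h2 := hw.tendsto_integral_clm_of_uniform hL hp hp' (fun k => hm (hyc k)) (hm hzc) (hH' hz)
    (tendstoUniformlyOn_comp_of_bounded hy hz hlim hΦ.continuousOn)
  have h1 : Tendsto (fun k => ∫ s, φ (y k s) ∂(arcMeasure L)) atTop
      (𝓝 (∫ s, φ (z s) ∂(arcMeasure L))) := by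
    refine tendsto_integral_of_dominated_convergence (fun _ => H₀) (fun k => hm0 (hyc k))
      (integrable_const _) (fun k => ?_) ?_
    · filter_upwards [ae_restrict_mem measurableSet_Icc] with s hs
      exact hH₀ _ (by simpa using hy k s hs)
    · filter_upwards [ae_restrict_mem measurableSet_Icc] with s hs
      exact (hφ.tendsto _).comp (hlim.tendsto_at hs)
  have h3 := h1.add h2
  rw [← integral_add (i1 hzc) (i2 hzc hz hw.integrable)] at h3
  refine h3.congr fun k => ?_
  rw [← integral_add (i1 (hyc k)) (i2 (hyc k) (hy k) (integrable_of_eLpNorm_le hp (hM k)))]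

/-- The Gauss kernel as a linear form, cut off near the singularity. -/
def gaussL (m : ℝ) (y : E3 × E3) : E3 →L[ℝ] ℝ :=
  ((max ‖y.1‖ m) ^ 3)⁻¹ • innerSL ℝ (cross y.1 y.2)

lemma gaussL_apply {m : ℝ} {v q r : E3} (h : m ≤ ‖v‖) : gaussL m (v, q) r = gauss v q r := by
  simp only [gaussL, gauss, max_eq_left h, smul_apply, smul_eq_mul, innerSL_apply_apply]
  rw [div_eq_inv_mul]
  congr 1
  simp only [inner_eq_sum, cross_apply_zero, cross_apply_one, cross_apply_two]
  ring

lemma continuous_gaussL {m : ℝ} (hm : 0 < m) : Continuous (gaussL m) := by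
  unfold gaussL
  refine Continuous.smul (((continuous_fst.norm.max continuous_const).pow 3).inv₀ fun y => ?_)
    ((innerSL ℝ).continuous.comp (continuous_fst.cross continuous_snd))
  exact pow_ne_zero 3 (hm.trans_le (le_max_right _ _)).ne'

lemma continuousAt_gauss {v q r : E3} (hv : v ≠ 0) {a : ℕ → E3} {b : ℕ → E3}
    (ha : Tendsto a atTop (𝓝 v)) (hb : Tendsto b atTop (𝓝 q)) :
    Tendsto (fun k => gauss (a k) (b k) r) atTop (𝓝 (gauss v q r)) := by
  have h1 : Tendsto (fun k => cross (b k) r) atTop (𝓝 (cross q r)) :=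
    ((continuous_id.cross continuous_const).tendsto q).comp hb
  exact (ha.inner h1).div (ha.norm.pow 3) (by positivity)

variable {W x t d : ℕ → ℝ → E3} {u x' t' d' : ℝ → E3} {θ ε m : ℝ}

/-- The inner Gauss integral along the translated midline converges. -/
lemma tendsto_inner_gauss (hL : 0 ≤ L) (hp : 1 < p) (hp' : p < ⊤) (hw : WeakTendsto L p W u)
    (hf : ∀ k, Framing L (W k) (x k) (t k) (d k)) (hf' : Framing L u x' t' d')
    (hx : TendstoUniformlyOn x x' atTop (Icc 0 L)) (ht : TendstoUniformlyOn t t' atTop (Icc 0 L))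
    (hd : TendstoUniformlyOn d d' atTop (Icc 0 L)) (hxb : ∃ R, ∀ k, ∀ s ∈ Icc 0 L, ‖x k s‖ ≤ R)
    (hm : 0 < m)
    (hmk : ∀ k, ∀ s ∈ Icc 0 L, ∀ r ∈ Icc 0 L, m ≤ ‖x k s - (x k r + ε • d k r)‖) {s : ℝ}
    (hs : s ∈ Icc 0 L) :
    Tendsto (fun k => ∫ r, gauss (x k s - (x k r + ε • d k r)) (t k s)
        (t k r + ε • (W k r 2 • cross (t k r) (d k r) - W k r 1 • t k r)) ∂(arcMeasure L)) atTop
      (𝓝 (∫ r, gauss (x' s - (x' r + ε • d' r)) (t' s)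
        (t' r + ε • (u r 2 • cross (t' r) (d' r) - u r 1 • t' r)) ∂(arcMeasure L))) := by
  have hm' : ∀ r ∈ Icc 0 L, m ≤ ‖x' s - (x' r + ε • d' r)‖ := fun r hr =>
    ge_of_tendsto ((hx.tendsto_at hs).sub ((hx.tendsto_at hr).add
      ((hd.tendsto_at hr).const_smul ε))).norm (Eventually.of_forall fun k => hmk k s hs r hr)
  obtain ⟨R, hR⟩ := hxb
  have hsmul : UniformContinuous fun v : E3 => ε • v := uniformContinuous_const_smul ε
  -- All quantities that converge uniformly in `r` are packed into one map. The integrand is then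
  -- affine in the strain with continuous coefficients.
  have hy : TendstoUniformlyOn (fun k r => (((x k s - (x k r + ε • d k r)), t k s), (d k r, t k r)))
      (fun r => (((x' s - (x' r + ε • d' r)), t' s), (d' r, t' r))) atTop (Icc 0 L) :=
    tendstoUniformlyOn_prodMk (tendstoUniformlyOn_prodMk
      (((hx.tendsto_at hs).tendstoUniformlyOn_const _).sub
        (hx.add (hsmul.comp_tendstoUniformlyOn hd)))
      ((ht.tendsto_at hs).tendstoUniformlyOn_const _)) (tendstoUniformlyOn_prodMk hd ht)
  have hc : ∀ {W x t d : ℝ → E3}, Framing L W x t d → ContinuousOn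
      (fun r => (((x s - (x r + ε • d r)), t s), (d r, t r))) (Icc 0 L) := fun h =>
    (((continuousOn_const.sub ((h.primitive_x.continuousOn hL).add
      ((h.primitive_d.continuousOn hL).const_smul ε))).prodMk continuousOn_const).prodMk
      ((h.primitive_d.continuousOn hL).prodMk (h.primitive_t.continuousOn hL)))
  have hb : ∀ k, ∀ r ∈ Icc 0 L,
      ‖(((x k s - (x k r + ε • d k r)), t k s), (d k r, t k r))‖ ≤ 2 * R + |ε| + 1 := fun k r hr => by
    have e1 : ‖x k s - (x k r + ε • d k r)‖ ≤ R + (R + |ε|) := by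
      refine (norm_sub_le _ _).trans (add_le_add (hR k s hs) ((norm_add_le _ _).trans
        (add_le_add (hR k r hr) ?_)))
      rw [norm_smul, (hf k).norm_d r hr, mul_one, Real.norm_eq_abs]
    have hR0 : 0 ≤ R := (norm_nonneg _).trans (hR k s hs)
    simp only [Prod.norm_def, (hf k).norm_t s hs, (hf k).norm_d r hr, (hf k).norm_t r hr]
    refine max_le (max_le (by linarith) ?_) (max_le ?_ ?_) <;> linarith [abs_nonneg ε]
  have hφ : Continuous fun y : (E3 × E3) × (E3 × E3) => gaussL m y.1 y.2.2 :=
    ((continuous_gaussL hm).comp continuous_fst).clm_apply (continuous_snd.comp continuous_snd)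
  have hΦ : Continuous fun y : (E3 × E3) × (E3 × E3) =>
      ε • (gaussL m y.1).comp (strainD y.2.2 (cross y.2.2 y.2.1)) :=
    (((continuous_gaussL hm).comp continuous_fst).clm_comp
      (continuous_strainD.comp continuous_snd)).const_smul ε
  have h := hw.tendsto_integral_affine hL hp hp' hφ hΦ hb (fun k => hc (hf k)) (hc hf') hy
  have e : ∀ {W x t d : ℝ → E3}, (∀ r ∈ Icc 0 L, m ≤ ‖x s - (x r + ε • d r)‖) →
      ∫ r, (gaussL m (x s - (x r + ε • d r), t s) (t r) +
        (ε • (gaussL m (x s - (x r + ε • d r), t s)).comp (strainD (t r) (cross (t r) (d r)))) (W r))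
          ∂(arcMeasure L) =
      ∫ r, gauss (x s - (x r + ε • d r)) (t s)
        (t r + ε • (W r 2 • cross (t r) (d r) - W r 1 • t r)) ∂(arcMeasure L) := fun hm => by
    refine integral_congr_ae ?_
    filter_upwards [ae_restrict_mem measurableSet_Icc] with r hr
    rw [gauss_add, gauss_smul, smul_apply, ContinuousLinearMap.comp_apply, gaussL_apply (hm r hr),
      gaussL_apply (hm r hr), strainD_apply, smul_eq_mul]
  simp only [e hm', fun k => e (W := W k) (t := t k) (hmk k s hs)] at h
  exact h

lemma arcMeasure_add_one (hL : 0 ≤ L) :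
    arcMeasure (L + 1) = arcMeasure L + volume.restrict (Ioc L (L + 1)) := by
  rw [arcMeasure, ← Icc_union_Ioc_eq_Icc hL (by linarith : L ≤ L + 1), Measure.restrict_union _ measurableSet_Ioc]
  exact Set.disjoint_left.2 fun a ha hb => not_lt.2 ha.2 hb.1

/-- Splitting off the closing arc in the Gauss integral. -/
lemma Framing.gaussIntegral_eq {W x t d : ℝ → E3} (h : Framing L W x t d) (hx : x L = x 0)
    (hd : d L = arcNormal (t 0) (d 0) θ) (hm : 0 < m)
    (hmin : ∀ s ∈ Icc 0 L, ∀ r ∈ Icc 0 (L + 1),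
      m ≤ ‖x s - (closedMid L x r + ε • closedDir L θ t d r)‖) :
    Integrable (fun s => ∫ r, gauss (x s - (x r + ε • d r)) (t s)
      (t r + ε • (W r 2 • cross (t r) (d r) - W r 1 • t r)) ∂(arcMeasure L)) (arcMeasure L) ∧
    gaussIntegral L (L + 1) x t (fun r => closedMid L x r + ε • closedDir L θ t d r)
      (fun r => closedMid' L t r + ε • closedDir' L θ W t d r) =
    (∫ s, ∫ r, gauss (x s - (x r + ε • d r)) (t s)
      (t r + ε • (W r 2 • cross (t r) (d r) - W r 1 • t r)) ∂(arcMeasure L) ∂(arcMeasure L)) +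
    ∫ z, gauss (x z.1 - (x 0 + ε • arcNormal (t 0) (d 0) ((1 - (z.2 - L)) * θ))) (t z.1)
      (ε • arcNormal' θ (t 0) (d 0) ((1 - (z.2 - L)) * θ))
      ∂((arcMeasure L).prod (volume.restrict (Ioc L (L + 1)))) := by
  have hL := h.L_pos.le
  have hb := (h.isPrimitive_closedMid hx).add_smul (h.isPrimitive_closedDir hd) ε
  have hM : 0 ≤ L + 1 := by linarith
  have hi := integrable_gauss_curves (h.primitive_x.aemeasurable hL) h.primitive_x.integrableOn
    (hb.aemeasurable hM) hb.integrableOn hm hmin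
  rw [gaussIntegral]
  rw [arcMeasure_add_one hL, Measure.prod_add] at hi ⊢
  have i1 := hi.left_of_add_measure
  have i2 := hi.right_of_add_measure
  rw [integral_add_measure i1 i2]
  have e1 : (fun z : ℝ × ℝ => gauss (x z.1 - (closedMid L x z.2 + ε • closedDir L θ t d z.2)) (t z.1)
      (closedMid' L t z.2 + ε • closedDir' L θ W t d z.2)) =ᵐ[(arcMeasure L).prod (arcMeasure L)]
      fun z => gauss (x z.1 - (x z.2 + ε • d z.2)) (t z.1)
      (t z.2 + ε • (W z.2 2 • cross (t z.2) (d z.2) - W z.2 1 • t z.2)) := by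
    filter_upwards [ae_prod_mem L L] with z hz
    simp only [closedMid, closedMid', closedDir, closedDir', hz.2.2, if_true]
  have e2 : (fun z : ℝ × ℝ => gauss (x z.1 - (closedMid L x z.2 + ε • closedDir L θ t d z.2)) (t z.1)
      (closedMid' L t z.2 + ε • closedDir' L θ W t d z.2))
      =ᵐ[(arcMeasure L).prod (volume.restrict (Ioc L (L + 1)))]
      fun z => gauss (x z.1 - (x 0 + ε • arcNormal (t 0) (d 0) ((1 - (z.2 - L)) * θ))) (t z.1)
      (ε • arcNormal' θ (t 0) (d 0) ((1 - (z.2 - L)) * θ)) := by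
    have : ∀ᵐ z ∂((arcMeasure L).prod (volume.restrict (Ioc L (L + 1)))),
        z ∈ Icc 0 L ×ˢ Ioc L (L + 1) := by
      rw [arcMeasure, Measure.prod_restrict]
      exact ae_restrict_mem (measurableSet_Icc.prod measurableSet_Ioc)
    filter_upwards [this] with z hz
    simp only [closedMid, closedMid', closedDir, closedDir', not_le.2 hz.2.1, if_false, zero_add]
  have i3 := i1.congr e1
  rw [integral_congr_ae e1, integral_congr_ae e2, integral_prod _ i3]
  exact ⟨i3.integral_prod_left, rfl⟩

/-- The Gauss integrals of convergent framed closed curves converge. -/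
theorem tendsto_gaussIntegral (hp : 1 < p) (hp' : p < ⊤) (hw : WeakTendsto L p W u)
    (hf : ∀ k, Framing L (W k) (x k) (t k) (d k)) (hf' : Framing L u x' t' d')
    (hx : TendstoUniformlyOn x x' atTop (Icc 0 L)) (ht : TendstoUniformlyOn t t' atTop (Icc 0 L))
    (hd : TendstoUniformlyOn d d' atTop (Icc 0 L)) (hx0 : ∀ k, x k 0 = x' 0) (ht0 : ∀ k, t k 0 = t' 0)
    (hd0 : ∀ k, d k 0 = d' 0) (hxc : ∀ k, x k L = x k 0) (hxc' : x' L = x' 0)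
    (hdc : ∀ k, d k L = arcNormal (t k 0) (d k 0) θ) (hdc' : d' L = arcNormal (t' 0) (d' 0) θ)
    (hm : 0 < m)
    (hmk : ∀ k, ∀ s ∈ Icc 0 L, ∀ r ∈ Icc 0 (L + 1),
      m ≤ ‖x k s - (closedMid L (x k) r + ε • closedDir L θ (t k) (d k) r)‖) :
    Tendsto (fun k => gaussIntegral L (L + 1) (x k) (t k)
        (fun r => closedMid L (x k) r + ε • closedDir L θ (t k) (d k) r)
        (fun r => closedMid' L (t k) r + ε • closedDir' L θ (W k) (t k) (d k) r)) atTop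
      (𝓝 (gaussIntegral L (L + 1) x' t' (fun r => closedMid L x' r + ε • closedDir L θ t' d' r)
        (fun r => closedMid' L t' r + ε • closedDir' L θ u t' d' r))) := by
  have hL := hf'.L_pos.le
  have h0 : (0 : ℝ) ∈ Icc 0 L := ⟨le_rfl, hL⟩
  have hmid : ∀ r ∈ Icc 0 (L + 1),
      Tendsto (fun k => closedMid L (x k) r) atTop (𝓝 (closedMid L x' r)) := fun r hr => by
    unfold closedMid
    split_ifs with h
    · exact hx.tendsto_at ⟨hr.1, h⟩
    · exact hx.tendsto_at h0
  have hdir : ∀ r ∈ Icc 0 (L + 1),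
      Tendsto (fun k => closedDir L θ (t k) (d k) r) atTop (𝓝 (closedDir L θ t' d' r)) := fun r hr => by
    unfold closedDir
    split_ifs with h
    · exact hd.tendsto_at ⟨hr.1, h⟩
    · simp only [ht0, hd0]; exact tendsto_const_nhds
  have hm' : ∀ s ∈ Icc 0 L, ∀ r ∈ Icc 0 (L + 1),
      m ≤ ‖x' s - (closedMid L x' r + ε • closedDir L θ t' d' r)‖ := fun s hs r hr =>
    ge_of_tendsto ((hx.tendsto_at hs).sub ((hmid r hr).add ((hdir r hr).const_smul ε))).norm
      (Eventually.of_forall fun k => hmk k s hs r hr)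
  have restr : ∀ {x t d : ℝ → E3}, (∀ s ∈ Icc 0 L, ∀ r ∈ Icc 0 (L + 1),
      m ≤ ‖x s - (closedMid L x r + ε • closedDir L θ t d r)‖) →
      ∀ s ∈ Icc 0 L, ∀ r ∈ Icc 0 L, m ≤ ‖x s - (x r + ε • d r)‖ := fun h s hs r hr => by
    simpa [closedMid, closedDir, hr.2] using h s hs r ⟨hr.1, hr.2.trans (by linarith)⟩
  have restr2 : ∀ {x t d : ℝ → E3}, (∀ s ∈ Icc 0 L, ∀ r ∈ Icc 0 (L + 1),
      m ≤ ‖x s - (closedMid L x r + ε • closedDir L θ t d r)‖) →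
      ∀ s ∈ Icc 0 L, ∀ r ∈ Ioc L (L + 1),
        m ≤ ‖x s - (x 0 + ε • arcNormal (t 0) (d 0) ((1 - (r - L)) * θ))‖ := fun h s hs r hr => by
    simpa [closedMid, closedDir, not_le.2 hr.1] using h s hs r ⟨hL.trans hr.1.le, hr.2⟩
  rw [(hf'.gaussIntegral_eq hxc' hdc' hm hm').2]
  simp only [fun k => ((hf k).gaussIntegral_eq (hxc k) (hdc k) hm (hmk k)).2]
  obtain ⟨M, hM⟩ := hw.bounded
  obtain ⟨K, hK0, hK⟩ := integral_norm_le_of_eLpNorm_le (L := L) hp.le M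
  have hwi := fun k => integrable_of_eLpNorm_le hp (hM k)
  have hxb : ∃ R, ∀ k, ∀ s ∈ Icc 0 L, ‖x k s‖ ≤ R := by
    refine ⟨‖x' 0‖ + L, fun k s hs => ?_⟩
    have h1 := (hf k).primitive_x.norm_sub_sub_smul_le (c := 1) (T := 0) h0 hs fun r hr => by
      rw [sub_zero, (hf k).norm_t r (uIcc_subset_Icc h0 hs hr)]
    rw [smul_zero, sub_zero, hx0, sub_zero, abs_of_nonneg hs.1] at h1
    have h2 := norm_le_norm_add_norm_sub' (x k s) (x' 0)
    linarith [hs.2]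
  refine Tendsto.add ?_ ?_
  -- Dominated convergence in `s`. The constant bound comes from the speed `1 + 2 |ε| ‖W‖` of the
  -- second curve and the uniform `L¹` bound `K`.
  · refine tendsto_integral_of_dominated_convergence (fun _ => (L + 2 * |ε| * K) / m ^ 2)
      (fun k => ((hf k).gaussIntegral_eq (hxc k) (hdc k) hm (hmk k)).1.1) (integrable_const _)
      (fun k => ?_) ?_
    · filter_upwards [ae_restrict_mem measurableSet_Icc] with s hs
      have hbd : ∀ᵐ r ∂(arcMeasure L), ‖gauss (x k s - (x k r + ε • d k r)) (t k s)
          (t k r + ε • (W k r 2 • cross (t k r) (d k r) - W k r 1 • t k r))‖ ≤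
          (1 + 2 * |ε| * ‖W k r‖) / m ^ 2 := by
        filter_upwards [ae_restrict_mem measurableSet_Icc] with r hr
        refine (abs_gauss_le hm (restr (hmk k) s hs r hr)).trans ?_
        rw [(hf k).norm_t s hs, one_mul]
        gcongr
        refine (norm_add_le _ _).trans ?_
        rw [(hf k).norm_t r hr, norm_smul, Real.norm_eq_abs]
        have := mul_le_mul_of_nonneg_left
          (norm_strainD_le ((hf k).norm_t r hr) ((hf k).norm_d r hr) (W k r)) (abs_nonneg ε)
        linarith
      have hbi : Integrable (fun r => (1 + 2 * |ε| * ‖W k r‖) / m ^ 2) (arcMeasure L) :=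
        ((integrable_const _).add ((hwi k).norm.const_mul _)).div_const _
      refine (norm_integral_le_of_norm_le hbi hbd).trans ?_
      rw [integral_div, integral_add (integrable_const _) ((hwi k).norm.const_mul _),
        integral_const_mul]
      have hv : ∫ _ : ℝ, (1 : ℝ) ∂(arcMeasure L) = L := by simp [hL]
      rw [hv]
      have := mul_le_mul_of_nonneg_left (hK _ (hM k).1 (hM k).2) (by positivity : 0 ≤ 2 * |ε|)
      gcongr
    · filter_upwards [ae_restrict_mem measurableSet_Icc] with s hs
      exact tendsto_inner_gauss hL hp hp' hw hf hf' hx ht hd hxb hm (fun k => restr (hmk k)) hs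
  -- On the closing arc the second curve is the same for all `k`; only the midline and its tangent
  -- vary.
  · simp only [hx0, ht0, hd0]
    have hmem : ∀ᵐ z ∂((arcMeasure L).prod (volume.restrict (Ioc L (L + 1)))),
        z ∈ Icc 0 L ×ˢ Ioc L (L + 1) := by
      rw [arcMeasure, Measure.prod_restrict]
      exact ae_restrict_mem (measurableSet_Icc.prod measurableSet_Ioc)
    refine tendsto_integral_of_dominated_convergence (fun _ => |ε| * (2 * |θ|) / m ^ 2) (fun k => ?_)
      (integrable_const _) (fun k => ?_) ?_
    · have hc1 : Continuous fun r => arcNormal (t' 0) (d' 0) ((1 - (r - L)) * θ) := by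
        unfold arcNormal; fun_prop
      have hc2 := (continuous_arcNormal' L θ (t' 0) (d' 0)).const_smul ε
      have hc3 : Continuous fun r => x' 0 + ε • arcNormal (t' 0) (d' 0) ((1 - (r - L)) * θ) :=
        continuous_const.add (hc1.const_smul ε)
      exact (AEMeasurable.gauss (((hf k).primitive_x.aemeasurable hL).comp_fst.sub
        hc3.aemeasurable.comp_snd) ((hf k).primitive_t.aemeasurable hL).comp_fst
        hc2.aemeasurable.comp_snd).aestronglyMeasurable
    · filter_upwards [hmem] with z hz
      have h1 := restr2 (hmk k) z.1 hz.1 z.2 hz.2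
      rw [hx0, ht0, hd0] at h1
      refine (abs_gauss_le hm h1).trans ?_
      rw [(hf k).norm_t _ hz.1, one_mul, norm_smul, Real.norm_eq_abs]
      gcongr
      exact norm_arcNormal' θ (hf'.norm_t 0 h0) (hf'.norm_d 0 h0) _
    · filter_upwards [hmem] with z hz
      exact continuousAt_gauss (norm_pos_iff.1 (hm.trans_le (restr2 hm' z.1 hz.1 z.2 hz.2)))
        ((hx.tendsto_at hz.1).sub_const _) (ht.tendsto_at hz.1)

end LinkingLimit

/-! ### Convergence of configurations. -/

section Compactness

lemma WeakTendsto.congr {L : ℝ} {p : ℝ≥0∞} {w : ℕ → ℝ → E3} {u u' : ℝ → E3}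
    (h : WeakTendsto L p w u) (he : u =ᵐ[arcMeasure L] u') : WeakTendsto L p w u' where
  bounded := h.bounded
  integrable := h.integrable.congr he
  tendsto s hs := by
    convert h.tendsto s hs using 2
    refine (intervalIntegral.integral_congr_ae ?_).symm
    rw [EventuallyEq, arcMeasure, ae_restrict_iff' measurableSet_Icc] at he
    filter_upwards [he] with r hr hrs
    rw [uIoc_of_le hs.1] at hrs
    exact hr ⟨hrs.1.le, hrs.2.trans hs.2⟩

lemma IsPrimitive.congr_ae {F : Type*} [NormedAddCommGroup F] [NormedSpace ℝ F] {L : ℝ}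
    {f f' g' : ℝ → F} (h : IsPrimitive L f f') (he : f' =ᵐ[arcMeasure L] g') : IsPrimitive L f g' where
  integrableOn := Integrable.congr h.integrableOn he
  eq_add s hs := by
    rw [h.eq_add s hs]
    congr 1
    refine intervalIntegral.integral_congr_ae ?_
    rw [EventuallyEq, arcMeasure, ae_restrict_iff' measurableSet_Icc] at he
    filter_upwards [he] with r hr hrs
    rw [uIoc_of_le hs.1] at hrs
    exact hr ⟨hrs.1.le, hrs.2.trans hs.2⟩

lemma Framing.congr_ae {L : ℝ} {W W' x t d : ℝ → E3} (h : Framing L W x t d)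
    (he : W =ᵐ[arcMeasure L] W') : Framing L W' x t d where
  L_pos := h.L_pos
  integrableOn := Integrable.congr h.integrableOn he
  primitive_x := h.primitive_x
  primitive_t := h.primitive_t.congr_ae (by filter_upwards [he] with s hs; rw [hs])
  primitive_d := h.primitive_d.congr_ae (by filter_upwards [he] with s hs; rw [hs])
  norm_t := h.norm_t
  norm_d := h.norm_d
  inner_td := h.inner_td

namespace Rod

variable {B : Rod}

/-- Weak convergence of the strains with fixed orthonormal clamping parameters, together with the
uniform convergence of the frames. -/
structure Converges (w : ℕ → B.V) (v : B.V) : Prop where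
  norm_t₀ : ‖v.2.2.1‖ = 1
  norm_d₀ : ‖v.2.2.2‖ = 1
  inner_td₀ : inner ℝ v.2.2.1 v.2.2.2 = 0
  clamp : ∀ k, (w k).2 = v.2
  weak : WeakTendsto B.L B.p (fun k => (w k).1) v.1
  unif_x : TendstoUniformlyOn (fun k => x (w k)) (x v) atTop (Icc 0 B.L)
  unif_t : TendstoUniformlyOn (fun k => t (w k)) (t v) atTop (Icc 0 B.L)
  unif_d : TendstoUniformlyOn (fun k => d (w k)) (d v) atTop (Icc 0 B.L)

namespace Converges

variable {w : ℕ → B.V} {v : B.V}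

lemma comp (h : Converges w v) {φ : ℕ → ℕ} (hφ : Tendsto φ atTop atTop) :
    Converges (fun k => w (φ k)) v where
  norm_t₀ := h.norm_t₀
  norm_d₀ := h.norm_d₀
  inner_td₀ := h.inner_td₀
  clamp _ := h.clamp _
  weak := h.weak.comp hφ
  unif_x u hu := hφ.eventually (h.unif_x u hu)
  unif_t u hu := hφ.eventually (h.unif_t u hu)
  unif_d u hu := hφ.eventually (h.unif_d u hu)

lemma framing_limit (h : Converges w v) :
    Framing B.L v.1 (x v) (t v) (d v) ∧ x v 0 = v.2.1 ∧ t v 0 = v.2.2.1 ∧ d v 0 = v.2.2.2 :=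
  Rod.framing v h.norm_t₀ h.norm_d₀ h.inner_td₀

lemma framing (h : Converges w v) (k : ℕ) :
    Framing B.L (w k).1 (x (w k)) (t (w k)) (d (w k)) ∧ x (w k) 0 = v.2.1 ∧ t (w k) 0 = v.2.2.1 ∧
      d (w k) 0 = v.2.2.2 := by
  have := Rod.framing (w k) (by rw [h.clamp]; exact h.norm_t₀) (by rw [h.clamp]; exact h.norm_d₀)
    (by rw [h.clamp]; exact h.inner_td₀)
  rwa [h.clamp] at this

end Converges

/-- Bounded sequences of strains have convergent subsequences. -/
theorem exists_converges {w : ℕ → B.V} {x₀ t₀ d₀ : E3} (ht₀ : ‖t₀‖ = 1) (hd₀ : ‖d₀‖ = 1)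
    (htd : inner ℝ t₀ d₀ = 0) (hw : ∀ k, (w k).2 = (x₀, t₀, d₀)) {M : NNReal}
    (hM : ∀ k, eLpNorm (w k).1 B.p (arcMeasure B.L) ≤ M) :
    ∃ (φ : ℕ → ℕ) (v : B.V), StrictMono φ ∧ v.2 = (x₀, t₀, d₀) ∧ Converges (fun k => w (φ k)) v := by
  have hf : ∀ k, Framing B.L (w k).1 (x (w k)) (t (w k)) (d (w k)) ∧ x (w k) 0 = x₀ ∧
      t (w k) 0 = t₀ ∧ d (w k) 0 = d₀ := fun k => by
    have := Rod.framing (w k) (by rw [hw]; exact ht₀) (by rw [hw]; exact hd₀) (by rw [hw]; exact htd)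
    rwa [hw] at this
  obtain ⟨φ, u, x', t', d', hφ, hum, huM, hweak, hf', hx0, ht0, hd0, hx, ht, hd⟩ :=
    exists_subseq_framing B.one_lt_p B.p_lt_top hM (fun k => (hf k).1) (fun k => (hf k).2.1)
      (fun k => (hf k).2.2.1) fun k => (hf k).2.2.2
  have hu : MemLp u B.p (arcMeasure B.L) := ⟨hum, huM.trans_lt ENNReal.coe_lt_top⟩
  have hae : u =ᵐ[arcMeasure B.L] hu.toLp u := hu.coeFn_toLp.symm
  obtain ⟨hv, hv0, hv1, hv2⟩ := Rod.framing (B := B) (hu.toLp u, x₀, t₀, d₀) ht₀ hd₀ htd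
  -- The limit frame belongs to the function `u`; uniqueness identifies it with the frame selected
  -- for the class of `u` in `L^p`.
  have huniq := fun {s : ℝ} (hs : s ∈ Icc 0 B.L) => (hf'.congr_ae hae).unique hv (by rw [hx0, hv0])
    (by rw [ht0, hv1]) (by rw [hd0, hv2]) hs
  exact ⟨φ, (hu.toLp u, x₀, t₀, d₀), hφ, rfl, ht₀, hd₀, htd, fun k => hw _, hweak.congr hae,
    hx.congr_right fun s hs => (huniq hs).1, ht.congr_right fun s hs => (huniq hs).2.1,
    hd.congr_right fun s hs => (huniq hs).2.2⟩

namespace Converges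

variable {w : ℕ → B.V} {v : B.V}

lemma localNI (h : Converges w v) (hw : ∀ k, w k ∈ B.localNI) : v ∈ B.localNI :=
  localNI_of_weakTendsto h.weak hw

lemma closure (h : Converges w v) (hw : ∀ k, Closure (w k)) : Closure v := by
  have hL := B.L_pos.le
  refine ⟨tendsto_nhds_unique (h.unif_x.tendsto_at ⟨hL, le_rfl⟩) ?_, h.framing_limit.2.1⟩
  simp only [fun k => (hw k).1]
  exact h.unif_x.tendsto_at ⟨le_rfl, hL⟩

lemma clamping (h : Converges w v) (hw : ∀ k, Clamping (w k)) : Clamping v := by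
  have hL := B.L_pos.le
  refine ⟨tendsto_nhds_unique (h.unif_t.tendsto_at ⟨hL, le_rfl⟩) ?_, h.framing_limit.2.2⟩
  simp only [fun k => (hw k).1]
  exact h.unif_t.tendsto_at ⟨le_rfl, hL⟩

lemma gluing_angle (h : Converges w v) {θ : ℝ} (hw : ∀ k, d (w k) B.L = normalAt (w k) θ) :
    d v B.L = normalAt v θ := by
  refine tendsto_nhds_unique (h.unif_d.tendsto_at ⟨B.L_pos.le, le_rfl⟩) ?_
  simp only [hw, normalAt, h.clamp]
  exact tendsto_const_nhds

lemma tendstoUniformlyOn_config (h : Converges w v) :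
    TendstoUniformlyOn (fun k => config (w k)) (config v) atTop B.Ω := by
  obtain ⟨R, hR0, hR⟩ := B.exists_bound
  rw [Metric.tendstoUniformlyOn_iff]
  intro ε hε
  have hη : 0 < ε / (2 + 4 * R) := by positivity
  filter_upwards [Metric.tendstoUniformlyOn_iff.1 h.unif_x _ hη,
    Metric.tendstoUniformlyOn_iff.1 h.unif_t _ hη, Metric.tendstoUniformlyOn_iff.1 h.unif_d _ hη]
    with k hx ht hd q hq
  have hx := (hx q.1 hq.1).le
  have ht := (ht q.1 hq.1).le
  have hd := (hd q.1 hq.1).le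
  rw [dist_eq_norm] at hx ht hd ⊢
  have n1 := h.framing_limit.1.norm_t q.1 hq.1
  have n2 := (h.framing k).1.norm_d q.1 hq.1
  have hc : ‖cross (t v q.1) (d v q.1) - cross (t (w k) q.1) (d (w k) q.1)‖ ≤
      2 * (ε / (2 + 4 * R)) := by
    rw [cross_sub_cross]
    refine (norm_add_le _ _).trans ?_
    have h1 := norm_cross_le (t v q.1 - t (w k) q.1) (d v q.1)
    have h2 := norm_cross_le (t (w k) q.1) (d v q.1 - d (w k) q.1)
    rw [h.framing_limit.1.norm_d q.1 hq.1] at h1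
    rw [(h.framing k).1.norm_t q.1 hq.1] at h2
    linarith
  have e : config v q - config (w k) q = (x v q.1 - x (w k) q.1) +
      q.2.1 • (d v q.1 - d (w k) q.1) +
      q.2.2 • (cross (t v q.1) (d v q.1) - cross (t (w k) q.1) (d (w k) q.1)) := by
    unfold config; module
  rw [e]
  refine (norm_add₃_le).trans_lt ?_
  rw [norm_smul, norm_smul, Real.norm_eq_abs, Real.norm_eq_abs]
  have h1 := mul_le_mul (hR q hq).1 hd (norm_nonneg _) hR0
  have h2 := mul_le_mul (hR q hq).2 hc (norm_nonneg _) hR0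
  have h3 : (2 + 4 * R) * (ε / (2 + 4 * R)) = ε := by field_simp
  nlinarith [mul_nonneg hR0 hη.le]

/-- The volumes enclosed by convergent configurations are upper semicontinuous. -/
lemma volume_le {V : ℝ≥0∞} (h : Converges w v) (hV : ∀ c < V, ∀ᶠ k in atTop,
    c ≤ volume (config (w k) '' B.Ω)) : V ≤ volume (config v '' B.Ω) := by
  have hcomp : IsCompact (config v '' B.Ω) := B.isCompact_domain.image_of_continuousOn
    ((continuousOn_tube h.framing_limit.1).mono fun q hq => hq.1)
  refine le_of_forall_lt_imp_le_of_dense fun c hc => ?_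
  -- Uniform convergence eventually puts the images into each closed thickening of the limit image,
  -- and the volumes of the thickenings of a compact set tend to its volume.
  have hlim := tendsto_measure_cthickening_of_isCompact (μ := volume) hcomp
  refine ge_of_tendsto (hlim.mono_left (nhdsWithin_le_nhds (s := Ioi 0))) ?_
  filter_upwards [self_mem_nhdsWithin] with δ hδ
  obtain ⟨k, hk, hkc⟩ := ((Metric.tendstoUniformlyOn_iff.1 h.tendstoUniformlyOn_config δ hδ).and
    (hV c hc)).exists
  refine hkc.trans (measure_mono ?_)
  rintro _ ⟨q, hq, rfl⟩
  exact Metric.mem_cthickening_of_dist_le _ (config v q) _ _ (mem_image_of_mem _ hq)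
    (by rw [dist_comm]; exact (hk q hq).le)

end Converges

end Rod

end Compactness

/-! ### Limits of global injectivity and knot type. -/

section Volume

namespace Rod

variable {B : Rod}

/-- Integration over the cross-sections. -/
lemma exists_section_integral (B : Rod) {g : ℝ × ℝ → ℝ} (hg : Continuous g) :
    ∃ (h : ℝ → ℝ) (H : ℝ), StronglyMeasurable h ∧ (∀ s, ‖h s‖ ≤ H) ∧
      ∀ {f : ℝ → ℝ}, IntegrableOn f (Icc 0 B.L) → IntegrableOn (fun q => f q.1 * g q.2) B.Ω ∧
        ∫ q in B.Ω, f q.1 * g q.2 = ∫ s, f s * h s ∂(arcMeasure B.L) := by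
  obtain ⟨R, hR0, hR⟩ := B.exists_bound
  set Q : Set (ℝ × ℝ) := Icc (-R) R ×ˢ Icc (-R) R
  have hQ : IsCompact Q := isCompact_Icc.prod isCompact_Icc
  obtain ⟨G, hG⟩ := hQ.exists_bound_of_continuousOn hg.continuousOn
  have hm : StronglyMeasurable (B.Ω.indicator fun q : ℝ × ℝ × ℝ => g q.2) :=
    (hg.comp continuous_snd).stronglyMeasurable.indicator B.measurableSet_Ω
  -- The integral of `g` over the cross-section at `s` is bounded in `s`, because all cross-sections
  -- lie in the square `Q`.
  refine ⟨fun s => ∫ ζ, B.Ω.indicator (fun q : ℝ × ℝ × ℝ => g q.2) (s, ζ), ∫ ζ, Q.indicator (fun _ => |G|) ζ,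
    hm.integral_prod_right (f := fun s ζ => B.Ω.indicator (fun q : ℝ × ℝ × ℝ => g q.2) (s, ζ)),
    fun s => ?_, fun {f} hf => ?_⟩
  · refine norm_integral_le_of_norm_le ((integrable_indicator_iff hQ.measurableSet).2
      (integrableOn_const hQ.measure_lt_top.ne)) (Eventually.of_forall fun ζ => ?_)
    by_cases hζ : (s, ζ) ∈ B.Ω
    · have hζQ : ζ ∈ Q := (subset_box hR hζ).2
      rw [indicator_of_mem hζ, indicator_of_mem hζQ]
      exact (hG ζ hζQ).trans (le_abs_self G)
    · rw [indicator_of_notMem hζ, norm_zero]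
      exact indicator_nonneg (fun _ _ => abs_nonneg G) ζ
  · have hi : IntegrableOn (fun q : ℝ × ℝ × ℝ => f q.1 * g q.2) B.Ω :=
      (integrableOn_box_mul R hf hg).mono_set (subset_box hR)
    refine ⟨hi, ?_⟩
    have hi' := (integrable_indicator_iff B.measurableSet_Ω).2 hi
    rw [← integral_indicator B.measurableSet_Ω, Measure.volume_eq_prod, integral_prod _ hi', arcMeasure,
      ← integral_indicator measurableSet_Icc]
    refine integral_congr_ae (Eventually.of_forall fun s => ?_)
    by_cases hs : s ∈ Icc 0 B.L
    · simp only [indicator_of_mem hs, ← integral_const_mul]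
      refine integral_congr_ae (Eventually.of_forall fun ζ => ?_)
      by_cases hζ : (s, ζ) ∈ B.Ω <;> simp [hζ]
    · simp only [indicator_of_notMem hs]
      refine integral_eq_zero_of_ae (Eventually.of_forall fun ζ => ?_)
      exact indicator_of_notMem (fun hζ => hs hζ.1) _

/-- Fubini reduces the volume integral to a one-dimensional one against a bounded function of `s`,
which weak convergence can test. -/
lemma tendsto_integral_section {w : ℕ → ℝ → E3} {u : ℝ → E3} (hw : WeakTendsto B.L B.p w u) {g : ℝ × ℝ → ℝ}
    (hg : Continuous g) (i : Fin 3) :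
    Tendsto (fun k => ∫ q in B.Ω, w k q.1 i * g q.2) atTop (𝓝 (∫ q in B.Ω, u q.1 i * g q.2)) := by
  obtain ⟨h, H, hm, hb, hh⟩ := B.exists_section_integral hg
  obtain ⟨M, hM⟩ := hw.bounded
  have hwi : ∀ k, IntegrableOn (w k) (Icc 0 B.L) := fun k => integrable_of_eLpNorm_le B.one_lt_p (hM k)
  rw [(hh (integrableOn_apply hw.integrable i)).2]
  simp only [fun k => (hh (integrableOn_apply (hwi k) i)).2]
  have key := hw.tendsto_integral_clm (F := ℝ) B.L_pos.le B.one_lt_p B.p_lt_top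
    (h := fun s => h s • (EuclideanSpace.proj (𝕜 := ℝ) i : E3 →L[ℝ] ℝ))
    (H := H * ‖(EuclideanSpace.proj (𝕜 := ℝ) i : E3 →L[ℝ] ℝ)‖)
    (hm.smul_const _).aestronglyMeasurable (Eventually.of_forall fun s => by
      rw [norm_smul]
      exact mul_le_mul_of_nonneg_right (hb s) (norm_nonneg _))
  simpa [mul_comm] using key

lemma tendsto_integral_tubeJac {w : ℕ → ℝ → E3} {u : ℝ → E3} (hw : WeakTendsto B.L B.p w u) :
    Tendsto (fun k => ∫ q in B.Ω, tubeJac (w k) q) atTop (𝓝 (∫ q in B.Ω, tubeJac u q)) := by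
  obtain ⟨M, hM⟩ := hw.bounded
  have hwi : ∀ k, IntegrableOn (w k) (Icc 0 B.L) := fun k => integrable_of_eLpNorm_le B.one_lt_p (hM k)
  have e : ∀ {W : ℝ → E3}, IntegrableOn W (Icc 0 B.L) → ∫ q in B.Ω, tubeJac W q =
      (∫ _ in B.Ω, (1 : ℝ)) - (∫ q in B.Ω, W q.1 1 * q.2.1) + ∫ q in B.Ω, W q.1 0 * q.2.2 := by
    intro W hW
    have h1 : IntegrableOn (fun _ : ℝ × ℝ × ℝ => (1 : ℝ)) B.Ω :=
      integrableOn_const B.isCompact_domain.measure_lt_top.ne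
    obtain ⟨_, _, _, _, h2⟩ := B.exists_section_integral (g := fun ζ => ζ.1) continuous_fst
    obtain ⟨_, _, _, _, h3⟩ := B.exists_section_integral (g := fun ζ => ζ.2) continuous_snd
    have i2 := (h2 (integrableOn_apply hW 1)).1
    have i3 := (h3 (integrableOn_apply hW 0)).1
    have i4 : IntegrableOn (fun q : ℝ × ℝ × ℝ => 1 - W q.1 1 * q.2.1) B.Ω := h1.sub i2
    rw [← integral_sub h1 i2, ← integral_add i4 i3]
    refine integral_congr_ae (Eventually.of_forall fun q => ?_)
    simp [tubeJac, mul_comm]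
  rw [e hw.integrable]
  simp only [fun k => e (hwi k)]
  exact (tendsto_const_nhds.sub (tendsto_integral_section hw (g := fun ζ => ζ.1) continuous_fst 1)).add
    (tendsto_integral_section hw (g := fun ζ => ζ.2) continuous_snd 0)

lemma globalInj_iff (w : B.V) : GlobalInj w ↔
    ENNReal.ofReal (∫ q in B.Ω, tubeJac w.1 q) ≤ volume (config w '' B.Ω) := by
  rw [GlobalInj, EuclideanSpace.euclideanHausdorffMeasure_eq_volume]
  rfl

lemma Converges.globalInj {w : ℕ → B.V} {v : B.V} (h : Converges w v) (hw : ∀ k, GlobalInj (w k)) :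
    GlobalInj v := by
  rw [globalInj_iff]
  -- The Jacobian integrals converge, being affine in the strains, so the images eventually have
  -- volume at least `c`.
  refine h.volume_le fun c hc => ?_
  have hlim := (ENNReal.continuous_ofReal.tendsto _).comp (tendsto_integral_tubeJac h.weak)
  filter_upwards [hlim.eventually (lt_mem_nhds hc)] with k hk
  exact hk.le.trans ((globalInj_iff _).1 (hw k))

/-- The closed midline of a configuration without interpenetration satisfies a chord-arc estimate. -/
lemma exists_chordArc_of_globalInj {v : B.V} (hf : Framing B.L v.1 (x v) (t v) (d v)) (hN : v ∈ B.localNI)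
    (hG : GlobalInj v) (hx : x v B.L = x v 0) (ht : t v B.L = t v 0) :
    ∃ c > 0, ∀ s ∈ Icc 0 B.L, ∀ s' ∈ Icc 0 B.L, c * arcDist B.L s s' ≤ ‖x v s - x v s'‖ :=
  exists_chordArc B.L_pos hf.primitive_x (hf.primitive_t.continuousOn B.L_pos.le) hf.norm_t hx ht
    fun _ hs _ hs' hne => midline_ne hf (B.tubeJac_nonneg hN) ((globalInj_iff v).1 hG) hs hs' hne

/-- One member of the sequence whose tangent is close to the limit tangent suffices: its isotopy to
`ℓ` is preceded by the small isotopy from `x v`. -/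
lemma Converges.isotopic {w : ℕ → B.V} {v : B.V} (h : Converges w v) {c : ℝ} (hc0 : 0 < c)
    (hc : ∀ s ∈ Icc 0 B.L, ∀ s' ∈ Icc 0 B.L, c * arcDist B.L s s' ≤ ‖x v s - x v s'‖)
    (hx : x v B.L = x v 0) (hw : ∀ k, Closure (w k)) {ℓ : ℝ → E3} (hℓ : ∀ k, Isotopic B.L (x (w k)) ℓ) :
    Isotopic B.L (x v) ℓ := by
  obtain ⟨ε, hε, hiso⟩ := exists_isotopic_of_close h.framing_limit.1.primitive_x hx hc0 hc
  obtain ⟨k, hk⟩ := (Metric.tendstoUniformlyOn_iff.1 h.unif_t ε hε).exists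
  refine hiso (h.framing k).1.primitive_x (hw k).1 (fun s hs => ?_) (hℓ k)
  rw [← dist_eq_norm, dist_comm]
  exact (hk s hs).le

end Rod

end Volume

/-! ### The link type in the limit. -/

section LinkingLimit

namespace Rod

variable {B : Rod} {θ ε₀ ε : ℝ}

/-- The closed midline does not meet the closed curves at distance `ε < ε₀` from it. -/
structure Separated (θ ε₀ : ℝ) (w : B.V) : Prop where
  framing : Framing B.L w.1 (x w) (t w) (d w) ∧ x w 0 = w.2.1 ∧ t w 0 = w.2.2.1 ∧ d w 0 = w.2.2.2
  closed_x : x w B.L = x w 0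
  angle : d w B.L = normalAt w θ
  ne : ∀ ε ∈ Ioo 0 ε₀, ∀ s ∈ Icc 0 B.L, ∀ u ∈ Icc 0 (B.L + 1),
    x w s ≠ closedMid B.L (x w) u + ε • closedDir B.L θ (t w) (d w) u

/-- The Gauss double integral of the midline and the closed curve at distance `ε`. -/
def linkGauss (θ ε : ℝ) (w : B.V) : ℝ :=
  gaussIntegral B.L (B.L + 1) (x w) (t w)
    (fun r => closedMid B.L (x w) r + ε • closedDir B.L θ (t w) (d w) r)
    (fun r => closedMid' B.L (t w) r + ε • closedDir' B.L θ w.1 (t w) (d w) r)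

namespace Separated

variable {w : B.V}

lemma angle' (h : Separated θ ε₀ w) : d w B.L = arcNormal (t w 0) (d w 0) θ := by
  rw [h.angle, h.framing.2.2.1, h.framing.2.2.2]; rfl

lemma shifted_eq (h : Separated θ ε₀ w) (ε : ℝ) :
    shifted w θ ε = fun r => closedMid B.L (x w) r + ε • closedDir B.L θ (t w) (d w) r := by
  ext1 u
  unfold shifted closedMid closedDir
  split_ifs
  · rfl
  · rw [h.framing.2.1, h.framing.2.2.1, h.framing.2.2.2]; rfl

lemma exists_pos_le (h : Separated θ ε₀ w) (hε : ε ∈ Ioo 0 ε₀) : ∃ m > 0, ∀ s ∈ Icc 0 B.L,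
    ∀ u ∈ Icc 0 (B.L + 1),
      m ≤ ‖x w s - (closedMid B.L (x w) u + ε • closedDir B.L θ (t w) (d w) u)‖ := by
  have hL := B.L_pos.le
  have hf := h.framing.1
  have hM : 0 ≤ B.L + 1 := by linarith
  obtain ⟨m, hm, hmin⟩ := exists_pos_le_norm_sub hL hM (hf.primitive_x.continuousOn hL)
    ((hf.isPrimitive_closedMid h.closed_x).continuousOn hM)
    ((hf.isPrimitive_closedDir h.angle').continuousOn hM) (le_refl ε)
    fun η hη => h.ne η (by rw [Icc_self, mem_singleton_iff] at hη; subst hη; exact hε)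
  exact ⟨m, hm, hmin ε ⟨le_rfl, le_rfl⟩⟩

lemma linkingNumber_eq (h : Separated θ ε₀ w) (hε : ε ∈ Ioo 0 ε₀) :
    linkingNumber (x w) (shifted w θ ε) B.L (B.L + 1) = 1 / (4 * Real.pi) * linkGauss θ ε w := by
  obtain ⟨m, hm, hmin⟩ := h.exists_pos_le hε
  have hL := B.L_pos.le
  have hf := h.framing.1
  rw [h.shifted_eq]
  exact KirchhoffRod.linkingNumber_eq hL (by linarith) hf.primitive_x
    ((hf.isPrimitive_closedMid h.closed_x).add_smul (hf.isPrimitive_closedDir h.angle') ε) hm hmin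

lemma linkGauss_const (h : Separated θ ε₀ w) (hε : ε ∈ Ioo 0 ε₀) {ε' : ℝ} (hε' : ε' ∈ Ioo 0 ε₀) :
    linkGauss θ ε w = linkGauss θ ε' w := by
  have hL := B.L_pos.le
  have hf := h.framing.1
  exact gaussIntegral_const hL (by linarith) hf.primitive_x (hf.isPrimitive_closedMid h.closed_x)
    (hf.isPrimitive_closedDir h.angle') h.closed_x hf.closedMid_closed hf.closedDir_closed hε hε' h.ne

/-- Constancy in `ε` replaces the condition for all small `ε`, a range that might shrink along a
sequence, by a condition on the whole interval `(0, ε₀)`. -/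
lemma gluing_iff (h : Separated θ ε₀ w) {n : ℤ} (hε₀ : 0 < ε₀) : Gluing θ n w ↔
    ∀ ε ∈ Ioo 0 ε₀, 1 / (4 * Real.pi) * linkGauss θ ε w = n := by
  have hmem : ∀ᶠ ε in 𝓝[>] (0 : ℝ), ε ∈ Ioo 0 ε₀ := Ioo_mem_nhdsGT hε₀
  constructor
  · intro hG ε hε
    obtain ⟨ε', hε', h'⟩ := (hmem.and hG.2).exists
    rw [h.linkGauss_const hε hε', ← h.linkingNumber_eq hε', h'.2]
  · intro hG
    refine ⟨h.angle, ?_⟩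
    filter_upwards [hmem] with ε hε
    refine ⟨?_, by rw [h.linkingNumber_eq hε, hG ε hε]⟩
    rw [h.shifted_eq, Set.disjoint_left]
    rintro _ ⟨s, hs, rfl⟩ ⟨u, hu, e⟩
    exact h.ne ε hε s hs u hu e.symm

end Separated

namespace Converges

variable {w : ℕ → B.V} {v : B.V}

/-- From some index on, the curves keep half of the distance `m` that separates those of the limit.
This is the uniform bound that the convergence of Gauss integrals needs. -/
lemma tendsto_linkGauss (h : Converges w v) (hw : ∀ k, Separated θ ε₀ (w k)) (hv : Separated θ ε₀ v)
    (hε : ε ∈ Ioo 0 ε₀) : Tendsto (fun k => linkGauss θ ε (w k)) atTop (𝓝 (linkGauss θ ε v)) := by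
  obtain ⟨m, hm, hmin⟩ := hv.exists_pos_le hε
  -- The denominator counts two midline errors and one director error multiplied by `ε`.
  have hη : 0 < m / 2 / (2 + ε) := by have := hε.1; positivity
  have hx0 : ∀ k, x (w k) 0 = x v 0 := fun k => by rw [(h.framing k).2.1, h.framing_limit.2.1]
  have ht0 : ∀ k, t (w k) 0 = t v 0 := fun k => by rw [(h.framing k).2.2.1, h.framing_limit.2.2.1]
  have hd0 : ∀ k, d (w k) 0 = d v 0 := fun k => by rw [(h.framing k).2.2.2, h.framing_limit.2.2.2]
  obtain ⟨K, hK⟩ := eventually_atTop.1 ((Metric.tendstoUniformlyOn_iff.1 h.unif_x _ hη).and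
    (Metric.tendstoUniformlyOn_iff.1 h.unif_d _ hη))
  rw [← tendsto_add_atTop_iff_nat K]
  have h' := h.comp (tendsto_add_atTop_nat K)
  refine tendsto_gaussIntegral B.one_lt_p B.p_lt_top h'.weak (fun k => (h'.framing k).1)
    h'.framing_limit.1 h'.unif_x h'.unif_t h'.unif_d (fun k => hx0 _) (fun k => ht0 _) (fun k => hd0 _)
    (fun k => (hw _).closed_x) hv.closed_x (fun k => (hw _).angle') hv.angle' (half_pos hm)
    fun k s hs u hu => ?_
  obtain ⟨kx, kd⟩ := hK (k + K) (Nat.le_add_left _ _)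
  have e1 : ‖closedMid B.L (x v) u - closedMid B.L (x (w (k + K))) u‖ ≤ m / 2 / (2 + ε) := by
    unfold closedMid
    split_ifs with huL
    · rw [← dist_eq_norm]; exact (kx u ⟨hu.1, huL⟩).le
    · rw [hx0, sub_self, norm_zero]; exact hη.le
  have e2 : ‖closedDir B.L θ (t v) (d v) u - closedDir B.L θ (t (w (k + K))) (d (w (k + K))) u‖ ≤
      m / 2 / (2 + ε) := by
    unfold closedDir
    split_ifs with huL
    · rw [← dist_eq_norm]; exact (kd u ⟨hu.1, huL⟩).le
    · rw [ht0, hd0, sub_self, norm_zero]; exact hη.le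
  have e0 : ‖x v s - x (w (k + K)) s‖ ≤ m / 2 / (2 + ε) := by rw [← dist_eq_norm]; exact (kx s hs).le
  have e3 := hmin s hs u hu
  have e : x v s - (closedMid B.L (x v) u + ε • closedDir B.L θ (t v) (d v) u) =
      (x (w (k + K)) s - (closedMid B.L (x (w (k + K))) u +
        ε • closedDir B.L θ (t (w (k + K))) (d (w (k + K))) u)) + (x v s - x (w (k + K)) s) +
      -((closedMid B.L (x v) u - closedMid B.L (x (w (k + K))) u) +
        ε • (closedDir B.L θ (t v) (d v) u - closedDir B.L θ (t (w (k + K))) (d (w (k + K))) u)) := by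
    module
  rw [e] at e3
  have e4 := e3.trans norm_add₃_le
  have e5 := norm_add_le (closedMid B.L (x v) u - closedMid B.L (x (w (k + K))) u)
    (ε • (closedDir B.L θ (t v) (d v) u - closedDir B.L θ (t (w (k + K))) (d (w (k + K))) u))
  rw [norm_smul, Real.norm_eq_abs, abs_of_pos hε.1] at e5
  rw [norm_neg] at e4
  have e6 := mul_le_mul_of_nonneg_left e2 hε.1.le
  have e7 : (2 + ε) * (m / 2 / (2 + ε)) = m / 2 := by have := hε.1; field_simp
  linarith

/-- The gluing conditions are preserved in the limit. -/
lemma gluing (h : Converges w v) {n : ℤ} {c : ℝ} (hc0 : 0 < c)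
    (hc : ∀ s ∈ Icc 0 B.L, ∀ s' ∈ Icc 0 B.L, c * arcDist B.L s s' ≤ ‖x v s - x v s'‖)
    (hcl : ∀ k, Closure (w k)) (hct : ∀ k, Clamping (w k)) (hw : ∀ k, Gluing θ n (w k)) :
    Gluing θ n v := by
  have hL := B.L_pos.le
  have hf := h.framing_limit.1
  obtain ⟨δ, hδ, hδt⟩ := Metric.uniformContinuousOn_iff.1
    (isCompact_Icc.uniformContinuousOn_of_continuous (hf.primitive_t.continuousOn hL)) (1 / 8) (by norm_num)
  have hδt' : ∀ r ∈ Icc 0 B.L, ∀ s ∈ Icc 0 B.L, |r - s| < δ → ‖t v r - t v s‖ ≤ 1 / 8 :=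
    fun r hr s hs hrs => by rw [← dist_eq_norm]; exact (hδt r hr s hs hrs).le
  -- Closeness `c / 2` keeps half of the chord-arc constant, and 1/16 + 1/8 + 1/16 = 1/4 is the
  -- tangent oscillation allowed in `ne_closed`. One `ε₀ = c / 2 * δ` then serves the limit and the
  -- tail of the sequence.
  obtain ⟨K, hK⟩ := eventually_atTop.1 ((Metric.tendstoUniformlyOn_iff.1 h.unif_t (c / 2) (half_pos hc0)).and
    (Metric.tendstoUniformlyOn_iff.1 h.unif_t (1 / 16) (by norm_num)))
  have hε₀ : 0 < c / 2 * δ := by positivity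
  have hvs : Separated θ (c / 2 * δ) v := ⟨h.framing_limit, (h.closure hcl).1,
    h.gluing_angle fun k => (hw k).1, fun ε hε s hs u hu => hf.ne_closed (h.closure hcl).1
      (h.clamping hct).1 (half_pos hc0) (fun s hs s' hs' => by
        refine le_trans ?_ (hc s hs s' hs')
        exact mul_le_mul_of_nonneg_right (by linarith) (arcDist_nonneg hs hs'))
      (fun r hr s hs hrs => (hδt' r hr s hs hrs).trans (by norm_num)) hε hs hu⟩
  have h' := h.comp (tendsto_add_atTop_nat K)
  have hws : ∀ k, Separated θ (c / 2 * δ) (w (k + K)) := fun k => by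
    obtain ⟨k1, k2⟩ := hK (k + K) (Nat.le_add_left _ _)
    refine ⟨?_, (hcl _).1, (hw _).1, fun ε hε s hs u hu => (h.framing _).1.ne_closed (hcl _).1
      (hct _).1 (half_pos hc0) (fun s hs s' hs' => chordArc_of_close hf.primitive_x
        (h.framing _).1.primitive_x (h.closure hcl).1 (hcl _).1 hc (fun s hs => ?_) hs hs')
      (fun r hr s hs hrs => ?_) hε hs hu⟩
    · rw [h.clamp]; exact h.framing _
    · rw [← dist_eq_norm, dist_comm]; exact (k1 s hs).le
    · have e1 := (k2 r hr).le
      have e2 := (k2 s hs).le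
      have e3 := hδt' r hr s hs hrs
      rw [← dist_eq_norm] at e3 ⊢
      have e4 := dist_triangle4 (t (w (k + K)) r) (t v r) (t v s) (t (w (k + K)) s)
      rw [dist_comm (t (w (k + K)) r) (t v r)] at e4
      linarith
  refine (hvs.gluing_iff hε₀).2 fun ε hε => ?_
  refine tendsto_nhds_unique ((h'.tendsto_linkGauss hws hvs hε).const_mul _) ?_
  simp only [fun k => ((hws k).gluing_iff hε₀).1 (hw (k + K)) ε hε]
  exact tendsto_const_nhds

/-- The admissible configurations without local interpenetration are closed under weak convergence. -/
theorem mem_admissible (h : Converges w v) {x₀ t₀ d₀ : E3} {n : ℤ} {ℓ : ℝ → E3}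
    (hw : ∀ k, w k ∈ B.admissible x₀ t₀ d₀ θ n ℓ) (hN : ∀ k, w k ∈ B.localNI) :
    v ∈ B.admissible x₀ t₀ d₀ θ n ℓ := by
  have hcl := fun k => (hw k).2.1
  have hct := fun k => (hw k).2.2.1
  have hG := h.globalInj fun k => (hw k).2.2.2.2.1
  obtain ⟨c, hc0, hc⟩ := exists_chordArc_of_globalInj h.framing_limit.1 (h.localNI hN) hG
    (h.closure hcl).1 (h.clamping hct).1
  exact ⟨by rw [← h.clamp 0, (hw 0).1], h.closure hcl, h.clamping hct,
    h.gluing hc0 hc hcl hct fun k => (hw k).2.2.2.1, hG,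
    h.isotopic hc0 hc (h.closure hcl).1 hcl fun k => (hw k).2.2.2.2.2⟩

end Converges

end Rod

end LinkingLimit

/-! ### Existence of minimizers. -/

section Minimization

namespace Rod

variable {B : Rod}

/-- The midline has length `L` and the cross-sections are bounded, so the bound is independent of
the strains. -/
lemma exists_norm_config_le (B : Rod) : ∃ R : ℝ, 0 ≤ R ∧ ∀ {w : B.V}, ‖w.2.2.1‖ = 1 → ‖w.2.2.2‖ = 1 →
    inner ℝ w.2.2.1 w.2.2.2 = 0 → ∀ q ∈ B.Ω, ‖config w q‖ ≤ ‖w.2.1‖ + R := by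
  obtain ⟨R, hR0, hR⟩ := B.exists_bound
  have hL := B.L_pos.le
  refine ⟨B.L + R + R, by positivity, fun {w} ht hd htd q hq => ?_⟩
  obtain ⟨hf, hx0, -, -⟩ := Rod.framing w ht hd htd
  have h0 : (0 : ℝ) ∈ Icc 0 B.L := ⟨le_rfl, hL⟩
  have h1 := hf.primitive_x.norm_sub_sub_smul_le (c := 1) (T := 0) h0 hq.1 fun r hr => by
    rw [sub_zero, hf.norm_t r (uIcc_subset_Icc h0 hq.1 hr)]
  rw [smul_zero, sub_zero, hx0, sub_zero, abs_of_nonneg hq.1.1, one_mul] at h1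
  have h2 : ‖x w q.1‖ ≤ ‖w.2.1‖ + B.L := by
    have := norm_le_norm_add_norm_sub' (x w q.1) w.2.1
    linarith [hq.1.2]
  refine norm_add₃_le.trans ?_
  rw [norm_smul, norm_smul, hf.norm_d _ hq.1, hf.norm_cross hq.1, Real.norm_eq_abs, Real.norm_eq_abs]
  linarith [(hR q hq).1, (hR q hq).2]

lemma aestronglyMeasurable_weight {w : B.V} (hf : Framing B.L w.1 (x w) (t w) (d w)) :
    AEStronglyMeasurable (fun q => B.ρ q * inner ℝ B.g (config w q)) (volume.restrict B.Ω) := by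
  have hc : ContinuousOn (config w) B.Ω := (continuousOn_tube hf).mono fun q hq => hq.1
  exact B.integrable_ρ.aestronglyMeasurable.mul
    ((continuousOn_const.inner hc).aestronglyMeasurable B.measurableSet_Ω)

lemma norm_weight_le {w : B.V} {q : ℝ × ℝ × ℝ} {R : ℝ} (hq : ‖config w q‖ ≤ R) :
    ‖B.ρ q * inner ℝ B.g (config w q)‖ ≤ ‖B.ρ q‖ * (‖B.g‖ * R) := by
  rw [norm_mul]
  gcongr
  refine (norm_inner_le_norm _ _).trans ?_
  gcongr

lemma exists_abs_Eg_le (B : Rod) {x₀ t₀ d₀ : E3} (ht₀ : ‖t₀‖ = 1) (hd₀ : ‖d₀‖ = 1)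
    (htd : inner ℝ t₀ d₀ = 0) : ∃ G : ℝ, ∀ w : B.V, w.2 = (x₀, t₀, d₀) → |Eg w| ≤ G := by
  obtain ⟨R, hR0, hR⟩ := B.exists_norm_config_le
  refine ⟨∫ q in B.Ω, ‖B.ρ q‖ * (‖B.g‖ * (‖x₀‖ + R)), fun w hw => ?_⟩
  rw [Eg, abs_neg, ← Real.norm_eq_abs]
  refine norm_integral_le_of_norm_le (B.integrable_ρ.norm.mul_const _) ?_
  filter_upwards [ae_restrict_mem B.measurableSet_Ω] with q hq
  refine norm_weight_le ?_
  have := hR (w := w) (by rw [hw]; exact ht₀) (by rw [hw]; exact hd₀) (by rw [hw]; exact htd) q hq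
  rwa [hw] at this

lemma Converges.tendsto_Eg {w : ℕ → B.V} {v : B.V} (h : Converges w v) :
    Tendsto (fun k => Eg (w k)) atTop (𝓝 (Eg v)) := by
  obtain ⟨R, hR0, hR⟩ := B.exists_norm_config_le
  refine Tendsto.neg (tendsto_integral_of_dominated_convergence
    (fun q => ‖B.ρ q‖ * (‖B.g‖ * (‖v.2.1‖ + R))) (fun k => aestronglyMeasurable_weight (h.framing k).1)
    (B.integrable_ρ.norm.mul_const _) (fun k => ?_) ?_)
  · filter_upwards [ae_restrict_mem B.measurableSet_Ω] with q hq
    refine norm_weight_le ?_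
    have := hR (w := w k) (by rw [h.clamp]; exact h.norm_t₀) (by rw [h.clamp]; exact h.norm_d₀)
      (by rw [h.clamp]; exact h.inner_td₀) q hq
    rwa [h.clamp] at this
  · filter_upwards [ae_restrict_mem B.measurableSet_Ω] with q hq
    exact (tendsto_const_nhds.inner (h.tendstoUniformlyOn_config.tendsto_at hq)).const_mul _

/-- The loop energy on `localNI`, shifted to a nonnegative quantity. -/
def shiftLoop (B : Rod) (c G : ℝ) (w : B.V) : ℝ≥0∞ :=
  B.shiftEnergy c w.1 + ENNReal.ofReal (Eg w + G)

/-- Adding constants turns the energy into an `ℝ≥0∞`-valued one with the same order, so that infima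
and limits avoid `⊤ - ⊤`. -/
lemma Eloop_eq_of_mem {c G : ℝ} (hc0 : 0 ≤ c)
    (hc : ∀ s ∈ Icc 0 B.L, ∀ a, ((-c : ℝ) : EReal) ≤ B.f a s) {w : B.V} (hw : w ∈ B.localNI)
    (hG : |Eg w| ≤ G) :
    Eloop w = (B.shiftLoop c G w : EReal) - ((c * B.L + G : ℝ) : EReal) := by
  have h0 : 0 ≤ Eg w + G := by linarith [neg_abs_le (Eg w)]
  rw [Eloop, Eni, if_pos hw, add_zero, Esh_eq w hc0 hc, shiftLoop, EReal.coe_ennreal_add,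
    EReal.coe_ennreal_ofReal, max_eq_left h0]
  generalize B.shiftEnergy c w.1 = a
  induction a using ENNReal.recTopCoe with
  | top =>
    rw [EReal.coe_ennreal_top, EReal.top_sub_coe, EReal.top_add_coe, EReal.top_add_coe,
      EReal.top_sub_coe]
  | coe a =>
    rw [show ((a : ℝ≥0∞) : EReal) = ((a : ℝ) : EReal) from rfl]
    norm_cast
    ring

/-- The shape energy is never `⊥`, which would absorb the `⊤` of `Eni`. -/
lemma Eloop_eq_of_notMem {c : ℝ} (hc0 : 0 ≤ c)
    (hc : ∀ s ∈ Icc 0 B.L, ∀ a, ((-c : ℝ) : EReal) ≤ B.f a s) {w : B.V} (hw : w ∉ B.localNI) :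
    Eloop w = ⊤ := by
  rw [Eloop, Eni, if_neg hw, Esh_eq w hc0 hc]
  generalize B.shiftEnergy c w.1 = a
  induction a using ENNReal.recTopCoe with
  | top => rw [EReal.coe_ennreal_top, EReal.top_sub_coe, EReal.top_add_top, EReal.top_add_coe]
  | coe a =>
    rw [show ((a : ℝ≥0∞) : EReal) = ((a : ℝ) : EReal) from rfl, ← EReal.coe_sub, EReal.coe_add_top, EReal.top_add_coe]

/-- Minimizing sequences have subsequences converging to minimizers. -/
theorem exists_shiftLoop_le {x₀ t₀ d₀ : E3} (ht₀ : ‖t₀‖ = 1) (hd₀ : ‖d₀‖ = 1)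
    (htd : inner ℝ t₀ d₀ = 0) {θ : ℝ} {n : ℤ} {ℓ : ℝ → E3} {c C₁ G : ℝ} (hC₁ : 0 < C₁)
    (hc : ∀ s ∈ Icc 0 B.L, ∀ a, ((-c : ℝ) : EReal) ≤ B.f a s)
    (hgrowth : ∀ s ∈ Icc 0 B.L, ∀ a : E3, ((C₁ * ‖a‖ ^ B.p.toReal : ℝ) : EReal) ≤ B.f a s + c)
    (hfin : ∃ w ∈ B.admissible x₀ t₀ d₀ θ n ℓ ∩ B.localNI, B.shiftLoop c G w ≠ ⊤) :
    ∃ v ∈ B.admissible x₀ t₀ d₀ θ n ℓ ∩ B.localNI,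
      ∀ w ∈ B.admissible x₀ t₀ d₀ θ n ℓ ∩ B.localNI, B.shiftLoop c G v ≤ B.shiftLoop c G w := by
  obtain ⟨w₀, hw₀, hw₀fin⟩ := hfin
  set S := B.admissible x₀ t₀ d₀ θ n ℓ ∩ B.localNI
  set m := sInf (B.shiftLoop c G '' S)
  have hm : m < ⊤ := (sInf_le (mem_image_of_mem _ hw₀)).trans_lt (lt_top_iff_ne_top.2 hw₀fin)
  obtain ⟨y, -, hy, hyS⟩ := exists_seq_tendsto_sInf (S := B.shiftLoop c G '' S) ⟨_, mem_image_of_mem _ hw₀⟩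
    (OrderBot.bddBelow _)
  choose w hwS hwy using hyS
  -- Past `K` the energies are below `m + 1`, which bounds the strains in `L^p`.
  obtain ⟨K, hK⟩ := eventually_atTop.1 (hy.eventually (gt_mem_nhds
    (ENNReal.lt_add_right hm.ne one_ne_zero)))
  obtain ⟨M, hM⟩ := B.eLpNorm_le_of_shiftEnergy_le hC₁ hgrowth (m + 1).toNNReal
  have hMw : ∀ k, eLpNorm (w (k + K)).1 B.p (arcMeasure B.L) ≤ M := fun k => by
    refine hM _ ?_
    rw [ENNReal.coe_toNNReal (ENNReal.add_ne_top.2 ⟨hm.ne, ENNReal.one_ne_top⟩)]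
    exact le_self_add.trans ((hwy _).le.trans (hK _ (Nat.le_add_left _ _)).le)
  obtain ⟨φ, v, hφ, -, hconv⟩ := exists_converges ht₀ hd₀ htd (fun k => (hwS (k + K)).1.1) hMw
  have hvS : v ∈ S := ⟨hconv.mem_admissible (fun k => (hwS _).1) fun k => (hwS _).2,
    hconv.localNI fun k => (hwS _).2⟩
  have hJ : Tendsto (fun k => B.shiftLoop c G (w (φ k + K))) atTop (𝓝 m) := by
    simp only [hwy]
    exact hy.comp ((tendsto_add_atTop_nat K).comp hφ.tendsto_atTop)
  have he : Tendsto (fun k => ENNReal.ofReal (Eg (w (φ k + K)) + G)) atTop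
      (𝓝 (ENNReal.ofReal (Eg v + G))) :=
    (ENNReal.continuous_ofReal.tendsto _).comp (hconv.tendsto_Eg.add_const G)
  have hem : ENNReal.ofReal (Eg v + G) ≤ m := le_of_tendsto_of_tendsto' he hJ fun k => le_add_self
  have hsub := ENNReal.Tendsto.sub hJ he (Or.inl hm.ne)
  -- The weight term converges, so the shape energies converge to `m` minus its limit, and only they
  -- need lower semicontinuity.
  have hle : B.shiftEnergy c v.1 ≤ m - ENNReal.ofReal (Eg v + G) := by
    refine shiftEnergy_le_of_weakTendsto hc hconv.weak fun T' hT' => ?_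
    filter_upwards [hsub.eventually (gt_mem_nhds hT')] with k hk
    rw [shiftLoop, ENNReal.add_sub_cancel_right ENNReal.ofReal_ne_top] at hk
    exact hk.le
  refine ⟨v, hvS, fun u hu => le_trans ?_ (sInf_le (mem_image_of_mem _ hu))⟩
  calc B.shiftLoop c G v ≤ m - ENNReal.ofReal (Eg v + G) + ENNReal.ofReal (Eg v + G) := by
        rw [shiftLoop]; gcongr
    _ = m := tsub_add_cancel_of_le hem

/-- Existence of minimizers of the loop energy. -/
theorem exists_isMinOn_Eloop (B : Rod) (ℓ : ℝ → E3) (θ : ℝ) (n : ℤ) {x₀ t₀ d₀ : E3} (ht₀ : ‖t₀‖ = 1)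
    (hd₀ : ‖d₀‖ = 1) (htd : inner ℝ t₀ d₀ = 0)
    (hfin : ∃ w ∈ B.admissible x₀ t₀ d₀ θ n ℓ, Eloop w < ⊤) :
    ∃ w ∈ B.admissible x₀ t₀ d₀ θ n ℓ,
      IsMinOn (fun v : B.V => Eloop v) (B.admissible x₀ t₀ d₀ θ n ℓ) w := by
  obtain ⟨c, C₁, hc0, hC₁, hc, hgrowth⟩ := B.exists_lower_bound
  obtain ⟨G, hG⟩ := B.exists_abs_Eg_le (x₀ := x₀) ht₀ hd₀ htd
  obtain ⟨w₀, hw₀, hlt⟩ := hfin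
  have hN₀ : w₀ ∈ B.localNI := by
    by_contra hN
    exact hlt.ne (Eloop_eq_of_notMem hc0 hc hN)
  obtain ⟨v, hv, hmin⟩ := exists_shiftLoop_le (G := G) ht₀ hd₀ htd hC₁ hc hgrowth
    ⟨w₀, ⟨hw₀, hN₀⟩, fun htop => by
      rw [Eloop_eq_of_mem hc0 hc hN₀ (hG _ hw₀.1), htop, EReal.coe_ennreal_top,
        EReal.top_sub_coe] at hlt
      exact lt_irrefl _ hlt⟩
  refine ⟨v, hv.1, fun u hu => ?_⟩
  by_cases hN : u ∈ B.localNI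
  · simp only [mem_ofPred_eq]
    rw [Eloop_eq_of_mem hc0 hc hv.2 (hG _ hv.1.1), Eloop_eq_of_mem hc0 hc hN (hG _ hu.1)]
    exact EReal.sub_le_sub (EReal.coe_ennreal_le_coe_ennreal_iff.2 (hmin u ⟨hu, hN⟩)) le_rfl
  · simp only [mem_ofPred_eq]
    rw [Eloop_eq_of_notMem hc0 hc hN]
    exact le_top

end Rod

end Minimization

end

end KirchhoffRod

theorem mainTheorem3 (B : KirchhoffRod.Rod) (ℓ : ℝ → KirchhoffRod.E3)
    (hℓ : ContinuousOn ℓ (Set.Icc 0 B.L)) (hℓ_closed : ℓ B.L = ℓ 0)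
    (θ : ℝ) (n : ℤ) (x₀ t₀ d₀ : KirchhoffRod.E3)
    (ht₀ : ‖t₀‖ = 1) (hd₀ : ‖d₀‖ = 1) (htd : inner ℝ t₀ d₀ = 0)
    (hfin : ∃ w ∈ B.admissible x₀ t₀ d₀ θ n ℓ, KirchhoffRod.Rod.Eloop w < ⊤) :
    ∃ w ∈ B.admissible x₀ t₀ d₀ θ n ℓ,
      IsMinOn (fun v : B.V => KirchhoffRod.Rod.Eloop v) (B.admissible x₀ t₀ d₀ θ n ℓ) w := by
  exact KirchhoffRod.Rod.exists_isMinOn_Eloop B ℓ θ n ht₀ hd₀ htd hfin
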